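/- **Setting.** Formulas are first-order formulas in negation normal form (literals, $\land,\lor,\exists,\forall$); $\bar A$ is the de Morgan dual of $A$. *Expansion trees* $E$ and their shallow formulas $\mathrm{Sh}(E)$ are defined inductively: a literal $L$ is one, with $\mathrm{Sh}(L)=L$; $E_1\circ E_2$ for $\circ\in\{\land,\lor\}$, with $\mathrm{Sh}(E_1\circ E_2)=\mathrm{Sh}(E_1)\circ\mathrm{Sh}(E_2)$; $\exists x\,A+^{t_1}E_1\cdots+^{t_n}E_n$ with $n\ge 0$, $t_1,\dots,t_n$ pairwise distinct terms and $\mathrm{Sh}(E_i)=A[x\backslash t_i]$, with shallow formula $\exists x\,A$; and $\forall x\,A+^{\alpha}E_0$ with $\mathrm{Sh}(E_0)=A[x\backslash\alpha]$, with shallow formula $\forall x\,A$. The $+^{t_i}$ and $+^\alpha$ are called ($\exists$- and $\forall$-)expansions; each dominates the expansions in its own subtree; $\alpha$ is the eigenvariable of $+^\alpha$. The deep formula $\mathrm{Dp}(E)$ is obtained by replacing $\exists x\,A+^{t_1}E_1\cdots+^{t_n}E_n$ by $\bigvee_i\mathrm{Dp}(E_i)$ and $\forall x\,A+^\alpha E_0$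 by $\mathrm{Dp}(E_0)$. A *cut* is a pair $C=\{E_1,E_2\}$ of expansion trees with $\mathrm{Sh}(E_1)=\overline{\mathrm{Sh}(E_2)}$; its cut-formula $\mathrm{Sh}(C)$ is the one of the two shallow formulas that is positive (a positive literal, or with top symbol $\lor$ or $\exists$), and $\mathrm{Dp}(C)=\mathrm{Dp}(E_1)\land\mathrm{Dp}(E_2)$. An *expansion pre-proof* $\mathcal P=\mathcal C,\mathcal E$ consists of a finite set $\mathcal C$ of cuts with pairwise different cut-formulas and a finite set $\mathcal E$ of expansion trees of pairwise different closed formulas, such that different $\forall$-expansions in $\mathcal P$ have different eigenvariables. Its shallow sequent is $\mathrm{Sh}(\mathcal P)=\mathrm{Sh}(\mathcal E)$ and its deep sequent is $\mathrm{Dp}(\mathcal P)=\mathrm{Dp}(\mathcal E),\mathrm{Dp}(\mathcal C)$. The *dependency relation* of $\mathcal P$ is the transitive closure of the relation $<^0$ on the expansions and cuts of $\mathcal P$ in which $v<^0w$ if the term of the $\exists$-expansion $w$ contains the eigenvariable of the $\forall$-expansion $v$, or $v$ dominates $w$; $C<^0v$ if $v$ is an expansion in the cut $C$; and $v<^0C$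 if $\mathrm{Sh}(C)$ contains the eigenvariable of $v$. An *expansion proof* is an expansion pre-proof whose dependency relation is acyclic and whose deep sequent is a propositional tautology. It is *cut-free* if $\mathcal C=\emptyset$. **Substitution and merge.** Allow in addition merge nodes $E_1\sqcup E_2$ with $\mathrm{Sh}(E_1)=\mathrm{Sh}(E_2)$. A substitution $\sigma$ (mapping eigenvariables to variables) acts on trees homomorphically, except that in $(\exists x\,A+^{t_1}E_1\cdots+^{t_n}E_n)\sigma$ the subtrees $E_i\sigma$ with the same term $t_i\sigma$ are joined by $\sqcup$. Merge reduction rewrites, anywhere in a collection of cuts and trees, $L\sqcup L$ to $L$; $(E_1'\circ E_1'')\sqcup(E_2'\circ E_2'')$ to $(E_1'\sqcup E_2')\circ(E_1''\sqcup E_2'')$; $(\forall x\,A+^{\alpha_1}E_1)\sqcup(\forall x\,A+^{\alpha_2}E_2)$ to $\forall x\,A+^{\alpha_1}(E_1\sqcup E_2)$ while replacing $\alpha_2$ by $\alpha_1$ everywhere in the collection; two existential trees joined by $\sqcup$ to the tree with all the expansions of both, the subtrees of expansions with a common term being joined by $\sqcup$; two trees outside of cuts with the same shallow formula to their $\sqcup$;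 and two cuts with the same shallow formulas to the cut formed of the $\sqcup$ of their positive and the $\sqcup$ of their negative trees. The union $\cup$ of collections means a normal form of their juxtaposition under merge reduction. **Cut reduction.** The one-step relation $\mapsto$ between expansion pre-proofs is given by the rules $$\{\exists x\,A+^{t_1}E_1\cdots+^{t_n}E_n,\ \forall x\,\bar A+^\alpha E\},\mathcal P\ \mapsto\ \mathcal P\cup\Bigl\{\bigvee_{i=1}^nE_i,\ \bigwedge_{i=1}^nE\eta_i[\alpha\backslash t_i]\Bigr\}\cup\bigcup_{i=1}^n\mathcal P\eta_i[\alpha\backslash t_i],$$ $$\{E_1\lor E_2,\ E_1'\land E_2'\},\mathcal P\ \mapsto\ \{E_1,E_1'\}\cup\{E_2,E_2'\}\cup\mathcal P,\qquad \{A,\bar A\},\mathcal P\ \mapsto\ \mathcal P\ \text{ for an atom } A,$$ where $\eta_1,\dots,\eta_n$ rename the eigenvariables of $\mathcal P,E$ to pairwise different fresh variables, and where for $n=0$ the first rule just deletes the cut. Let $\rightarrow$ be the reflexive and transitive closure of $\mapsto$. **Theorem (Weak Normalization).** For every expansion proof $\mathcal P$ there is a cut-free expansion proof $\mathcal P^*$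 with $\mathrm{Sh}(\mathcal P)=\mathrm{Sh}(\mathcal P^*)$ and $\mathcal P\rightarrow\mathcal P^*$. -/

import Mathlib

universe u v

namespace ExpansionCut

/-! ## First-order formulas in negation normal form

The free variables are the natural numbers; a formula in `NNF L n` may in addition contain the
bound variables `0, …, n - 1`, a quantifier binding the variable with the largest index (the
convention of Mathlib's `BoundedFormula`). -/

/-- Formulas in negation normal form. The literal with `b = true` is the atom `R(ts)`, the one
with `b = false` the negated atom. -/
inductive NNF (L : FirstOrder.Language.{u, v}) : ℕ → Type (max u v)
  | lit {n l : ℕ} (b : Bool) (R : L.Relations l) (ts : Fin l → L.Term (ℕ ⊕ Fin n)) : NNF L n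
  | and {n : ℕ} (A B : NNF L n) : NNF L n
  | or {n : ℕ} (A B : NNF L n) : NNF L n
  | ex {n : ℕ} (A : NNF L (n + 1)) : NNF L n
  | all {n : ℕ} (A : NNF L (n + 1)) : NNF L n

namespace NNF

variable {L : FirstOrder.Language.{u, v}}

/-- The de Morgan dual. -/
def dual : {n : ℕ} → NNF L n → NNF L n
  | _, lit b R ts => lit (!b) R ts
  | _, and A B => or A.dual B.dual
  | _, or A B => and A.dual B.dual
  | _, ex A => all A.dual
  | _, all A => ex A.dual

/-- Substitution for the free variables. -/
def subst (σ : ℕ → L.Term ℕ) : {n : ℕ} → NNF L n → NNF L n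
  | _, lit b R ts => lit b R fun i =>
      (ts i).subst (Sum.elim (fun x => (σ x).relabel Sum.inl) (fun j => FirstOrder.Language.Term.var (Sum.inr j)))
  | _, and A B => and (A.subst σ) (B.subst σ)
  | _, or A B => or (A.subst σ) (B.subst σ)
  | _, ex A => ex (A.subst σ)
  | _, all A => all (A.subst σ)

/-- Replace the outermost bound variable (the one with index `0`) by the term `t`. For
`A : NNF L 1` and a quantified formula `QxA`, this is `A[x\t]`. -/
def inst (t : L.Term ℕ) : {n : ℕ} → NNF L (n + 1) → NNF L n
  | _, lit b R ts => lit b R fun i =>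
      (ts i).subst (Sum.elim (fun x => FirstOrder.Language.Term.var (Sum.inl x))
        (Fin.cases (t.relabel Sum.inl) (fun j => FirstOrder.Language.Term.var (Sum.inr j))))
  | _, and A B => and (A.inst t) (B.inst t)
  | _, or A B => or (A.inst t) (B.inst t)
  | _, ex A => ex (A.inst t)
  | _, all A => all (A.inst t)

/-- The set of free variables. -/
def fv : {n : ℕ} → NNF L n → Set ℕ
  | _, lit _ _ ts => {x | ∃ i, x ∈ (ts i).varFinsetLeft}
  | _, and A B => A.fv ∪ B.fv
  | _, or A B => A.fv ∪ B.fv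
  | _, ex A => A.fv
  | _, all A => A.fv

/-- A formula is positive if its top connective is `∨` or `∃` or if it is a positive literal. -/
def positive : {n : ℕ} → NNF L n → Bool
  | _, lit b _ _ => b
  | _, and _ _ => false
  | _, or _ _ => true
  | _, ex _ => true
  | _, all _ => false

end NNF

/-- Quantifier-free formulas, with `bot` for the empty disjunction. -/
inductive PForm (L : FirstOrder.Language.{u, v}) : Type (max u v)
  | lit {l : ℕ} (b : Bool) (R : L.Relations l) (ts : Fin l → L.Term ℕ) : PForm L
  | bot : PForm L
  | and (A B : PForm L) : PForm L
  | or (A B : PForm L) : PForm L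

/-- Truth of a quantifier-free formula under a propositional valuation of the atoms. -/
def PForm.eval {L : FirstOrder.Language.{u, v}}
    (val : (l : ℕ) → L.Relations l → (Fin l → L.Term ℕ) → Prop) : PForm L → Prop
  | lit true R ts => val _ R ts
  | lit false R ts => ¬ val _ R ts
  | bot => False
  | and A B => A.eval val ∧ B.eval val
  | or A B => A.eval val ∨ B.eval val

/-! ## Expansion trees (with merges) -/

/-- The syntax of expansion trees with merges, subject to `ETree.WF` below.
The tree `∃x A +^{t₁} E₁ ⋯ +^{tₙ} Eₙ` is built up as in this notation, from the tree `ex A`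
without expansions (`n = 0`) by adding `+^{tᵢ} Eᵢ` one after the other on the right, where
`exp F t E` stands for `F +^t E`; `all A a E` stands for `∀x A +^a E` and `merge` for `⊔`. -/
inductive ETree (L : FirstOrder.Language.{u, v}) : Type (max u v)
  | lit {l : ℕ} (b : Bool) (R : L.Relations l) (ts : Fin l → L.Term ℕ) : ETree L
  | and (E F : ETree L) : ETree L
  | or (E F : ETree L) : ETree L
  | ex (A : NNF L 1) : ETree L
  | exp (F : ETree L) (t : L.Term ℕ) (E : ETree L) : ETree L
  | all (A : NNF L 1) (a : ℕ) (E : ETree L) : ETree L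
  | merge (E F : ETree L) : ETree L

namespace ETree

variable {L : FirstOrder.Language.{u, v}}

/-- The shallow formula. -/
def Sh : ETree L → NNF L 0
  | lit b R ts => NNF.lit b R fun i => (ts i).relabel Sum.inl
  | and E F => NNF.and E.Sh F.Sh
  | or E F => NNF.or E.Sh F.Sh
  | ex A => NNF.ex A
  | exp F _ _ => F.Sh
  | all A _ _ => NNF.all A
  | merge E _ => E.Sh

/-- The deep formula. -/
def Dp : ETree L → PForm L
  | lit b R ts => PForm.lit b R ts
  | and E F => PForm.and E.Dp F.Dp
  | or E F => PForm.or E.Dp F.Dp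
  | ex _ => PForm.bot
  | exp F _ E => PForm.or F.Dp E.Dp
  | all _ _ E => E.Dp
  | merge E F => PForm.or E.Dp F.Dp

/-- `E.exBody = some A` if `E` is of the form `∃x A +^{t₁} E₁ ⋯ +^{tₙ} Eₙ`. -/
def exBody : ETree L → Option (NNF L 1)
  | ex A => some A
  | exp F _ _ => F.exBody
  | _ => none

/-- The list `(t₁, E₁), …, (tₙ, Eₙ)` for a tree `∃x A +^{t₁} E₁ ⋯ +^{tₙ} Eₙ`. -/
def expansions : ETree L → List (L.Term ℕ × ETree L)
  | exp F t E => F.expansions ++ [(t, E)]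
  | _ => []

/-- The expansion terms `t₁, …, tₙ` of a tree `∃x A +^{t₁} E₁ ⋯ +^{tₙ} Eₙ`. -/
def terms (E : ETree L) : List (L.Term ℕ) := E.expansions.map Prod.fst

/-- `E` is an expansion tree (without merges). -/
def WF : ETree L → Prop
  | lit _ _ _ => True
  | and E F => E.WF ∧ F.WF
  | or E F => E.WF ∧ F.WF
  | ex _ => True
  | exp F t E => F.WF ∧ E.WF ∧ t ∉ F.terms ∧ ∃ A, F.exBody = some A ∧ E.Sh = A.inst t
  | all A a E => E.WF ∧ E.Sh = A.inst (FirstOrder.Language.Term.var a)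
  | merge _ _ => False

/-- The eigenvariables, one for each `∀`-expansion. -/
def EV : ETree L → Multiset ℕ
  | lit _ _ _ => 0
  | and E F => E.EV + F.EV
  | or E F => E.EV + F.EV
  | ex _ => 0
  | exp F _ E => F.EV + E.EV
  | all _ a E => a ::ₘ E.EV
  | merge E F => E.EV + F.EV

/-- All variables that occur (as eigenvariables or free in a term or formula). -/
def vars : ETree L → Set ℕ
  | lit _ _ ts => {x | ∃ i, x ∈ (ts i).varFinset}
  | and E F => E.vars ∪ F.vars
  | or E F => E.vars ∪ F.vars
  | ex A => A.fv
  | exp F t E => F.vars ∪ {x | x ∈ t.varFinset} ∪ E.vars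
  | all A a E => A.fv ∪ {a} ∪ E.vars
  | merge E F => E.vars ∪ F.vars

open Classical in
/-- Replace the subtree `G` of the expansion `+^t G` of `F` by `G ⊔ E`. -/
noncomputable def absorb : ETree L → L.Term ℕ → ETree L → ETree L
  | exp F s G, t, E => if s = t then exp F s (merge G E) else exp (F.absorb t E) s G
  | F, _, _ => F

open Classical in
/-- Add the expansion `+^t E` to `F`, with a merge node if `F` already has an expansion with
the term `t`. -/
noncomputable def addExp (F : ETree L) (t : L.Term ℕ) (E : ETree L) : ETree L :=
  if t ∈ F.terms then F.absorb t E else exp F t E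

/-- The variable `aσ`, for a substitution `σ` that maps `a` to a variable (the only case in
which a substitution is applied to a tree with eigenvariable `a`). -/
def substVar (σ : ℕ → L.Term ℕ) (a : ℕ) : ℕ :=
  match σ a with
  | FirstOrder.Language.Term.var b => b
  | _ => a

/-- Substitution: subtrees of `∃`-expansions whose terms become equal are joined by `⊔`. -/
noncomputable def subst (σ : ℕ → L.Term ℕ) : ETree L → ETree L
  | lit b R ts => lit b R fun i => (ts i).subst σ
  | and E F => and (E.subst σ) (F.subst σ)
  | or E F => or (E.subst σ) (F.subst σ)
  | ex A => ex (A.subst σ)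
  | exp F t E => (F.subst σ).addExp (t.subst σ) (E.subst σ)
  | all A a E => all (A.subst σ) (substVar σ a) (E.subst σ)
  | merge E F => merge (E.subst σ) (F.subst σ)

/-- Add all the expansions of the second tree to the first: expansions with a common term get
the subtree `E₁ ⊔ E₂`, all others are kept. -/
noncomputable def unionEx (E : ETree L) : ETree L → ETree L
  | exp F t G => (E.unionEx F).addExp t G
  | _ => E

/-- The subtree at a position. At a binary node (and at `F +^t E`) `false` leads to the first
and `true` to the second component; at `∀x A +^a E`, `true` leads to `E`. -/
def sub : ETree L → List Bool → Option (ETree L)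
  | E, [] => some E
  | and E _, false :: p => E.sub p
  | and _ F, true :: p => F.sub p
  | or E _, false :: p => E.sub p
  | or _ F, true :: p => F.sub p
  | exp F _ _, false :: p => F.sub p
  | exp _ _ E, true :: p => E.sub p
  | all _ _ E, true :: p => E.sub p
  | merge E _, false :: p => E.sub p
  | merge _ F, true :: p => F.sub p
  | _, _ :: _ => none

/-- `E₁ ∨ (E₂ ∨ ⋯)` for a non-empty list. -/
def bigOr (E : ETree L) : List (ETree L) → ETree L
  | [] => E
  | F :: l => or E (bigOr F l)

/-- `E₁ ∧ (E₂ ∧ ⋯)` for a non-empty list. -/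
def bigAnd (E : ETree L) : List (ETree L) → ETree L
  | [] => E
  | F :: l => and E (bigAnd F l)

/-- Closure of a relation on trees under contexts: `Ctx R (D[E]) (D[E'])` if `R E E'`. -/
inductive Ctx (R : ETree L → ETree L → Prop) : ETree L → ETree L → Prop
  | hole {E E'} : R E E' → Ctx R E E'
  | and_left {E E'} (F) : Ctx R E E' → Ctx R (and E F) (and E' F)
  | and_right {F F'} (E) : Ctx R F F' → Ctx R (and E F) (and E F')
  | or_left {E E'} (F) : Ctx R E E' → Ctx R (or E F) (or E' F)
  | or_right {F F'} (E) : Ctx R F F' → Ctx R (or E F) (or E F')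
  | exp_left {F F'} (t E) : Ctx R F F' → Ctx R (exp F t E) (exp F' t E)
  | exp_right {E E'} (F t) : Ctx R E E' → Ctx R (exp F t E) (exp F t E')
  | all {E E'} (A a) : Ctx R E E' → Ctx R (all A a E) (all A a E')
  | merge_left {E E'} (F) : Ctx R E E' → Ctx R (merge E F) (merge E' F)
  | merge_right {F F'} (E) : Ctx R F F' → Ctx R (merge E F) (merge E F')

/-- The merge reductions that do not involve a renaming of variables. -/
inductive LocalRule : ETree L → ETree L → Prop
  | lit {l : ℕ} (b : Bool) (R : L.Relations l) (ts : Fin l → L.Term ℕ) :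
      LocalRule (merge (lit b R ts) (lit b R ts)) (lit b R ts)
  | and (E₁ F₁ E₂ F₂ : ETree L) :
      LocalRule (merge (and E₁ F₁) (and E₂ F₂)) (and (merge E₁ E₂) (merge F₁ F₂))
  | or (E₁ F₁ E₂ F₂ : ETree L) :
      LocalRule (merge (or E₁ F₁) (or E₂ F₂)) (or (merge E₁ E₂) (merge F₁ F₂))
  | ex (E₁ E₂ : ETree L) (A : NNF L 1) : E₁.exBody = some A → E₂.exBody = some A →
      LocalRule (merge E₁ E₂) (E₁.unionEx E₂)

/-- The local part of the merge reduction of `(∀x A +^a E₁) ⊔ (∀x A +^b E₂)`; it comes with the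
global renaming of `b` to `a`. -/
inductive AllRule (a b : ℕ) : ETree L → ETree L → Prop
  | all (A : NNF L 1) (E₁ E₂ : ETree L) :
      AllRule a b (merge (all A a E₁) (all A b E₂)) (all A a (merge E₁ E₂))

end ETree

/-- The substitution `[a\t]`. -/
def single {L : FirstOrder.Language.{u, v}} (a : ℕ) (t : L.Term ℕ) : ℕ → L.Term ℕ :=
  Function.update FirstOrder.Language.Term.var a t

/-! ## Cuts and expansion pre-proofs -/

/-- A cut as an ordered pair, the first component being the positive one. -/
abbrev Cut (L : FirstOrder.Language.{u, v}) : Type (max u v) := ETree L × ETree L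

/-- The cut `{E, F}`, written with the positive tree first. -/
def mkCut {L : FirstOrder.Language.{u, v}} (E F : ETree L) : Cut L :=
  if E.Sh.positive then (E, F) else (F, E)

/-- A collection of cuts and expansion trees, possibly with merges; it is an expansion pre-proof
if it satisfies `IsPreProof` below. -/
structure RawProof (L : FirstOrder.Language.{u, v}) : Type (max u v) where
  cuts : Multiset (Cut L)
  trees : Multiset (ETree L)

namespace RawProof

variable {L : FirstOrder.Language.{u, v}}

/-- The shallow sequent, to which the cuts do not contribute. -/
def Sh (P : RawProof L) : Multiset (NNF L 0) := P.trees.map ETree.Sh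

/-- The deep sequent. -/
def Dp (P : RawProof L) : Multiset (PForm L) :=
  P.trees.map ETree.Dp + P.cuts.map fun C => PForm.and C.1.Dp C.2.Dp

/-- The eigenvariables, one for each `∀`-expansion. -/
def EV (P : RawProof L) : Multiset ℕ :=
  P.trees.bind ETree.EV + P.cuts.bind fun C => C.1.EV + C.2.EV

/-- All variables that occur. -/
def vars (P : RawProof L) : Set ℕ :=
  {x | (∃ E ∈ P.trees, x ∈ E.vars) ∨ ∃ C ∈ P.cuts, x ∈ C.1.vars ∪ C.2.vars}

/-- Expansion pre-proofs (without merges). -/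
structure IsPreProof (P : RawProof L) : Prop where
  tree_wf : ∀ E ∈ P.trees, E.WF
  cut_wf : ∀ C ∈ P.cuts, C.1.WF ∧ C.2.WF
  cut_dual : ∀ C ∈ P.cuts, C.2.Sh = C.1.Sh.dual
  cut_positive : ∀ C ∈ P.cuts, C.1.Sh.positive = true
  trees_distinct : (P.trees.map ETree.Sh).Nodup
  cuts_distinct : (P.cuts.map fun C => C.1.Sh).Nodup
  regular : P.EV.Nodup
  closed : ∀ A ∈ P.Sh, A.fv = ∅

/-! ### The dependency relation -/

/-- The places where trees occur in an expansion pre-proof (in which all trees of the end-sequent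
are different, and so are all cuts). -/
inductive Root (L : FirstOrder.Language.{u, v}) : Type (max u v)
  | tree (E : ETree L) : Root L
  | pos (C : Cut L) : Root L
  | neg (C : Cut L) : Root L

/-- The tree at a place. -/
def Root.content : Root L → ETree L
  | tree E => E
  | pos C => C.1
  | neg C => C.2

/-- The place belongs to `P`. -/
def Root.In (P : RawProof L) : Root L → Prop
  | tree E => E ∈ P.trees
  | pos C => C ∈ P.cuts
  | neg C => C ∈ P.cuts

/-- Cuts, and occurrences of expansions (a place and a position in the tree at that place). -/
inductive Node (L : FirstOrder.Language.{u, v}) : Type (max u v)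
  | cut (C : Cut L) : Node L
  | expansion (r : Root L) (p : List Bool) : Node L

/-- There is a `∀`-expansion with eigenvariable `a` at this position of `P`. -/
def AllAt (P : RawProof L) (r : Root L) (p : List Bool) (a : ℕ) : Prop :=
  r.In P ∧ ∃ A E, r.content.sub p = some (ETree.all A a E)

/-- There is an `∃`-expansion with term `t` at this position of `P`. -/
def ExAt (P : RawProof L) (r : Root L) (p : List Bool) (t : L.Term ℕ) : Prop :=
  r.In P ∧ ∃ F E, r.content.sub p = some (ETree.exp F t E)

/-- There is an expansion at this position of `P`. -/
def ExpansionAt (P : RawProof L) (r : Root L) (p : List Bool) : Prop :=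
  (∃ a, P.AllAt r p a) ∨ ∃ t, P.ExAt r p t

/-- The relation `<⁰` whose transitive closure is the dependency relation. An expansion dominates
the expansions in its subtree, which is found by going to `true` from its position. -/
inductive Lt0 (P : RawProof L) : Node L → Node L → Prop
  | term {r p a s q t} : P.AllAt r p a → P.ExAt s q t → a ∈ t.varFinset →
      Lt0 P (Node.expansion r p) (Node.expansion s q)
  | dominates {r p q} : P.ExpansionAt r p → P.ExpansionAt r (p ++ true :: q) →
      Lt0 P (Node.expansion r p) (Node.expansion r (p ++ true :: q))
  | in_pos {C p} : C ∈ P.cuts → P.ExpansionAt (Root.pos C) p →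
      Lt0 P (Node.cut C) (Node.expansion (Root.pos C) p)
  | in_neg {C p} : C ∈ P.cuts → P.ExpansionAt (Root.neg C) p →
      Lt0 P (Node.cut C) (Node.expansion (Root.neg C) p)
  | cut_formula {r p a C} : P.AllAt r p a → C ∈ P.cuts → a ∈ C.1.Sh.fv →
      Lt0 P (Node.expansion r p) (Node.cut C)

/-- The dependency relation. -/
def Lt (P : RawProof L) : Node L → Node L → Prop := Relation.TransGen P.Lt0

/-- Expansion proofs: the dependency relation is acyclic and the deep sequent is a tautology. -/
structure IsProof (P : RawProof L) : Prop where
  preProof : P.IsPreProof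
  acyclic : ∀ x, ¬ P.Lt x x
  tautology : ∀ val, ∃ A ∈ P.Dp, A.eval val

/-! ### Substitution and merge -/

/-- Substitution. -/
noncomputable def subst (σ : ℕ → L.Term ℕ) (P : RawProof L) : RawProof L where
  cuts := P.cuts.map fun C => (C.1.subst σ, C.2.subst σ)
  trees := P.trees.map (ETree.subst σ)

/-- Apply a relation on expansion trees to one tree in `P`. -/
inductive InTree (R : ETree L → ETree L → Prop) : RawProof L → RawProof L → Prop
  | tree {E E'} (cuts trees) : R E E' → InTree R ⟨cuts, E ::ₘ trees⟩ ⟨cuts, E' ::ₘ trees⟩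
  | pos {E E'} (F cuts trees) : R E E' →
      InTree R ⟨(E, F) ::ₘ cuts, trees⟩ ⟨(E', F) ::ₘ cuts, trees⟩
  | neg {F F'} (E cuts trees) : R F F' →
      InTree R ⟨(E, F) ::ₘ cuts, trees⟩ ⟨(E, F') ::ₘ cuts, trees⟩

/-- One step of the merge reduction. Besides the reductions of merge nodes, it merges two trees
of the same formula and two cuts with the same formulas. (Renaming an eigenvariable can make
cut-formulas equal, so that these steps cannot be separated from the others.) -/
inductive MergeStep : RawProof L → RawProof L → Prop
  | loc {P Q} : InTree (ETree.Ctx ETree.LocalRule) P Q → MergeStep P Q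
  | all {P Q} (a b : ℕ) : InTree (ETree.Ctx (ETree.AllRule a b)) P Q →
      MergeStep P (Q.subst (single b (FirstOrder.Language.Term.var a)))
  | trees (E F : ETree L) (cuts trees) : E.Sh = F.Sh →
      MergeStep ⟨cuts, E ::ₘ F ::ₘ trees⟩ ⟨cuts, ETree.merge E F ::ₘ trees⟩
  | cuts (C D : Cut L) (cuts trees) : C.1.Sh = D.1.Sh → C.2.Sh = D.2.Sh →
      MergeStep ⟨C ::ₘ D ::ₘ cuts, trees⟩
        ⟨(ETree.merge C.1 D.1, ETree.merge C.2 D.2) ::ₘ cuts, trees⟩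

/-- `Q` is a normal form of `P` under the merge reduction. -/
def MergesTo (P Q : RawProof L) : Prop :=
  Relation.ReflTransGen MergeStep P Q ∧ ∀ Q', ¬ MergeStep Q Q'

/-! ### Cut reduction -/

/-- Renamings of the variables in `S` to pairwise different variables outside of `V`. -/
structure FreshRenamings {n : ℕ} (η : Fin n → ℕ → ℕ) (S V : Set ℕ) : Prop where
  fixed : ∀ i, ∀ x ∉ S, η i x = x
  fresh : ∀ i, ∀ x ∈ S, η i x ∉ V
  injective : ∀ i j, ∀ x ∈ S, ∀ y ∈ S, η i x = η j y → i = j ∧ x = y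

/-- The cut `{E₁ ∨ ⋯ ∨ Eₙ, F₁ ∧ ⋯ ∧ Fₙ}` for a list of pairs `(Eᵢ, Fᵢ)`; no cut for `n = 0`
(the cut between the empty disjunction and the empty conjunction). -/
def disjunctionCut : List (ETree L × ETree L) → Multiset (Cut L)
  | [] => 0
  | (E, F) :: l => {mkCut (ETree.bigOr E (l.map Prod.fst)) (ETree.bigAnd F (l.map Prod.snd))}

/-- The collection `P, {E₁ ∨ ⋯ ∨ Eₙ, Eη₁[a\t₁] ∧ ⋯ ∧ Eηₙ[a\tₙ]}, Pη₁[a\t₁], …, Pηₙ[a\tₙ]`,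
before merging, where `l` is the list of the pairs `(tᵢ, Eᵢ)`. -/
noncomputable def quantReduct (P : RawProof L) (l : List (L.Term ℕ × ETree L))
    (a : ℕ) (E : ETree L) (η : Fin l.length → ℕ → ℕ) : RawProof L where
  cuts := P.cuts +
    disjunctionCut (List.ofFn fun i : Fin l.length =>
      ((l.get i).2,
        (E.subst fun x => FirstOrder.Language.Term.var (η i x)).subst (single a (l.get i).1))) +
    ∑ i : Fin l.length,
      ((P.subst fun x => FirstOrder.Language.Term.var (η i x)).subst (single a (l.get i).1)).cuts
  trees := P.trees +
    ∑ i : Fin l.length,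
      ((P.subst fun x => FirstOrder.Language.Term.var (η i x)).subst (single a (l.get i).1)).trees

/-- The cut-reduction rules. -/
inductive CutRule : RawProof L → RawProof L → Prop
  | quant (F : ETree L) (A : NNF L 1) (a : ℕ) (E : ETree L) (cuts : Multiset (Cut L))
      (trees : Multiset (ETree L)) (η : Fin F.expansions.length → ℕ → ℕ) (Q : RawProof L) :
      F.exBody = some A →
      FreshRenamings η {x | x ∈ (⟨cuts, trees⟩ : RawProof L).EV + E.EV}
        (vars ⟨(F, ETree.all A.dual a E) ::ₘ cuts, trees⟩) →
      MergesTo (quantReduct ⟨cuts, trees⟩ F.expansions a E η) Q →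
      CutRule ⟨(F, ETree.all A.dual a E) ::ₘ cuts, trees⟩ Q
  | prop (E₁ E₂ F₁ F₂ : ETree L) (cuts : Multiset (Cut L)) (trees : Multiset (ETree L))
      (Q : RawProof L) :
      MergesTo ⟨mkCut E₁ F₁ ::ₘ mkCut E₂ F₂ ::ₘ cuts, trees⟩ Q →
      CutRule ⟨(ETree.or E₁ E₂, ETree.and F₁ F₂) ::ₘ cuts, trees⟩ Q
  | atom {l : ℕ} (R : L.Relations l) (ts : Fin l → L.Term ℕ) (cuts : Multiset (Cut L))
      (trees : Multiset (ETree L)) :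
      CutRule ⟨(ETree.lit true R ts, ETree.lit false R ts) ::ₘ cuts, trees⟩ ⟨cuts, trees⟩

/-- One step of cut reduction, as a relation between expansion pre-proofs. -/
def CutStep (P Q : RawProof L) : Prop :=
  P.IsPreProof ∧ Q.IsPreProof ∧ CutRule P Q

/-- Reduction: the reflexive and transitive closure of `CutStep`. -/
def Reduces : RawProof L → RawProof L → Prop := Relation.ReflTransGen CutStep

/-- A pre-proof without cuts. -/
def CutFree (P : RawProof L) : Prop := P.cuts = 0

end RawProof

end ExpansionCut

/-
The dependency relation is acyclic iff the variables can be given levels such that every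
eigenvariable has a greater level than the variables on which its `∀`-expansion depends: those in
the expansion terms above it and in the quantified formula in which it is introduced. In this form
acyclicity is stable under merging and cut reduction.

Propositional and atomic cuts are reduced first. Among the quantified cuts of maximal depth, one is
then reduced whose cut-formula contains a variable of maximal level. The variables of lower level
occur in positions that the duplication of the proof does not affect, so that, by induction on the
level, merging identifies each of them with all its copies. These include the variables of all
cut-formulas of maximal depth, so that the copies of the other cuts of that depth are merged with
the originals, and the number of these cuts decreases.
-/

namespace ExpansionCut

open FirstOrder FirstOrder.Language

variable {L : FirstOrder.Language.{u, v}}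

section Terms

variable {α β γ δ : Type}

theorem term_subst_subst (σ : α → L.Term β) (τ : β → L.Term γ) (t : L.Term α) :
    (t.subst σ).subst τ = t.subst fun x => (σ x).subst τ := by
  induction t with
  | var => rfl
  | func f ts ih => simp [Term.subst, ih]

theorem term_subst_relabel (g : α → β) (τ : β → L.Term γ) (t : L.Term α) :
    (t.relabel g).subst τ = t.subst fun x => τ (g x) := by
  induction t with
  | var => rfl
  | func f ts ih => simp [Term.subst, ih]

theorem term_relabel_subst (σ : α → L.Term β) (g : β → γ) (t : L.Term α) :
    (t.subst σ).relabel g = t.subst fun x => (σ x).relabel g := by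
  induction t with
  | var => rfl
  | func f ts ih => simp [Term.subst, ih]

theorem term_subst_var (t : L.Term α) : t.subst Term.var = t := by
  induction t with
  | var => rfl
  | func f ts ih => simp [Term.subst, ih]

theorem term_subst_congr [DecidableEq α] {σ τ : α → L.Term β} (t : L.Term α)
    (h : ∀ x ∈ t.varFinset, σ x = τ x) : t.subst σ = t.subst τ := by
  induction t with
  | var => exact h _ (by simp)
  | func f ts ih =>
    simp only [Term.subst, Term.func.injEq, heq_eq_eq, true_and]
    funext i
    exact ih i fun x hx => h x (Finset.mem_biUnion.2 ⟨i, Finset.mem_univ i, hx⟩)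

theorem term_subst_congr_left [DecidableEq α] {σ τ : α ⊕ β → L.Term γ} (t : L.Term (α ⊕ β))
    (h : ∀ x ∈ t.varFinsetLeft, σ (Sum.inl x) = τ (Sum.inl x))
    (h' : ∀ y, σ (Sum.inr y) = τ (Sum.inr y)) : t.subst σ = t.subst τ := by
  induction t with
  | var x =>
    rcases x with x | y
    · exact h _ (by simp)
    · exact h' y
  | func f ts ih =>
    simp only [Term.subst, Term.func.injEq, heq_eq_eq, true_and]
    funext i
    exact ih i fun x hx => h x (Finset.mem_biUnion.2 ⟨i, Finset.mem_univ i, hx⟩)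

theorem mem_varFinset_subst [DecidableEq α] [DecidableEq β] {σ : α → L.Term β} {t : L.Term α}
    {y : β} : y ∈ (t.subst σ).varFinset ↔ ∃ x ∈ t.varFinset, y ∈ (σ x).varFinset := by
  induction t with
  | var => simp [Term.subst]
  | func f ts ih =>
    simp only [Term.subst, Term.varFinset, Finset.mem_biUnion, Finset.mem_univ, true_and, ih]
    grind

theorem mem_varFinsetLeft_subst [DecidableEq α] [DecidableEq β]
    {σ : α ⊕ γ → L.Term (β ⊕ δ)} {t : L.Term (α ⊕ γ)} {y : β}
    (h : y ∈ (t.subst σ).varFinsetLeft) :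
    (∃ x ∈ t.varFinsetLeft, y ∈ (σ (Sum.inl x)).varFinsetLeft) ∨
      ∃ z, y ∈ (σ (Sum.inr z)).varFinsetLeft := by
  induction t with
  | var x =>
    rcases x with x | z
    · exact Or.inl ⟨x, by simp, h⟩
    · exact Or.inr ⟨z, h⟩
  | func f ts ih =>
    simp only [Term.subst, Term.varFinsetLeft, Finset.mem_biUnion, Finset.mem_univ, true_and] at h ⊢
    obtain ⟨i, hi⟩ := h
    rcases ih i hi with ⟨x, hx, hy⟩ | hz
    · exact Or.inl ⟨x, ⟨i, hx⟩, hy⟩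
    · exact Or.inr hz

theorem varFinsetLeft_relabel_inl [DecidableEq α] (t : L.Term α) :
    (t.relabel (Sum.inl : α → α ⊕ β)).varFinsetLeft = t.varFinset := by
  induction t with
  | var => simp
  | func f ts ih => simp [ih]

theorem relabel_inl_injective {t s : L.Term α}
    (h : t.relabel (Sum.inl : α → α ⊕ β) = s.relabel Sum.inl) : t = s := by
  induction t generalizing s with
  | var => cases s <;> simp_all
  | func f ts ih =>
    cases s with
    | var => simp at h
    | func g us =>
      simp only [Term.relabel, Term.func.injEq] at h
      obtain ⟨rfl, h1, h2⟩ := h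
      rw [heq_eq_eq] at h1 h2
      subst h1
      congr
      funext i
      exact ih i (congrFun h2 i)

end Terms

namespace NNF

variable {n : ℕ}

@[simp] theorem dual_dual (A : NNF L n) : A.dual.dual = A := by
  induction A <;> simp_all [dual]

theorem dual_subst (σ : ℕ → L.Term ℕ) (A : NNF L n) : (A.subst σ).dual = A.dual.subst σ := by
  induction A <;> simp_all [dual, subst]

@[simp] theorem fv_dual (A : NNF L n) : A.dual.fv = A.fv := by
  induction A <;> simp_all [dual, fv]

theorem positive_dual (A : NNF L n) : A.dual.positive = !A.positive := by
  cases A <;> simp [dual, positive]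

@[simp] theorem positive_subst (σ : ℕ → L.Term ℕ) (A : NNF L n) :
    (A.subst σ).positive = A.positive := by
  cases A <;> simp [subst, positive]

theorem positive_inst (t s : L.Term ℕ) (A : NNF L (n + 1)) :
    (A.inst t).positive = (A.inst s).positive := by
  cases A <;> simp [inst, positive]

theorem dual_inst {n : ℕ} (t : L.Term ℕ) (A : NNF L (n + 1)) :
    (A.inst t).dual = A.dual.inst t := by
  match n, A with
  | _, lit .. => simp [dual, inst]
  | _, and A B => simp [dual, inst, dual_inst t A, dual_inst t B]
  | _, or A B => simp [dual, inst, dual_inst t A, dual_inst t B]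
  | _, ex A => simp [dual, inst, dual_inst t A]
  | _, all A => simp [dual, inst, dual_inst t A]

theorem subst_subst (σ τ : ℕ → L.Term ℕ) (A : NNF L n) :
    (A.subst σ).subst τ = A.subst fun x => (σ x).subst τ := by
  induction A with
  | lit b R ts =>
    simp only [subst, lit.injEq, heq_eq_eq, true_and]
    funext i
    rw [term_subst_subst]
    congr 1
    funext x
    rcases x with x | j
    · simp [term_subst_relabel, term_relabel_subst]
    · simp [Term.subst]
  | _ => simp_all [subst]

theorem subst_congr {σ τ : ℕ → L.Term ℕ} (A : NNF L n) (h : ∀ x ∈ A.fv, σ x = τ x) :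
    A.subst σ = A.subst τ := by
  induction A with
  | lit b R ts =>
    simp only [subst, lit.injEq, heq_eq_eq, true_and]
    funext i
    refine term_subst_congr_left _ (fun x hx => ?_) (fun y => rfl)
    simp [h x ⟨i, hx⟩]
  | _ => simp_all [subst, fv]

theorem subst_var (A : NNF L n) : A.subst Term.var = A := by
  induction A with
  | lit b R ts =>
    simp only [subst, lit.injEq, heq_eq_eq, true_and]
    funext i
    conv_rhs => rw [← term_subst_var (ts i)]
    congr 1
    funext x
    rcases x with x | j <;> rfl
  | _ => simp_all [subst]

theorem subst_eq_self {σ : ℕ → L.Term ℕ} {A : NNF L n} (h : A.fv = ∅) : A.subst σ = A := by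
  rw [subst_congr A (τ := Term.var) (by simp [h]), subst_var]

theorem subst_inst {n : ℕ} (σ : ℕ → L.Term ℕ) (t : L.Term ℕ) (A : NNF L (n + 1)) :
    (A.inst t).subst σ = (A.subst σ).inst (t.subst σ) := by
  match n, A with
  | _, lit b R ts =>
    simp only [subst, inst, lit.injEq, heq_eq_eq, true_and]
    funext i
    rw [term_subst_subst, term_subst_subst]
    congr 1
    funext x
    rcases x with x | j
    · simp only [Sum.elim_inl, Term.subst, term_subst_relabel]
      induction σ x with
      | var => rfl
      | func f ts ih => simp [Term.subst, ← ih]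
    · refine Fin.cases ?_ (fun j => ?_) j
      · simp [Term.subst, term_subst_relabel, term_relabel_subst]
      · simp [Term.subst]
  | _, and A B => simp [subst, inst, subst_inst σ t A, subst_inst σ t B]
  | _, or A B => simp [subst, inst, subst_inst σ t A, subst_inst σ t B]
  | _, ex A => simp [subst, inst, subst_inst σ t A]
  | _, all A => simp [subst, inst, subst_inst σ t A]

theorem mem_fv_subst {σ : ℕ → L.Term ℕ} {A : NNF L n} {y : ℕ} (h : y ∈ (A.subst σ).fv) :
    ∃ x ∈ A.fv, y ∈ (σ x).varFinset := by
  induction A with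
  | lit b R ts =>
    obtain ⟨i, hi⟩ := h
    rcases mem_varFinsetLeft_subst hi with ⟨x, hx, hy⟩ | ⟨z, hz⟩
    · exact ⟨x, ⟨i, hx⟩, by simpa [varFinsetLeft_relabel_inl] using hy⟩
    · simp at hz
  | and A B ihA ihB | or A B ihA ihB =>
    rcases h with h | h
    · obtain ⟨x, hx, hy⟩ := ihA h
      exact ⟨x, Or.inl hx, hy⟩
    · obtain ⟨x, hx, hy⟩ := ihB h
      exact ⟨x, Or.inr hx, hy⟩
  | ex A ih | all A ih => exact ih h

theorem mem_fv_inst {n : ℕ} {t : L.Term ℕ} {A : NNF L (n + 1)} {y : ℕ} (h : y ∈ (A.inst t).fv) :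
    y ∈ A.fv ∨ y ∈ t.varFinset := by
  match n, A with
  | _, lit b R ts =>
    simp only [inst, fv, Set.mem_ofPred_eq] at h
    obtain ⟨i, hi⟩ := h
    rcases mem_varFinsetLeft_subst hi with ⟨x, hx, hy⟩ | ⟨z, hz⟩
    · simp only [Sum.elim_inl, Term.varFinsetLeft, Finset.mem_singleton] at hy
      subst hy
      exact Or.inl ⟨i, hx⟩
    · revert hz
      refine Fin.cases ?_ (fun j => ?_) z
      · simpa [varFinsetLeft_relabel_inl] using Or.inr
      · simp
  | _, and A B | _, or A B =>
    simp only [inst, fv, Set.mem_union] at h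
    rcases h with h | h
    · exact (mem_fv_inst h).imp Or.inl id
    · exact (mem_fv_inst h).imp Or.inr id
  | _, ex A | _, all A =>
    simp only [inst, fv] at h
    exact mem_fv_inst (A := A) h

theorem fv_finite (A : NNF L n) : A.fv.Finite := by
  induction A with
  | lit b R ts =>
    refine (Finset.finite_toSet (Finset.univ.biUnion fun i => (ts i).varFinsetLeft)).subset ?_
    intro x hx
    simpa [fv] using hx
  | and A B ihA ihB | or A B ihA ihB => exact ihA.union ihB
  | ex _ ih | all _ ih => exact ih

/-- The quantifier depth, the main parameter of the termination argument. -/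
def qd : {n : ℕ} → NNF L n → ℕ
  | _, lit _ _ _ => 0
  | _, and A B => max A.qd B.qd
  | _, or A B => max A.qd B.qd
  | _, ex A => A.qd + 1
  | _, all A => A.qd + 1

/-- The number of connectives, quantifiers and literals. -/
def size : {n : ℕ} → NNF L n → ℕ
  | _, lit _ _ _ => 1
  | _, and A B => A.size + B.size + 1
  | _, or A B => A.size + B.size + 1
  | _, ex A => A.size + 1
  | _, all A => A.size + 1

/-- The number of quantified formulas of quantifier depth `r` from which the formula is built up
by propositional connectives. -/
def weight (r : ℕ) : {n : ℕ} → NNF L n → ℕ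
  | _, lit _ _ _ => 0
  | _, and A B => A.weight r + B.weight r
  | _, or A B => A.weight r + B.weight r
  | _, ex A => if A.qd + 1 = r then 1 else 0
  | _, all A => if A.qd + 1 = r then 1 else 0

@[simp] theorem qd_dual (A : NNF L n) : A.dual.qd = A.qd := by
  induction A <;> simp_all [dual, qd]

@[simp] theorem qd_subst (σ : ℕ → L.Term ℕ) (A : NNF L n) : (A.subst σ).qd = A.qd := by
  induction A <;> simp_all [subst, qd]

@[simp] theorem qd_inst {n : ℕ} (t : L.Term ℕ) (A : NNF L (n + 1)) : (A.inst t).qd = A.qd := by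
  match n, A with
  | _, lit .. => simp [qd, inst]
  | _, and A B => simp [qd, inst, qd_inst t A, qd_inst t B]
  | _, or A B => simp [qd, inst, qd_inst t A, qd_inst t B]
  | _, ex A => simp [qd, inst, qd_inst t A]
  | _, all A => simp [qd, inst, qd_inst t A]

@[simp] theorem size_dual (A : NNF L n) : A.dual.size = A.size := by
  induction A <;> simp_all [dual, size]

@[simp] theorem size_subst (σ : ℕ → L.Term ℕ) (A : NNF L n) : (A.subst σ).size = A.size := by
  induction A <;> simp_all [subst, size]

@[simp] theorem weight_dual (r : ℕ) (A : NNF L n) : A.dual.weight r = A.weight r := by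
  induction A <;> simp_all [dual, weight]

@[simp] theorem weight_subst (r : ℕ) (σ : ℕ → L.Term ℕ) (A : NNF L n) :
    (A.subst σ).weight r = A.weight r := by
  induction A <;> simp_all [subst, weight]

theorem weight_eq_zero {r : ℕ} {A : NNF L n} (h : A.qd < r) : A.weight r = 0 := by
  induction A with
  | lit => rfl
  | and A B ihA ihB | or A B ihA ihB =>
    simp only [qd, max_lt_iff] at h
    simp [weight, ihA h.1, ihB h.2]
  | ex A _ | all A _ =>
    simp only [qd] at h
    simp [weight, h.ne]

end NNF

/-! ### Paths -/

/-- The steps of a path in an expansion tree. The step into an `∃`-expansion records its term, so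
that a path survives the reordering of the expansions of an existential tree. -/
inductive Step (L : FirstOrder.Language.{u, v}) : Type u
  | left : Step L
  | right : Step L
  | ex (t : L.Term ℕ) : Step L
  | all : Step L

/-- A path in an expansion tree. -/
abbrev Path (L : FirstOrder.Language.{u, v}) : Type u := List (Step L)

/-- Substitution in the term recorded by a step. -/
def Step.subst (σ : ℕ → L.Term ℕ) : Step L → Step L
  | left => left
  | right => right
  | ex t => ex (t.subst σ)
  | all => all

/-- The variables in the term recorded by a step. -/
def Step.vars : Step L → Finset ℕ
  | ex t => t.varFinset
  | _ => ∅

/-- Substitution in the terms along a path. -/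
def Path.subst (σ : ℕ → L.Term ℕ) (p : Path L) : Path L := p.map (Step.subst σ)

/-- The variables in the terms along a path. -/
def Path.vars : Path L → Finset ℕ
  | [] => ∅
  | s :: p => s.vars ∪ Path.vars p

theorem Step.subst_subst (σ τ : ℕ → L.Term ℕ) (s : Step L) :
    (s.subst σ).subst τ = s.subst fun x => (σ x).subst τ := by
  cases s <;> simp [Step.subst, term_subst_subst]

theorem Path.subst_subst (σ τ : ℕ → L.Term ℕ) (p : Path L) :
    Path.subst τ (Path.subst σ p) = Path.subst (fun x => (σ x).subst τ) p := by
  simp [Path.subst, Step.subst_subst]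

theorem Path.subst_var (p : Path L) : Path.subst Term.var p = p := by
  induction p with
  | nil => rfl
  | cons s p ih =>
    simp only [Path.subst, List.map_cons] at ih ⊢
    rw [ih]
    cases s <;> simp [Step.subst, term_subst_var]

theorem Path.subst_congr {σ τ : ℕ → L.Term ℕ} (p : Path L)
    (h : ∀ x ∈ Path.vars p, σ x = τ x) : Path.subst σ p = Path.subst τ p := by
  induction p with
  | nil => rfl
  | cons s p ih =>
    simp only [Path.vars, Finset.mem_union] at h
    have hp := ih fun x hx => h x (Or.inr hx)
    simp only [Path.subst, List.map_cons] at hp ⊢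
    rw [hp]
    congr 1
    cases s with
    | ex t => exact congrArg Step.ex (term_subst_congr t fun x hx => h x (Or.inl hx))
    | _ => rfl

theorem Path.mem_vars_subst {σ : ℕ → L.Term ℕ} {p : Path L} {y : ℕ}
    (h : y ∈ Path.vars (Path.subst σ p)) : ∃ x ∈ Path.vars p, y ∈ (σ x).varFinset := by
  induction p with
  | nil => simp [Path.subst, Path.vars] at h
  | cons s p ih =>
    simp only [Path.subst, List.map_cons, Path.vars, Finset.mem_union] at h ih ⊢
    rcases h with h | h
    · cases s with
      | ex t =>
        obtain ⟨x, hx, hy⟩ := mem_varFinset_subst.1 h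
        exact ⟨x, Or.inl hx, hy⟩
      | _ => simp [Step.subst, Step.vars] at h
    · obtain ⟨x, hx, hy⟩ := ih h
      exact ⟨x, Or.inr hx, hy⟩

namespace NNF

/-- The subformula that is reached from the root along a path by passing only through
conjunctions and disjunctions. -/
def top {n : ℕ} : NNF L n → Path L → NNF L n
  | and A _, Step.left :: p => A.top p
  | and _ B, Step.right :: p => B.top p
  | or A _, Step.left :: p => A.top p
  | or _ B, Step.right :: p => B.top p
  | A, _ => A

theorem top_subst {n : ℕ} (σ : ℕ → L.Term ℕ) (A : NNF L n) (p : Path L) :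
    (A.subst σ).top (Path.subst σ p) = (A.top p).subst σ := by
  induction A generalizing p with
  | lit | ex | all => simp [subst, top]
  | and A B ihA ihB | or A B ihA ihB =>
    rcases p with _ | ⟨s, p⟩
    · simp [subst, top, Path.subst]
    · cases s with
      | left => simpa [subst, top, Path.subst, Step.subst] using ihA p
      | right => simpa [subst, top, Path.subst, Step.subst] using ihB p
      | _ => simp [subst, top, Path.subst, Step.subst]

theorem fv_top_subset {n : ℕ} (A : NNF L n) (p : Path L) : (A.top p).fv ⊆ A.fv := by
  induction A generalizing p with
  | lit | ex | all => simp [top]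
  | and A B ihA ihB | or A B ihA ihB =>
    rcases p with _ | ⟨s, p⟩
    · simp [top]
    · cases s with
      | left => exact (ihA p).trans Set.subset_union_left
      | right => exact (ihB p).trans Set.subset_union_right
      | _ => simp [top]

/-- The variables on which an eigenvariable depends that is introduced at the path `p` in one of the
trees, with shallow formula `A`, of a cut: those in the terms of the dominating expansions and those
in the component of the cut-formula that contains the path. -/
def deps (A : NNF L 0) (p : Path L) : Set ℕ := {y | y ∈ Path.vars p} ∪ (A.top p).fv

theorem mem_deps_subst {σ : ℕ → L.Term ℕ} {A : NNF L 0} {p : Path L} {y : ℕ}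
    (h : y ∈ deps (A.subst σ) (Path.subst σ p)) : ∃ x ∈ deps A p, y ∈ (σ x).varFinset := by
  rcases h with h | h
  · obtain ⟨x, hx, hy⟩ := Path.mem_vars_subst h
    exact ⟨x, Or.inl hx, hy⟩
  · rw [top_subst] at h
    obtain ⟨x, hx, hy⟩ := mem_fv_subst h
    exact ⟨x, Or.inr hx, hy⟩

end NNF

/-! ### Occurrences of eigenvariables -/

/-- An occurrence of a `∀`-expansion in a tree: the path to it and its eigenvariable. -/
abbrev Occ (L : FirstOrder.Language.{u, v}) : Type u := Path L × ℕ

/-- The occurrence in a larger tree, of which the present one is the subtree at the step `s`. -/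
def Occ.under (s : Step L) (o : Occ L) : Occ L := (s :: o.1, o.2)

/-- Substitution in an occurrence. -/
def Occ.subst (σ : ℕ → L.Term ℕ) (o : Occ L) : Occ L := (Path.subst σ o.1, ETree.substVar σ o.2)

theorem Occ.subst_under (σ : ℕ → L.Term ℕ) (s : Step L) (o : Occ L) :
    (o.under s).subst σ = (o.subst σ).under (s.subst σ) := rfl

/-- Propositional valuations of the quantifier-free formulas. -/
abbrev Valuation (L : FirstOrder.Language.{u, v}) : Type (max u v) :=
  (l : ℕ) → L.Relations l → (Fin l → L.Term ℕ) → Prop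

namespace ETree

/-- The `∀`-expansions of a tree, with multiplicity as long as the tree contains merge nodes (which
leave no trace in paths). -/
def occs : ETree L → Multiset (Occ L)
  | lit _ _ _ => 0
  | and E F => E.occs.map (Occ.under Step.left) + F.occs.map (Occ.under Step.right)
  | or E F => E.occs.map (Occ.under Step.left) + F.occs.map (Occ.under Step.right)
  | ex _ => 0
  | exp F t E => F.occs + E.occs.map (Occ.under (Step.ex t))
  | all _ a E => ([], a) ::ₘ E.occs.map (Occ.under Step.all)
  | merge E F => E.occs + F.occs

theorem map_snd_occs (E : ETree L) : E.occs.map Prod.snd = E.EV := by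
  induction E <;> simp_all [occs, EV, Occ.under, Function.comp_def]

theorem mem_EV_iff {E : ETree L} {a : ℕ} : a ∈ E.EV ↔ ∃ p, (p, a) ∈ E.occs := by
  simp [← map_snd_occs]

theorem Sh_of_exBody {E : ETree L} {A : NNF L 1} (h : E.exBody = some A) : E.Sh = NNF.ex A := by
  induction E with
  | ex => simpa [exBody, Sh] using h
  | exp F t G ihF _ => exact ihF h
  | _ => simp [exBody] at h

@[simp] theorem terms_exp (F : ETree L) (t : L.Term ℕ) (E : ETree L) :
    (exp F t E).terms = F.terms ++ [t] := by
  simp [terms, expansions]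

section AddExp

variable {F E : ETree L} {t : L.Term ℕ}

@[simp] theorem exBody_absorb : (F.absorb t E).exBody = F.exBody := by
  induction F with
  | exp F s G ihF _ =>
    rw [absorb]
    split_ifs <;> simp [exBody, ihF]
  | _ => rfl

@[simp] theorem terms_absorb : (F.absorb t E).terms = F.terms := by
  induction F with
  | exp F s G ihF _ =>
    rw [absorb]
    split_ifs <;> simp [ihF]
  | _ => rfl

@[simp] theorem Sh_absorb : (F.absorb t E).Sh = F.Sh := by
  induction F with
  | exp F s G ihF _ =>
    rw [absorb]
    split_ifs <;> simp [Sh, ihF]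
  | _ => rfl

@[simp] theorem exBody_addExp : (F.addExp t E).exBody = F.exBody := by
  rw [addExp]
  split_ifs <;> simp [exBody]

@[simp] theorem Sh_addExp : (F.addExp t E).Sh = F.Sh := by
  rw [addExp]
  split_ifs <;> simp [Sh]

theorem absorb_induction {motive : ETree L → ETree L → Prop}
    (here : ∀ F G, motive (exp F t G) (exp F t (merge G E)))
    (there : ∀ F F' s G, motive F F' → motive (exp F s G) (exp F' s G))
    (h : t ∈ F.terms) : motive F (F.absorb t E) := by
  induction F with
  | exp F s G ihF _ =>
    rw [absorb]
    split_ifs with hs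
    · exact hs ▸ here F G
    · have ht : t ∈ F.terms := by simpa [Ne.symm hs] using h
      exact there F _ s G (ihF ht)
  | _ => simp [terms, expansions] at h

theorem addExp_induction {motive : ETree L → ETree L → Prop}
    (fresh : ∀ F, motive F (exp F t E))
    (here : ∀ F G, motive (exp F t G) (exp F t (merge G E)))
    (there : ∀ F F' s G, motive F F' → motive (exp F s G) (exp F' s G)) :
    motive F (F.addExp t E) := by
  rw [addExp]
  split_ifs with h
  · exact absorb_induction here there h
  · exact fresh F

theorem occs_addExp : (F.addExp t E).occs = F.occs + E.occs.map (Occ.under (Step.ex t)) := by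
  refine addExp_induction
    (motive := fun F F' => F'.occs = F.occs + E.occs.map (Occ.under (Step.ex t)))
    (fun _ => rfl) (fun F G => ?_) (fun F F' s G ih => ?_)
  · simp [occs, add_assoc]
  · simp only [occs, ih]
    exact add_right_comm _ _ _

theorem eval_addExp (val : Valuation L) :
    (F.addExp t E).Dp.eval val ↔ F.Dp.eval val ∨ E.Dp.eval val := by
  refine addExp_induction
    (motive := fun F F' => (F'.Dp.eval val ↔ F.Dp.eval val ∨ E.Dp.eval val))
    (fun _ => Iff.rfl) (fun F G => ?_) (fun F F' s G ih => ?_)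
  · simp [Dp, PForm.eval, or_assoc]
  · simp only [Dp, PForm.eval, ih]
    exact or_right_comm

end AddExp

section UnionEx

variable {E F : ETree L} {A : NNF L 1}

@[simp] theorem exBody_unionEx (E F : ETree L) : (E.unionEx F).exBody = E.exBody := by
  induction F with
  | exp F t G ihF _ => simp [unionEx, ihF]
  | _ => rfl

@[simp] theorem Sh_unionEx (E F : ETree L) : (E.unionEx F).Sh = E.Sh := by
  induction F with
  | exp F t G ihF _ => simp [unionEx, ihF]
  | _ => rfl

theorem occs_unionEx (h : F.exBody = some A) : (E.unionEx F).occs = E.occs + F.occs := by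
  induction F with
  | ex => simp [unionEx, occs]
  | exp F t G ihF _ => simp [unionEx, occs_addExp, occs, ihF h, add_assoc]
  | _ => simp [exBody] at h

theorem eval_unionEx (h : F.exBody = some A) (val : Valuation L) :
    (E.unionEx F).Dp.eval val ↔ E.Dp.eval val ∨ F.Dp.eval val := by
  induction F with
  | ex => simp [unionEx, Dp, PForm.eval]
  | exp F t G ihF _ => simp [unionEx, eval_addExp, Dp, PForm.eval, ihF h, or_assoc]
  | _ => simp [exBody] at h

end UnionEx

section Subst

variable {σ : ℕ → L.Term ℕ}

@[simp] theorem substVar_var (ρ : ℕ → ℕ) (a : ℕ) :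
    substVar (fun x => (Term.var (ρ x) : L.Term ℕ)) a = ρ a := rfl

theorem substVar_eq {a b : ℕ} (h : σ a = Term.var b) : substVar σ a = b := by
  rw [substVar, h]

theorem exBody_subst {E : ETree L} {A : NNF L 1} (h : E.exBody = some A) :
    (E.subst σ).exBody = some (A.subst σ) := by
  induction E with
  | ex =>
    obtain rfl := Option.some.inj h
    rfl
  | exp F t G ihF _ => simpa [subst] using ihF h
  | _ => simp [exBody] at h

@[simp] theorem Sh_subst (σ : ℕ → L.Term ℕ) (E : ETree L) : (E.subst σ).Sh = E.Sh.subst σ := by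
  induction E with
  | lit => simp [subst, Sh, NNF.subst, term_subst_relabel, term_relabel_subst]
  | exp F t G ihF _ => simp [subst, Sh, ihF]
  | _ => simp_all [subst, Sh, NNF.subst]

theorem occs_subst (σ : ℕ → L.Term ℕ) (E : ETree L) :
    (E.subst σ).occs = E.occs.map (Occ.subst σ) := by
  induction E with
  | exp F t G ihF ihG =>
    simp [subst, occs, occs_addExp, ihF, ihG, Function.comp_def, Occ.subst_under, Step.subst]
  | all A a E ih =>
    simp only [subst, occs, ih, Multiset.map_cons, Multiset.map_map, Function.comp_def,
      Occ.subst_under]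
    rfl
  | _ => simp_all [subst, occs, Function.comp_def, Occ.subst_under, Step.subst]

theorem EV_subst (σ : ℕ → L.Term ℕ) (E : ETree L) :
    (E.subst σ).EV = E.EV.map (substVar σ) := by
  simp [← map_snd_occs, occs_subst, Occ.subst, Function.comp_def]

theorem eval_subst (σ : ℕ → L.Term ℕ) (E : ETree L) (val : Valuation L) :
    (E.subst σ).Dp.eval val ↔ E.Dp.eval fun l R ts => val l R fun i => (ts i).subst σ := by
  induction E with
  | lit b => cases b <;> simp [subst, Dp, PForm.eval]
  | exp F t G ihF ihG => simp [subst, eval_addExp, Dp, PForm.eval, ihF, ihG]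
  | _ => simp_all [subst, Dp, PForm.eval]

end Subst

theorem mem_terms_of_mem_occs {F : ETree L} {A : NNF L 1} (h : F.exBody = some A) {o : Occ L}
    (ho : o ∈ F.occs) : ∃ t q, o.1 = Step.ex t :: q ∧ t ∈ F.terms := by
  induction F with
  | ex => simp [occs] at ho
  | exp F t G ihF _ =>
    rcases Multiset.mem_add.1 ho with ho | ho
    · obtain ⟨s, q, hq, hs⟩ := ihF h ho
      exact ⟨s, q, hq, by simp [hs]⟩
    · obtain ⟨o, _, rfl⟩ := Multiset.mem_map.1 ho
      exact ⟨t, o.1, rfl, by simp⟩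
  | _ => simp [exBody] at h

theorem map_fst_map_under (s : Step L) (m : Multiset (Occ L)) :
    (m.map (Occ.under s)).map Prod.fst = (m.map Prod.fst).map (s :: ·) := by
  simp [Occ.under, Function.comp_def]

theorem nodup_under {s : Step L} {m : Multiset (Occ L)} (h : (m.map Prod.fst).Nodup) :
    ((m.map (Occ.under s)).map Prod.fst).Nodup := by
  rw [map_fst_map_under]
  exact h.map List.cons_injective

theorem WF.nodup_paths {E : ETree L} (h : E.WF) : (E.occs.map Prod.fst).Nodup := by
  induction E with
  | lit | ex => simp [occs]
  | and E F ihE ihF | or E F ihE ihF =>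
    rw [occs, Multiset.map_add]
    refine Multiset.nodup_add.2 ⟨nodup_under (ihE h.1), nodup_under (ihF h.2), ?_⟩
    simp only [map_fst_map_under, Multiset.disjoint_left, Multiset.mem_map]
    rintro _ ⟨p, _, rfl⟩ ⟨q, _, hq⟩
    simp at hq
  | exp F t E ihF ihE =>
    obtain ⟨hF, hE, ht, A, hA, _⟩ := h
    rw [occs, Multiset.map_add]
    refine Multiset.nodup_add.2 ⟨ihF hF, nodup_under (ihE hE), ?_⟩
    simp only [map_fst_map_under, Multiset.disjoint_left, Multiset.mem_map]
    rintro _ ⟨o, ho, rfl⟩ ⟨q, _, hq⟩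
    obtain ⟨s, q', hs, hs'⟩ := mem_terms_of_mem_occs hA ho
    rw [hs, List.cons.injEq, Step.ex.injEq] at hq
    exact ht (hq.1 ▸ hs')
  | all A c E ih =>
    rw [occs, Multiset.map_cons, Multiset.nodup_cons]
    exact ⟨by simp [Occ.under], nodup_under (ih h.1)⟩
  | merge => exact h.elim

theorem WF.occ_eq_of_path_eq {E : ETree L} (h : E.WF) {o o' : Occ L} (ho : o ∈ E.occs)
    (ho' : o' ∈ E.occs) (heq : o.1 = o'.1) : o = o' :=
  Multiset.inj_on_of_nodup_map h.nodup_paths o ho o' ho' heq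

/-! ### Well-formedness in the presence of merges -/

/-- Well-formedness of expansion trees with merges; the trees joined by a merge node have the same
shallow formula. -/
def MWF : ETree L → Prop
  | lit _ _ _ => True
  | and E F => E.MWF ∧ F.MWF
  | or E F => E.MWF ∧ F.MWF
  | ex _ => True
  | exp F t E => F.MWF ∧ E.MWF ∧ t ∉ F.terms ∧ ∃ A, F.exBody = some A ∧ E.Sh = A.inst t
  | all A a E => E.MWF ∧ E.Sh = A.inst (Term.var a)
  | merge E F => E.MWF ∧ F.MWF ∧ E.Sh = F.Sh

theorem WF.mwf {E : ETree L} (h : E.WF) : E.MWF := by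
  induction E with
  | lit | ex => trivial
  | and E F ihE ihF | or E F ihE ihF => exact ⟨ihE h.1, ihF h.2⟩
  | exp F t E ihF ihE => exact ⟨ihF h.1, ihE h.2.1, h.2.2⟩
  | all A a E ih => exact ⟨ih h.1, h.2⟩
  | merge => exact h.elim

section MWF

variable {E F : ETree L} {t : L.Term ℕ} {A : NNF L 1}

theorem MWF.absorb (hF : F.MWF) (hE : E.MWF) (hA : F.exBody = some A) (hS : E.Sh = A.inst t) :
    (F.absorb t E).MWF := by
  induction F with
  | exp F s G ihF _ =>
    obtain ⟨hF, hG, hs, B, hB, hGB⟩ := hF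
    obtain rfl : B = A := Option.some.inj (hB.symm.trans hA)
    rw [ETree.absorb]
    split_ifs with hst
    · subst hst
      exact ⟨hF, ⟨hG, hE, hGB.trans hS.symm⟩, hs, B, hB, hGB⟩
    · exact ⟨ihF hF hB, hG, by simpa using hs, B, by simpa using hB, hGB⟩
  | _ => exact hF

theorem MWF.addExp (hF : F.MWF) (hE : E.MWF) (hA : F.exBody = some A) (hS : E.Sh = A.inst t) :
    (F.addExp t E).MWF := by
  rw [ETree.addExp]
  split_ifs with h
  · exact hF.absorb hE hA hS
  · exact ⟨hF, hE, h, A, hA, hS⟩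

theorem MWF.unionEx (hE : E.MWF) (hF : F.MWF) (hA : E.exBody = some A)
    (hB : F.exBody = some A) : (E.unionEx F).MWF := by
  induction F with
  | ex => exact hE
  | exp F t G ihF _ =>
    obtain ⟨hF, hG, _, B, hFB, hGB⟩ := hF
    obtain rfl : B = A := Option.some.inj (hFB.symm.trans hB)
    exact (ihF hF hFB).addExp hG (by simpa using hA) hGB
  | _ => simp [exBody] at hB

theorem MWF.subst {σ : ℕ → L.Term ℕ} (h : E.MWF) (hσ : ∀ a ∈ E.EV, ∃ b, σ a = Term.var b) :
    (E.subst σ).MWF := by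
  induction E with
  | lit | ex => trivial
  | and E F ihE ihF | or E F ihE ihF =>
    simp only [EV, Multiset.mem_add] at hσ
    exact ⟨ihE h.1 fun a ha => hσ a (Or.inl ha), ihF h.2 fun a ha => hσ a (Or.inr ha)⟩
  | exp F t E ihF ihE =>
    simp only [EV, Multiset.mem_add] at hσ
    obtain ⟨hF, hE, _, A, hA, hS⟩ := h
    exact (ihF hF fun a ha => hσ a (Or.inl ha)).addExp (ihE hE fun a ha => hσ a (Or.inr ha))
      (exBody_subst hA) (by rw [Sh_subst, hS, NNF.subst_inst])
  | all A a E ih =>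
    simp only [EV, Multiset.mem_cons] at hσ
    obtain ⟨b, hb⟩ := hσ a (Or.inl rfl)
    refine ⟨ih h.1 fun a ha => hσ a (Or.inr ha), ?_⟩
    rw [Sh_subst, h.2, NNF.subst_inst, substVar_eq hb]
    simp [Term.subst, hb]
  | merge E F ihE ihF =>
    simp only [EV, Multiset.mem_add] at hσ
    exact ⟨ihE h.1 fun a ha => hσ a (Or.inl ha), ihF h.2.1 fun a ha => hσ a (Or.inr ha),
      by simp [h.2.2]⟩

end MWF

end ETree

/-! ### Merge reduction of trees -/

namespace ETree

/-- The number of nodes other than merges, which every merge reduction decreases. -/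
def nodes : ETree L → ℕ
  | lit _ _ _ => 1
  | and E F => E.nodes + F.nodes + 1
  | or E F => E.nodes + F.nodes + 1
  | ex _ => 1
  | exp F _ E => F.nodes + E.nodes + 1
  | all _ _ E => E.nodes + 1
  | merge E F => E.nodes + F.nodes

theorem nodes_addExp_le (F : ETree L) (t : L.Term ℕ) (E : ETree L) :
    (F.addExp t E).nodes ≤ F.nodes + E.nodes + 1 := by
  refine addExp_induction (motive := fun F F' => F'.nodes ≤ F.nodes + E.nodes + 1)
    (fun _ => le_rfl) (fun F G => ?_) (fun F F' s G ih => ?_)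
  · simp only [nodes]
    omega
  · simp only [nodes]
    omega

theorem nodes_unionEx_lt (E : ETree L) {F : ETree L} {A : NNF L 1} (h : F.exBody = some A) :
    (E.unionEx F).nodes < E.nodes + F.nodes := by
  induction F with
  | ex => simp [unionEx, nodes]
  | exp F t G ihF _ =>
    have := nodes_addExp_le (E.unionEx F) t G
    have := ihF h
    simp only [unionEx, nodes]
    omega
  | _ => simp [exBody] at h

theorem nodes_subst_le (σ : ℕ → L.Term ℕ) (E : ETree L) : (E.subst σ).nodes ≤ E.nodes := by
  induction E with
  | exp F t G ihF ihG =>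
    have := nodes_addExp_le (F.subst σ) (t.subst σ) (G.subst σ)
    simp only [subst, nodes]
    omega
  | _ => simp only [subst, nodes]; omega

/-- The relation only rewrites merge nodes, without changing the shallow formula. -/
def MergeHeaded (R : ETree L → ETree L → Prop) : Prop :=
  ∀ E E', R E E' → (∃ F G, E = merge F G) ∧ E'.Sh = E.Sh

theorem mergeHeaded_localRule : MergeHeaded (LocalRule (L := L)) := by
  rintro _ _ (_ | _ | _ | _)
  · exact ⟨⟨_, _, rfl⟩, rfl⟩
  · exact ⟨⟨_, _, rfl⟩, rfl⟩
  · exact ⟨⟨_, _, rfl⟩, rfl⟩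
  · exact ⟨⟨_, _, rfl⟩, by simp [Sh]⟩

theorem mergeHeaded_allRule (a b : ℕ) : MergeHeaded (AllRule (L := L) a b) := by
  rintro _ _ ⟨⟩
  exact ⟨⟨_, _, rfl⟩, rfl⟩

section Ctx

variable {R : ETree L → ETree L → Prop} {E E' : ETree L} {a b : ℕ}

theorem Ctx.Sh_eq (hR : MergeHeaded R) (h : Ctx R E E') : E'.Sh = E.Sh := by
  induction h with
  | hole h => exact (hR _ _ h).2
  | _ => simp_all [Sh]

theorem Ctx.exBody_terms_eq (hR : MergeHeaded R) (h : Ctx R E E') {A : NNF L 1}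
    (hA : E.exBody = some A) : E'.exBody = some A ∧ E'.terms = E.terms := by
  induction h with
  | hole h =>
    obtain ⟨⟨F, G, rfl⟩, _⟩ := hR _ _ h
    simp [exBody] at hA
  | exp_left t G _ ih =>
    obtain ⟨hB, ht⟩ := ih hA
    exact ⟨hB, by simp [ht]⟩
  | exp_right F t _ _ => exact ⟨hA, by simp⟩
  | _ => simp [exBody] at hA

theorem Ctx.nodes_lt (hR : ∀ E E', R E E' → E'.nodes < E.nodes) (h : Ctx R E E') :
    E'.nodes < E.nodes := by
  induction h with
  | hole h => exact hR _ _ h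
  | _ => simp only [nodes]; omega

theorem LocalRule.nodes_lt (h : LocalRule E E') : E'.nodes < E.nodes := by
  cases h with
  | ex _ _ A hA hB => exact nodes_unionEx_lt _ hB
  | _ => simp only [nodes]; omega

theorem AllRule.nodes_lt (h : AllRule a b E E') : E'.nodes < E.nodes := by
  cases h
  simp only [nodes]
  omega

theorem Ctx.eval {val : Valuation L} (hR : ∀ E E', R E E' → E.Dp.eval val → E'.Dp.eval val)
    (h : Ctx R E E') : E.Dp.eval val → E'.Dp.eval val := by
  induction h with
  | hole h => exact hR _ _ h
  | all _ _ _ ih => exact ih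
  | _ =>
    simp only [Dp, PForm.eval]
    tauto

theorem LocalRule.eval {val : Valuation L} (h : LocalRule E E') :
    E.Dp.eval val → E'.Dp.eval val := by
  cases h with
  | ex _ _ A hA hB => exact (eval_unionEx hB val).2
  | _ =>
    simp only [Dp, PForm.eval]
    tauto

theorem AllRule.eval {val : Valuation L} (h : AllRule a b E E') :
    E.Dp.eval val → E'.Dp.eval val := by
  cases h
  exact id

theorem LocalRule.occs_eq (h : LocalRule E E') : E'.occs = E.occs := by
  cases h with
  | ex _ _ A hA hB => exact occs_unionEx hB
  | lit => rfl
  | _ =>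
    simp only [occs, Multiset.map_add]
    exact add_add_add_comm _ _ _ _

theorem Ctx.occs_eq (h : Ctx LocalRule E E') : E'.occs = E.occs := by
  induction h with
  | hole h => exact h.occs_eq
  | _ => simp_all [occs]

theorem Ctx.exists_occs_eq_cons_cons (h : Ctx (AllRule a b) E E') :
    ∃ p s, E.occs = (p, a) ::ₘ (p, b) ::ₘ s ∧ E'.occs = (p, a) ::ₘ s := by
  induction h with
  | hole h =>
    obtain ⟨A, E₁, E₂⟩ := h
    refine ⟨[], E₁.occs.map (Occ.under Step.all) + E₂.occs.map (Occ.under Step.all), ?_, ?_⟩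
    · simp only [occs, Multiset.cons_add, Multiset.add_cons, Multiset.cons_swap]
    · simp only [occs, Multiset.map_add]
  | and_left F _ ih | or_left F _ ih =>
    obtain ⟨p, s, hE, hE'⟩ := ih
    exact ⟨Step.left :: p, s.map (Occ.under Step.left) + F.occs.map (Occ.under Step.right),
      by simp [occs, hE, Occ.under], by simp [occs, hE', Occ.under]⟩
  | and_right F _ ih | or_right F _ ih =>
    obtain ⟨p, s, hE, hE'⟩ := ih
    exact ⟨Step.right :: p, F.occs.map (Occ.under Step.left) + s.map (Occ.under Step.right),
      by simp [occs, hE, Occ.under], by simp [occs, hE', Occ.under]⟩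
  | exp_left t F _ ih =>
    obtain ⟨p, s, hE, hE'⟩ := ih
    exact ⟨p, s + F.occs.map (Occ.under (Step.ex t)), by simp [occs, hE], by simp [occs, hE']⟩
  | exp_right F t _ ih =>
    obtain ⟨p, s, hE, hE'⟩ := ih
    exact ⟨Step.ex t :: p, F.occs + s.map (Occ.under (Step.ex t)),
      by simp [occs, hE, Occ.under], by simp [occs, hE', Occ.under]⟩
  | all A d _ ih =>
    obtain ⟨p, s, hE, hE'⟩ := ih
    refine ⟨Step.all :: p, ([], d) ::ₘ s.map (Occ.under Step.all), ?_, ?_⟩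
    · simp [occs, hE, Occ.under, Multiset.cons_swap ([], d)]
    · simp [occs, hE', Occ.under, Multiset.cons_swap ([], d)]
  | merge_left F _ ih =>
    obtain ⟨p, s, hE, hE'⟩ := ih
    exact ⟨p, s + F.occs, by simp [occs, hE], by simp [occs, hE']⟩
  | merge_right F _ ih =>
    obtain ⟨p, s, hE, hE'⟩ := ih
    exact ⟨p, F.occs + s, by simp [occs, hE], by simp [occs, hE']⟩

theorem MWF.localRule (hE : E.MWF) (h : LocalRule E E') : E'.MWF := by
  cases h with
  | ex _ _ A hA hB => exact hE.1.unionEx hE.2.1 hA hB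
  | lit => trivial
  | and | or =>
    obtain ⟨⟨hE₁, hF₁⟩, ⟨hE₂, hF₂⟩, hS⟩ := hE
    simp only [Sh, NNF.and.injEq, NNF.or.injEq] at hS
    exact ⟨⟨hE₁, hE₂, hS.1⟩, hF₁, hF₂, hS.2⟩

theorem MWF.ctx_localRule (hE : E.MWF) (h : Ctx LocalRule E E') : E'.MWF := by
  have hR := mergeHeaded_localRule (L := L)
  induction h with
  | hole h => exact hE.localRule h
  | and_left F _ ih | or_left F _ ih => exact ⟨ih hE.1, hE.2⟩
  | and_right F _ ih | or_right F _ ih => exact ⟨hE.1, ih hE.2⟩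
  | exp_left t F h ih =>
    obtain ⟨hF, hG, ht, A, hA, hS⟩ := hE
    obtain ⟨hA', ht'⟩ := h.exBody_terms_eq hR hA
    exact ⟨ih hF, hG, ht' ▸ ht, A, hA', hS⟩
  | exp_right F t h ih =>
    obtain ⟨hF, hG, ht, A, hA, hS⟩ := hE
    exact ⟨hF, ih hG, ht, A, hA, (h.Sh_eq hR).trans hS⟩
  | all A a h ih => exact ⟨ih hE.1, (h.Sh_eq hR).trans hE.2⟩
  | merge_left F h ih => exact ⟨ih hE.1, hE.2.1, (h.Sh_eq hR).trans hE.2.2⟩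
  | merge_right F h ih => exact ⟨hE.1, ih hE.2.1, hE.2.2.trans (h.Sh_eq hR).symm⟩

/-- The substitution of the variable `a` for `b` that accompanies an `AllRule a b`. -/
noncomputable abbrev rename (b a : ℕ) : ℕ → L.Term ℕ := single b (Term.var a)

@[simp] theorem rename_left (b a : ℕ) : rename (L := L) b a b = Term.var a :=
  Function.update_self ..

@[simp] theorem rename_right (b a : ℕ) : rename (L := L) b a a = Term.var a := by
  by_cases h : a = b
  · rw [h, rename_left]
  · exact Function.update_of_ne h ..

theorem rename_of_ne {a b c : ℕ} (h : c ≠ b) : rename (L := L) b a c = Term.var c :=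
  Function.update_of_ne h ..

theorem exists_rename_eq_var (b a c : ℕ) : ∃ d, rename (L := L) b a c = Term.var d := by
  by_cases h : c = b
  · exact ⟨a, by rw [h, rename_left]⟩
  · exact ⟨c, rename_of_ne h⟩

theorem MWF.rename (hE : E.MWF) (b a : ℕ) : (E.subst (rename b a)).MWF :=
  hE.subst fun c _ => exists_rename_eq_var b a c

theorem MWF.allRule (hE : E.MWF) (h : AllRule a b E E') : (E'.subst (ETree.rename b a)).MWF := by
  cases h
  obtain ⟨⟨hE₁, hS₁⟩, ⟨hE₂, hS₂⟩, _⟩ := hE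
  refine ⟨⟨hE₁.rename b a, hE₂.rename b a, ?_⟩, ?_⟩
  · simp [hS₁, hS₂, NNF.subst_inst, Term.subst]
  · change (ETree.subst _ _).Sh = _
    rw [substVar_eq (rename_right b a), Sh_subst, Sh, hS₁, NNF.subst_inst, Term.subst, rename_right]

theorem MWF.ctx_allRule (hE : E.MWF) (h : Ctx (AllRule a b) E E') :
    (E'.subst (ETree.rename b a)).MWF := by
  have hR := mergeHeaded_allRule (L := L) a b
  induction h with
  | hole h => exact hE.allRule h
  | and_left F _ ih | or_left F _ ih => exact ⟨ih hE.1, hE.2.rename b a⟩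
  | and_right F _ ih | or_right F _ ih => exact ⟨hE.1.rename b a, ih hE.2⟩
  | exp_left t F h ih =>
    obtain ⟨hF, hG, _, A, hA, hS⟩ := hE
    obtain ⟨hA', _⟩ := h.exBody_terms_eq hR hA
    exact (ih hF).addExp (hG.rename b a) (exBody_subst hA') (by rw [Sh_subst, hS, NNF.subst_inst])
  | exp_right F t h ih =>
    obtain ⟨hF, hG, _, A, hA, hS⟩ := hE
    exact (hF.rename b a).addExp (ih hG) (exBody_subst hA)
      (by rw [Sh_subst, h.Sh_eq hR, hS, NNF.subst_inst])
  | all A c h ih =>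
    obtain ⟨d, hd⟩ := exists_rename_eq_var (L := L) b a c
    refine ⟨ih hE.1, ?_⟩
    rw [substVar_eq hd, Sh_subst, h.Sh_eq hR, hE.2, NNF.subst_inst, Term.subst, hd]
  | merge_left F h ih => exact ⟨ih hE.1, hE.2.1.rename b a, by simp [h.Sh_eq hR, hE.2.2]⟩
  | merge_right F h ih => exact ⟨hE.1.rename b a, ih hE.2.1, by simp [h.Sh_eq hR, hE.2.2]⟩

end Ctx

section Inversion

variable {E : ETree L}

theorem WF.exists_Sh_exp {F : ETree L} {t : L.Term ℕ} (h : (exp F t E).WF) :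
    ∃ A, F.exBody = some A ∧ (exp F t E).Sh = NNF.ex A :=
  h.2.2.2.imp fun _ hA => ⟨hA.1, Sh_of_exBody hA.1⟩

theorem WF.exBody_of_Sh (h : E.WF) {A : NNF L 1} (hS : E.Sh = NNF.ex A) : E.exBody = some A := by
  cases E with
  | exp F t E =>
    obtain ⟨B, hB, hSB⟩ := h.exists_Sh_exp
    rw [hSB, NNF.ex.injEq] at hS
    exact hS ▸ hB
  | ex => simpa [Sh, exBody] using hS
  | merge => exact h.elim
  | _ => simp [Sh] at hS

theorem WF.eq_all_of_Sh (h : E.WF) {A : NNF L 1} (hS : E.Sh = NNF.all A) :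
    ∃ a G, E = ETree.all A a G := by
  cases E with
  | exp F t E =>
    obtain ⟨B, _, hSB⟩ := h.exists_Sh_exp
    cases hSB.symm.trans hS
  | all B a G =>
    rw [Sh, NNF.all.injEq] at hS
    exact ⟨a, G, by rw [hS]⟩
  | merge => exact h.elim
  | _ => simp [Sh] at hS

theorem WF.eq_and_of_Sh (h : E.WF) {A B : NNF L 0} (hS : E.Sh = NNF.and A B) :
    ∃ F G, E = ETree.and F G ∧ F.Sh = A ∧ G.Sh = B := by
  cases E with
  | exp F t E =>
    obtain ⟨C, _, hSC⟩ := h.exists_Sh_exp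
    cases hSC.symm.trans hS
  | and F G =>
    rw [Sh, NNF.and.injEq] at hS
    exact ⟨F, G, rfl, hS⟩
  | merge => exact h.elim
  | _ => simp [Sh] at hS

theorem WF.eq_or_of_Sh (h : E.WF) {A B : NNF L 0} (hS : E.Sh = NNF.or A B) :
    ∃ F G, E = ETree.or F G ∧ F.Sh = A ∧ G.Sh = B := by
  cases E with
  | exp F t E =>
    obtain ⟨C, _, hSC⟩ := h.exists_Sh_exp
    cases hSC.symm.trans hS
  | or F G =>
    rw [Sh, NNF.or.injEq] at hS
    exact ⟨F, G, rfl, hS⟩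
  | merge => exact h.elim
  | _ => simp [Sh] at hS

theorem WF.eq_lit_of_Sh (h : E.WF) {l : ℕ} {b : Bool} {R : L.Relations l}
    {ts : Fin l → L.Term ℕ}
    (hS : E.Sh = NNF.lit b R fun i => (ts i).relabel Sum.inl) : E = ETree.lit b R ts := by
  cases E with
  | exp F t E =>
    obtain ⟨B, _, hSB⟩ := h.exists_Sh_exp
    cases hSB.symm.trans hS
  | lit b' R' ts' =>
    simp only [Sh, NNF.lit.injEq] at hS
    obtain ⟨rfl, rfl, hR, hts⟩ := hS
    obtain rfl := eq_of_heq hR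
    congr
    funext i
    exact relabel_inl_injective (congrFun (eq_of_heq hts) i)
  | merge => exact h.elim
  | _ => simp [Sh] at hS

end Inversion

/-- No merge reduction applies within the tree. -/
structure IsNormal (E : ETree L) : Prop where
  not_local : ∀ E', ¬ Ctx LocalRule E E'
  not_all : ∀ a b E', ¬ Ctx (AllRule a b) E E'

theorem IsNormal.of_context {E : ETree L} {D : ETree L → ETree L} (h : (D E).IsNormal)
    (hD : ∀ {R : ETree L → ETree L → Prop} {E'}, Ctx R E E' → Ctx R (D E) (D E')) :
    E.IsNormal :=
  ⟨fun _ hE => h.not_local _ (hD hE), fun _ _ _ hE => h.not_all _ _ _ (hD hE)⟩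

theorem WF.not_isNormal_merge {E F : ETree L} (hE : E.WF) (hF : F.WF) (hS : E.Sh = F.Sh) :
    ¬ (merge E F).IsNormal := by
  rintro ⟨hloc, hall⟩
  replace hS := hS.symm
  cases E with
  | lit b R ts =>
    obtain rfl := hF.eq_lit_of_Sh hS
    exact hloc _ (.hole (.lit b R ts))
  | and E₁ E₂ =>
    obtain ⟨F₁, F₂, rfl, -, -⟩ := hF.eq_and_of_Sh hS
    exact hloc _ (.hole (.and ..))
  | or E₁ E₂ =>
    obtain ⟨F₁, F₂, rfl, -, -⟩ := hF.eq_or_of_Sh hS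
    exact hloc _ (.hole (.or ..))
  | ex A => exact hloc _ (.hole (.ex _ _ A rfl (hF.exBody_of_Sh hS)))
  | exp G t E =>
    obtain ⟨A, hA, hSA⟩ := hE.exists_Sh_exp
    exact hloc _ (.hole (.ex _ _ A hA (hF.exBody_of_Sh (hS.trans hSA))))
  | all A a E =>
    obtain ⟨b, G, rfl⟩ := hF.eq_all_of_Sh hS
    exact hall a b _ (.hole (.all A E G))
  | merge => exact hE

theorem MWF.wf_of_isNormal {E : ETree L} (h : E.MWF) (hn : E.IsNormal) : E.WF := by
  induction E with
  | lit | ex => trivial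
  | and E F ihE ihF =>
    exact ⟨ihE h.1 (hn.of_context (D := (and · F)) (.and_left F)),
      ihF h.2 (hn.of_context (D := and E) (.and_right E))⟩
  | or E F ihE ihF =>
    exact ⟨ihE h.1 (hn.of_context (D := (or · F)) (.or_left F)),
      ihF h.2 (hn.of_context (D := or E) (.or_right E))⟩
  | exp F t E ihF ihE =>
    exact ⟨ihF h.1 (hn.of_context (D := (exp · t E)) (.exp_left t E)),
      ihE h.2.1 (hn.of_context (D := exp F t) (.exp_right F t)), h.2.2⟩
  | all A a E ih => exact ⟨ih h.1 (hn.of_context (D := all A a) (.all A a)), h.2⟩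
  | merge E F ihE ihF =>
    exact (WF.not_isNormal_merge (ihE h.1 (hn.of_context (D := (merge · F)) (.merge_left F)))
      (ihF h.2.1 (hn.of_context (D := merge E) (.merge_right E))) h.2.2 hn).elim

end ETree

/-! ### Places -/

/-- A place in a collection of cuts and trees, given by shallow formulas. Trees that may have to be
merged are at the same place. -/
inductive Place (L : FirstOrder.Language.{u, v}) : Type (max u v)
  | tree (A : NNF L 0) : Place L
  | pos (A B : NNF L 0) : Place L
  | neg (A B : NNF L 0) : Place L

namespace Place

/-- The shallow formula of the trees at a place. -/
def formula : Place L → NNF L 0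
  | tree A => A
  | pos A _ => A
  | neg _ B => B

/-- Substitution in a place. -/
def subst (σ : ℕ → L.Term ℕ) : Place L → Place L
  | tree A => tree (A.subst σ)
  | pos A B => pos (A.subst σ) (B.subst σ)
  | neg A B => neg (A.subst σ) (B.subst σ)

@[simp] theorem formula_subst (σ : ℕ → L.Term ℕ) (π : Place L) :
    (π.subst σ).formula = π.formula.subst σ := by
  cases π <;> rfl

theorem subst_subst (σ τ : ℕ → L.Term ℕ) (π : Place L) :
    (π.subst σ).subst τ = π.subst fun x => (σ x).subst τ := by
  cases π <;> simp [subst, NNF.subst_subst]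

theorem subst_var (π : Place L) : π.subst Term.var = π := by
  cases π <;> simp [subst, NNF.subst_var]

end Place

/-- The substitution that renames the variables. -/
def ren (ρ : ℕ → ℕ) : ℕ → L.Term ℕ := fun x => Term.var (ρ x)

theorem single_var_eq_ren (b a : ℕ) :
    single b (Term.var a : L.Term ℕ) = ren (Function.update id b a) := by
  funext x
  simp only [single, ren, Function.update_apply]
  split_ifs <;> rfl

/-- An occurrence of a `∀`-expansion in a collection of cuts and trees. -/
abbrev PlacedOcc (L : FirstOrder.Language.{u, v}) : Type (max u v) := Place L × Occ L

/-- Substitution in an occurrence. -/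
def PlacedOcc.subst (σ : ℕ → L.Term ℕ) (o : PlacedOcc L) : PlacedOcc L :=
  (o.1.subst σ, o.2.subst σ)

theorem PlacedOcc.subst_ren_ren (ρ τ : ℕ → ℕ) (o : PlacedOcc L) :
    PlacedOcc.subst (ren τ) (PlacedOcc.subst (ren ρ) o) = PlacedOcc.subst (ren (τ ∘ ρ)) o := by
  simp only [PlacedOcc.subst, Occ.subst, Place.subst_subst, Path.subst_subst]
  rfl

theorem PlacedOcc.subst_id (o : PlacedOcc L) : PlacedOcc.subst (ren id) o = o := by
  have hid : ren (L := L) id = Term.var := rfl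
  rw [PlacedOcc.subst, Occ.subst, hid, Place.subst_var, Path.subst_var]
  rfl

namespace RawProof

variable {R R' : RawProof L}

/-- The trees together with their places. -/
def roots (R : RawProof L) : Multiset (Place L × ETree L) :=
  R.trees.map (fun E => (Place.tree E.Sh, E)) +
    (R.cuts.map (fun C => (Place.pos C.1.Sh C.2.Sh, C.1)) +
      R.cuts.map fun C => (Place.neg C.1.Sh C.2.Sh, C.2))

/-- The places at which there is a tree. -/
def places (R : RawProof L) : Set (Place L) := {π | ∃ E, (π, E) ∈ R.roots}

/-- The `∀`-expansions, with multiplicity. -/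
def occs (R : RawProof L) : Multiset (PlacedOcc L) :=
  R.roots.bind fun x => x.2.occs.map (Prod.mk x.1)

section Roots

variable {cuts : Multiset (Cut L)} {trees : Multiset (ETree L)}

theorem roots_cons_tree (E : ETree L) :
    roots ⟨cuts, E ::ₘ trees⟩ = (Place.tree E.Sh, E) ::ₘ roots ⟨cuts, trees⟩ := by
  simp only [roots, Multiset.map_cons, Multiset.cons_add]

theorem roots_cons_cut (C : Cut L) : roots ⟨C ::ₘ cuts, trees⟩ =
    (Place.pos C.1.Sh C.2.Sh, C.1) ::ₘ (Place.neg C.1.Sh C.2.Sh, C.2) ::ₘ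
      roots ⟨cuts, trees⟩ := by
  simp only [roots, Multiset.map_cons, Multiset.cons_add, Multiset.add_cons, Multiset.cons_swap]

end Roots

theorem mem_roots {x : Place L × ETree L} :
    x ∈ R.roots ↔ (∃ E ∈ R.trees, (Place.tree E.Sh, E) = x) ∨
      (∃ C ∈ R.cuts, (Place.pos C.1.Sh C.2.Sh, C.1) = x) ∨
        ∃ C ∈ R.cuts, (Place.neg C.1.Sh C.2.Sh, C.2) = x := by
  simp only [roots, Multiset.mem_add, Multiset.mem_map]

theorem tree_mem_roots {E : ETree L} (h : E ∈ R.trees) : (Place.tree E.Sh, E) ∈ R.roots :=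
  mem_roots.2 (Or.inl ⟨E, h, rfl⟩)

theorem pos_mem_roots {C : Cut L} (h : C ∈ R.cuts) : (Place.pos C.1.Sh C.2.Sh, C.1) ∈ R.roots :=
  mem_roots.2 (Or.inr (Or.inl ⟨C, h, rfl⟩))

theorem neg_mem_roots {C : Cut L} (h : C ∈ R.cuts) : (Place.neg C.1.Sh C.2.Sh, C.2) ∈ R.roots :=
  mem_roots.2 (Or.inr (Or.inr ⟨C, h, rfl⟩))

theorem tree_mem_places {A : NNF L 0} :
    Place.tree A ∈ R.places ↔ ∃ E ∈ R.trees, E.Sh = A := by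
  simp [places, mem_roots]

theorem pos_mem_places {A B : NNF L 0} :
    Place.pos A B ∈ R.places ↔ ∃ C ∈ R.cuts, C.1.Sh = A ∧ C.2.Sh = B := by
  simp [places, mem_roots]

theorem formula_of_mem_roots {x : Place L × ETree L} (h : x ∈ R.roots) :
    x.1.formula = x.2.Sh := by
  rcases mem_roots.1 h with ⟨_, _, rfl⟩ | ⟨_, _, rfl⟩ | ⟨_, _, rfl⟩ <;> rfl

theorem mem_occs {o : PlacedOcc L} : o ∈ R.occs ↔ ∃ E, (o.1, E) ∈ R.roots ∧ o.2 ∈ E.occs := by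
  obtain ⟨π, o⟩ := o
  simp only [occs, Multiset.mem_bind, Multiset.mem_map, Prod.mk.injEq, Prod.exists]
  grind

theorem EV_eq_bind (R : RawProof L) : R.EV = R.roots.bind fun x => x.2.EV := by
  simp [EV, roots, Multiset.bind_map, Multiset.bind_add]

theorem map_occs (R : RawProof L) : R.occs.map (fun o => o.2.2) = R.EV := by
  simp [occs, EV_eq_bind, Multiset.map_bind, ← ETree.map_snd_occs]

theorem mem_EV_iff {a : ℕ} : a ∈ R.EV ↔ ∃ π p, (π, p, a) ∈ R.occs := by
  simp [← map_occs]

theorem occ_eq_of_nodup_EV (h : R.EV.Nodup) {o o' : PlacedOcc L} (ho : o ∈ R.occs)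
    (ho' : o' ∈ R.occs) (heq : o.2.2 = o'.2.2) : o = o' :=
  Multiset.inj_on_of_nodup_map ((map_occs R).symm ▸ h) o ho o' ho' heq

theorem roots_subst (σ : ℕ → L.Term ℕ) (R : RawProof L) :
    (R.subst σ).roots = R.roots.map fun x => (x.1.subst σ, x.2.subst σ) := by
  simp [roots, subst, Place.subst]

theorem places_subst (σ : ℕ → L.Term ℕ) (R : RawProof L) :
    (R.subst σ).places = Place.subst σ '' R.places := by
  ext π
  simp only [places, roots_subst, Multiset.mem_map, Set.mem_ofPred_eq, Set.mem_image, Prod.exists,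
    Prod.mk.injEq]
  grind

theorem occs_subst (σ : ℕ → L.Term ℕ) (R : RawProof L) :
    (R.subst σ).occs = R.occs.map (PlacedOcc.subst σ) := by
  simp [occs, roots_subst, Multiset.bind_map, Multiset.map_bind, ETree.occs_subst,
    PlacedOcc.subst, Function.comp_def]

theorem eval_Dp_iff {val : Valuation L} :
    (∃ A ∈ R.Dp, A.eval val) ↔ (∃ E ∈ R.trees, E.Dp.eval val) ∨
      ∃ C ∈ R.cuts, C.1.Dp.eval val ∧ C.2.Dp.eval val := by
  simp only [Dp, Multiset.mem_add, Multiset.mem_map]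
  constructor
  · rintro ⟨_, ⟨E, hE, rfl⟩ | ⟨C, hC, rfl⟩, h⟩
    · exact Or.inl ⟨E, hE, h⟩
    · exact Or.inr ⟨C, hC, h⟩
  · rintro (⟨E, hE, h⟩ | ⟨C, hC, h⟩)
    · exact ⟨_, Or.inl ⟨E, hE, rfl⟩, h⟩
    · exact ⟨_, Or.inr ⟨C, hC, rfl⟩, h⟩

theorem eval_Dp_subst (σ : ℕ → L.Term ℕ) {val : Valuation L} :
    (∃ A ∈ (R.subst σ).Dp, A.eval val) ↔
      ∃ A ∈ R.Dp, A.eval fun l R ts => val l R fun i => (ts i).subst σ := by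
  simp [eval_Dp_iff, subst, ETree.eval_subst]

/-! ### The effect of merging on occurrences -/

/-- The level of every eigenvariable exceeds the levels of the variables on which it depends. -/
def IsLevel (R : RawProof L) (lev : ℕ → ℕ) : Prop :=
  ∀ o ∈ R.occs, ∀ y ∈ o.1.formula.deps o.2.1, lev y < lev o.2.2

/-- `R'` has the places and the occurrences of `R`, up to a renaming of variables that may
identify occurrences. -/
structure Renames (ρ : ℕ → ℕ) (R R' : RawProof L) : Prop where
  places : R'.places = Place.subst (ren ρ) '' R.places
  mem_occs : ∀ o, o ∈ R'.occs ↔ o ∈ R.occs.map (PlacedOcc.subst (ren ρ))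

theorem Renames.trans {ρ τ : ℕ → ℕ} {P Q R : RawProof L} (h₁ : Renames ρ P Q)
    (h₂ : Renames τ Q R) : Renames (τ ∘ ρ) P R := by
  refine ⟨?_, fun o => ?_⟩
  · rw [h₂.places, h₁.places, Set.image_image]
    exact Set.image_congr fun π _ => Place.subst_subst _ _ π
  · simp only [h₂.mem_occs, Multiset.mem_map, h₁.mem_occs, exists_exists_and_eq_and,
      PlacedOcc.subst_ren_ren]

theorem Renames.of_eq (h₁ : R'.places = R.places) (h₂ : R'.occs = R.occs) : Renames id R R' := by
  refine ⟨?_, fun o => ?_⟩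
  · rw [h₁, show Place.subst (ren (L := L) id) = id from funext Place.subst_var, Set.image_id]
  · rw [h₂, show PlacedOcc.subst (ren (L := L) id) = id from funext PlacedOcc.subst_id,
      Multiset.map_id]

theorem Renames.positive {ρ : ℕ → ℕ} (h : Renames ρ R R')
    (hR : ∀ A B, Place.pos A B ∈ R.places → A.positive = true) (A B : NNF L 0)
    (hA : Place.pos A B ∈ R'.places) : A.positive = true := by
  rw [h.places] at hA
  obtain ⟨π, hπ, hA⟩ := hA
  cases π with
  | pos A₀ B₀ =>
    obtain ⟨rfl, -⟩ := Place.pos.inj hA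
    rw [NNF.positive_subst]
    exact hR _ _ hπ
  | _ => cases hA

theorem Renames.tree_iff {ρ : ℕ → ℕ} (h : Renames ρ R R')
    (hR : ∀ A, Place.tree A ∈ R.places → A.fv = ∅) (A : NNF L 0) :
    Place.tree A ∈ R'.places ↔ Place.tree A ∈ R.places := by
  rw [h.places]
  constructor
  · rintro ⟨π, hπ, hA⟩
    cases π with
    | tree A₀ =>
      simp only [Place.subst, Place.tree.injEq, NNF.subst_eq_self (hR _ hπ)] at hA
      exact hA ▸ hπ
    | _ => cases hA
  · intro hA
    exact ⟨_, hA, by rw [Place.subst, NNF.subst_eq_self (hR _ hA)]⟩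

/-- `R'` arises from `R` by the replacement of `b` by `a`, where `a` and `b` are the eigenvariables
of two occurrences with the same path at the same place, which become one. -/
structure Identifies (a b : ℕ) (R R' : RawProof L) : Prop where
  places : R'.places = Place.subst (ren (Function.update id b a)) '' R.places
  occs : ∃ π p s, R.occs = (π, p, a) ::ₘ (π, p, b) ::ₘ s ∧
    R'.occs = ((π, p, a) ::ₘ s).map (PlacedOcc.subst (ren (Function.update id b a)))

theorem Identifies.renames {a b : ℕ} (h : Identifies a b R R') :
    Renames (Function.update id b a) R R' := by
  refine ⟨h.places, fun o => ?_⟩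
  obtain ⟨π, p, s, hs, hs'⟩ := h.occs
  have hba : PlacedOcc.subst (ren (Function.update id b a)) (π, p, b) =
      PlacedOcc.subst (ren (Function.update id b a)) (π, p, a) := by
    simp [PlacedOcc.subst, Occ.subst, ETree.substVar, ren, Function.update_apply]
  rw [hs, hs']
  simp only [Multiset.map_cons, Multiset.mem_cons, hba, or_self_left]

theorem Identifies.nodup_EV {a b : ℕ} (h : Identifies a b R R') (hR : R.EV.Nodup) :
    R'.EV.Nodup := by
  obtain ⟨π, p, s, hs, hs'⟩ := h.occs
  have hEV : R.EV = b ::ₘ ((π, p, a) ::ₘ s).map fun o => o.2.2 := by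
    simp only [← map_occs, hs, Multiset.map_cons, Multiset.cons_swap]
  rw [hEV, Multiset.nodup_cons] at hR
  rw [← map_occs, hs', Multiset.map_map]
  convert hR.2 using 1
  refine Multiset.map_congr rfl fun o ho => ?_
  have hb : o.2.2 ≠ b := fun hob => hR.1 (Multiset.mem_map.2 ⟨o, ho, hob⟩)
  simp [PlacedOcc.subst, Occ.subst, ETree.substVar, ren, hb]

/-- Both occurrences have the same dependencies, so that the minimum of their levels will do. -/
theorem Identifies.exists_isLevel {a b : ℕ} (h : Identifies a b R R') (hR : R.EV.Nodup)
    {lev : ℕ → ℕ} (hlev : R.IsLevel lev) : ∃ lev, R'.IsLevel lev := by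
  set lev' : ℕ → ℕ := fun x => if x = a ∨ x = b then min (lev a) (lev b) else lev x with hlev'
  refine ⟨lev', fun o' ho' y' hy' => ?_⟩
  have hren (x : ℕ) : lev' (Function.update id b a x) = lev' x := by
    by_cases hx : x = b <;> simp [hlev', hx]
  have hle (x : ℕ) : lev' x ≤ lev x := by grind
  obtain ⟨π, p, s, hs, -⟩ := h.occs
  have ha : (π, p, a) ∈ R.occs := by simp [hs]
  have hb : (π, p, b) ∈ R.occs := by simp [hs]
  obtain ⟨o, ho, rfl⟩ := Multiset.mem_map.1 ((h.renames.mem_occs o').1 ho')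
  simp only [PlacedOcc.subst, Occ.subst, Place.formula_subst] at hy'
  obtain ⟨y, hy, hyy'⟩ := NNF.mem_deps_subst hy'
  obtain rfl : y' = Function.update id b a y := by simpa [ren] using hyy'
  change lev' _ < lev' (Function.update id b a o.2.2)
  rw [hren, hren]
  refine (hle y).trans_lt ?_
  by_cases hc : o.2.2 = a ∨ o.2.2 = b
  · have hdeps : o.1.formula.deps o.2.1 = π.formula.deps p := by
      rcases hc with hc | hc
      · rw [occ_eq_of_nodup_EV hR ho ha hc]
      · rw [occ_eq_of_nodup_EV hR ho hb hc]
    rw [hdeps] at hy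
    simp only [hlev', if_pos hc]
    exact lt_min (hlev _ ha y hy) (hlev _ hb y hy)
  · simp only [hlev', if_neg hc]
    exact hlev _ ho y hy

/-! ### Merge reduction of collections -/

section InTree

variable {S : ETree L → ETree L → Prop} {P Q : RawProof L}

theorem InTree.exists_roots (hS : ∀ E E', S E E' → E'.Sh = E.Sh) (h : InTree S P Q) :
    ∃ π E E' s, S E E' ∧ P.roots = (π, E) ::ₘ s ∧ Q.roots = (π, E') ::ₘ s := by
  cases h with
  | tree cuts trees h =>
    exact ⟨_, _, _, _, h, roots_cons_tree _, by rw [roots_cons_tree, hS _ _ h]⟩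
  | pos F cuts trees h =>
    exact ⟨_, _, _, _, h, roots_cons_cut _, by rw [roots_cons_cut, hS _ _ h]⟩
  | neg E cuts trees h =>
    exact ⟨_, _, _, _, h, (roots_cons_cut _).trans (Multiset.cons_swap ..),
      by rw [roots_cons_cut, hS _ _ h, Multiset.cons_swap]⟩

theorem InTree.eval_Dp {val : Valuation L} (hS : ∀ E E', S E E' → E.Dp.eval val → E'.Dp.eval val)
    (h : InTree S P Q) : (∃ A ∈ P.Dp, A.eval val) → ∃ A ∈ Q.Dp, A.eval val := by
  cases h with
  | tree _ _ h | pos _ _ _ h | neg _ _ _ h =>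
    have := hS _ _ h
    simp only [eval_Dp_iff, Multiset.mem_cons, exists_eq_or_imp]
    grind

theorem exists_inTree {x : Place L × ETree L} (hx : x ∈ R.roots) {E' : ETree L} (h : S x.2 E') :
    ∃ R', InTree S R R' := by
  obtain ⟨cuts, trees⟩ := R
  rcases mem_roots.1 hx with ⟨E, hE, rfl⟩ | ⟨⟨E, F⟩, hE, rfl⟩ | ⟨⟨E, F⟩, hE, rfl⟩ <;>
    obtain ⟨s, rfl⟩ := Multiset.exists_cons_of_mem hE
  · exact ⟨_, .tree _ _ h⟩
  · exact ⟨_, .pos _ _ _ h⟩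
  · exact ⟨_, .neg _ _ _ h⟩

end InTree

namespace MergeStep

theorem places_occs_eq_or (h : MergeStep R R') :
    (R'.places = R.places ∧ R'.occs = R.occs) ∨ ∃ a b, Identifies a b R R' := by
  cases h with
  | loc h =>
    obtain ⟨π, E, E', s, hE, hs, hs'⟩ :=
      h.exists_roots fun _ _ h => h.Sh_eq ETree.mergeHeaded_localRule
    refine Or.inl ⟨?_, ?_⟩
    · simp [places, hs, hs', exists_or]
    · simp [occs, hs, hs', hE.occs_eq]
  | @all _ Q a b h =>
    obtain ⟨π, E, E', s, hE, hs, hs'⟩ :=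
      h.exists_roots fun _ _ h => h.Sh_eq (ETree.mergeHeaded_allRule a b)
    obtain ⟨p, t, ht, ht'⟩ := hE.exists_occs_eq_cons_cons
    refine Or.inr ⟨a, b, ?_, π, p, t.map (Prod.mk π) + s.bind fun x => x.2.occs.map (Prod.mk x.1),
      by simp [occs, hs, ht], ?_⟩
    · rw [places_subst, single_var_eq_ren]
      simp [places, hs, hs', exists_or]
    · rw [occs_subst, single_var_eq_ren]
      simp [occs, hs', ht']
  | trees E F cuts trees hS =>
    refine Or.inl ⟨?_, ?_⟩
    · simp [places, roots_cons_tree, exists_or, ETree.Sh, hS]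
    · simp [occs, roots_cons_tree, ETree.Sh, ETree.occs, hS, add_assoc]
  | cuts C D cuts trees hS hS' =>
    refine Or.inl ⟨?_, ?_⟩
    · ext π
      simp only [places, roots_cons_cut, ETree.Sh, hS, hS', Multiset.mem_cons, Prod.mk.injEq,
        exists_or, exists_and_left, exists_eq, and_true, Set.mem_ofPred_eq]
      tauto
    · simp only [occs, roots_cons_cut, ETree.Sh, ETree.occs, hS, hS', Multiset.cons_bind,
        Multiset.map_add]
      abel

theorem mwf (h : MergeStep R R') (hR : ∀ x ∈ R.roots, x.2.MWF) : ∀ x ∈ R'.roots, x.2.MWF := by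
  cases h with
  | loc h =>
    obtain ⟨π, E, E', s, hE, hs, hs'⟩ :=
      h.exists_roots fun _ _ h => h.Sh_eq ETree.mergeHeaded_localRule
    rw [hs, Multiset.forall_mem_cons] at hR
    rw [hs', Multiset.forall_mem_cons]
    exact ⟨hR.1.ctx_localRule hE, hR.2⟩
  | @all _ Q a b h =>
    obtain ⟨π, E, E', s, hE, hs, hs'⟩ :=
      h.exists_roots fun _ _ h => h.Sh_eq (ETree.mergeHeaded_allRule a b)
    rw [hs, Multiset.forall_mem_cons] at hR
    rw [roots_subst, hs', Multiset.map_cons, Multiset.forall_mem_cons]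
    refine ⟨hR.1.ctx_allRule hE, fun x hx => ?_⟩
    obtain ⟨y, hy, rfl⟩ := Multiset.mem_map.1 hx
    exact (hR.2 y hy).rename b a
  | trees E F cuts trees hS =>
    simp only [roots_cons_tree, Multiset.forall_mem_cons] at hR ⊢
    exact ⟨⟨hR.1, hR.2.1, hS⟩, hR.2.2⟩
  | cuts C D cuts trees hS hS' =>
    simp only [roots_cons_cut, Multiset.forall_mem_cons] at hR ⊢
    obtain ⟨hC, hC', hD, hD', hR⟩ := hR
    exact ⟨⟨hC, hD, hS⟩, ⟨hC', hD', hS'⟩, hR⟩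

theorem tautology (h : MergeStep R R') (hR : ∀ val, ∃ A ∈ R.Dp, A.eval val) (val : Valuation L) :
    ∃ A ∈ R'.Dp, A.eval val := by
  cases h with
  | loc h => exact h.eval_Dp (fun _ _ h => h.eval fun _ _ h => h.eval) (hR val)
  | all a b h =>
    rw [eval_Dp_subst]
    exact h.eval_Dp (fun _ _ h => h.eval fun _ _ h => h.eval) (hR _)
  | trees | cuts =>
    have := hR val
    simp only [eval_Dp_iff, Multiset.mem_cons, exists_eq_or_imp, ETree.Dp, PForm.eval] at this ⊢
    grind

end MergeStep

/-- The number of trees and of their nodes other than merges, which every merge step decreases. -/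
def nodes (R : RawProof L) : ℕ := (R.roots.map fun x => x.2.nodes + 1).sum

theorem nodes_subst_le (σ : ℕ → L.Term ℕ) (R : RawProof L) : (R.subst σ).nodes ≤ R.nodes := by
  simp only [nodes, roots_subst, Multiset.map_map, Function.comp_def]
  exact Multiset.sum_map_le_sum_map _ _ fun x _ => Nat.succ_le_succ (ETree.nodes_subst_le σ x.2)

theorem MergeStep.nodes_lt (h : MergeStep R R') : R'.nodes < R.nodes := by
  cases h with
  | loc h =>
    obtain ⟨π, E, E', s, hE, hs, hs'⟩ :=
      h.exists_roots fun _ _ h => h.Sh_eq ETree.mergeHeaded_localRule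
    simpa [nodes, hs, hs'] using hE.nodes_lt fun _ _ h => h.nodes_lt
  | all a b h =>
    refine (nodes_subst_le _ _).trans_lt ?_
    obtain ⟨π, E, E', s, hE, hs, hs'⟩ :=
      h.exists_roots fun _ _ h => h.Sh_eq (ETree.mergeHeaded_allRule a b)
    simpa [nodes, hs, hs'] using hE.nodes_lt fun _ _ h => h.nodes_lt
  | trees =>
    simp only [nodes, roots_cons_tree, Multiset.map_cons, Multiset.sum_cons, ETree.nodes]
    omega
  | cuts =>
    simp only [nodes, roots_cons_cut, Multiset.map_cons, Multiset.sum_cons, ETree.nodes]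
    omega

/-- The properties that are invariant under merge reduction. -/
structure Mergeable (R : RawProof L) : Prop where
  wf : ∀ x ∈ R.roots, x.2.MWF
  regular : R.EV.Nodup
  positive : ∀ A B, Place.pos A B ∈ R.places → A.positive = true
  closed : ∀ A, Place.tree A ∈ R.places → A.fv = ∅
  level : ∃ lev, R.IsLevel lev
  tautology : ∀ val, ∃ A ∈ R.Dp, A.eval val

theorem MergeStep.mergeable (h : MergeStep R R') (hR : R.Mergeable) :
    R'.Mergeable ∧ ∃ ρ, Renames ρ R R' := by
  have hwf := h.mwf hR.wf
  have htaut := h.tautology hR.tautology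
  obtain ⟨lev, hlev⟩ := hR.level
  rcases h.places_occs_eq_or with ⟨hpl, hoc⟩ | ⟨a, b, hab⟩
  · refine ⟨⟨hwf, ?_, hpl ▸ hR.positive, hpl ▸ hR.closed, ⟨lev, ?_⟩, htaut⟩, id, .of_eq hpl hoc⟩
    · rw [← map_occs, hoc, map_occs]
      exact hR.regular
    · rw [IsLevel, hoc]
      exact hlev
  · have hren := hab.renames
    exact ⟨⟨hwf, hab.nodup_EV hR.regular, hren.positive hR.positive,
      fun A hA => hR.closed A ((hren.tree_iff hR.closed A).1 hA),
      hab.exists_isLevel hR.regular hlev, htaut⟩, _, hren⟩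

theorem Mergeable.exists_normalForm (hR : R.Mergeable) :
    ∃ Q ρ, MergesTo R Q ∧ Q.Mergeable ∧ Renames ρ R Q := by
  induction hn : R.nodes using Nat.strong_induction_on generalizing R with
  | _ n ih =>
    by_cases h : ∃ R', MergeStep R R'
    · obtain ⟨R', h⟩ := h
      obtain ⟨hR', ρ, hρ⟩ := h.mergeable hR
      obtain ⟨Q, τ, ⟨h₁, h₂⟩, hQ, hτ⟩ := ih _ (hn ▸ h.nodes_lt) hR' rfl
      exact ⟨Q, _, ⟨h₁.head h, h₂⟩, hQ, hρ.trans hτ⟩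
    · exact ⟨R, id, ⟨.refl, fun Q' hQ' => h ⟨Q', hQ'⟩⟩, hR, .of_eq rfl rfl⟩

/-! ### Normal forms of merge reduction -/

theorem nodup_map_of_ne {α β : Type*} {s : Multiset α} {f : α → β}
    (h : ∀ x y t, s = x ::ₘ y ::ₘ t → f x ≠ f y) : (s.map f).Nodup := by
  classical
  rw [Multiset.nodup_iff_ne_cons_cons]
  intro b t hb
  obtain ⟨x, hx, hfx, hx'⟩ := (Multiset.map_eq_cons f s _ b).2 hb
  obtain ⟨y, hy, hfy, -⟩ := (Multiset.map_eq_cons f _ _ b).2 hx'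
  refine h x y ((s.erase x).erase y) ?_ (hfx.trans hfy.symm)
  rw [Multiset.cons_erase hy, Multiset.cons_erase hx]

theorem nodup_trees_of_normal (hn : ∀ R', ¬ MergeStep R R') :
    (R.trees.map ETree.Sh).Nodup := by
  refine nodup_map_of_ne fun E F t ht hS => ?_
  obtain ⟨cuts, trees⟩ := R
  obtain rfl : trees = _ := ht
  exact hn _ (.trees E F cuts t hS)

theorem nodup_cuts_of_normal (hn : ∀ R', ¬ MergeStep R R') :
    (R.cuts.map fun C => (C.1.Sh, C.2.Sh)).Nodup := by
  refine nodup_map_of_ne fun C D t ht hS => ?_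
  obtain ⟨cuts, trees⟩ := R
  obtain rfl : cuts = _ := ht
  obtain ⟨hS₁, hS₂⟩ := Prod.mk.inj hS
  exact hn _ (.cuts C D t trees hS₁ hS₂)

theorem nodup_roots_of_normal (hn : ∀ R', ¬ MergeStep R R') :
    (R.roots.map Prod.fst).Nodup := by
  have htrees := (nodup_trees_of_normal hn).map fun A B h => Place.tree.inj h
  have hpos := (nodup_cuts_of_normal hn).map (f := fun x => Place.pos x.1 x.2)
    fun _ _ h => Prod.ext (Place.pos.inj h).1 (Place.pos.inj h).2
  have hneg := (nodup_cuts_of_normal hn).map (f := fun x => Place.neg x.1 x.2)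
    fun _ _ h => Prod.ext (Place.neg.inj h).1 (Place.neg.inj h).2
  simp only [Multiset.map_map, Function.comp_def] at htrees hpos hneg
  simp only [roots, Multiset.map_add, Multiset.map_map, Function.comp_def, Multiset.nodup_add]
  refine ⟨htrees, ⟨hpos, hneg, ?_⟩, ?_⟩ <;>
    · simp only [Multiset.disjoint_left, Multiset.mem_add, Multiset.mem_map]
      grind

theorem wf_of_normal (hn : ∀ R', ¬ MergeStep R R') (hR : R.Mergeable) {x : Place L × ETree L}
    (hx : x ∈ R.roots) : x.2.WF :=
  (hR.wf x hx).wf_of_isNormal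
    ⟨fun _ h => (exists_inTree hx h).elim fun _ h => hn _ (.loc h),
      fun a b _ h => (exists_inTree hx h).elim fun _ h => hn _ (.all a b h)⟩

theorem eq_of_path_eq_of_normal (hn : ∀ R', ¬ MergeStep R R') (hR : R.Mergeable)
    {π : Place L} {p : Path L} {a b : ℕ} (ha : (π, p, a) ∈ R.occs)
    (hb : (π, p, b) ∈ R.occs) : a = b := by
  obtain ⟨E, hE, ha⟩ := mem_occs.1 ha
  obtain ⟨F, hF, hb⟩ := mem_occs.1 hb
  obtain ⟨-, rfl⟩ := Prod.mk.inj
    (Multiset.inj_on_of_nodup_map (nodup_roots_of_normal hn) _ hE _ hF rfl)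
  exact congrArg Prod.snd ((wf_of_normal hn hR hE).occ_eq_of_path_eq ha hb rfl)

theorem isPreProof_of_normal (hn : ∀ R', ¬ MergeStep R R') (hR : R.Mergeable)
    (hd : ∀ A B, Place.pos A B ∈ R.places → B = A.dual) : R.IsPreProof where
  tree_wf E hE := wf_of_normal hn hR (tree_mem_roots hE)
  cut_wf C hC :=
    ⟨wf_of_normal hn hR (pos_mem_roots hC), wf_of_normal hn hR (neg_mem_roots hC)⟩
  cut_dual C hC := hd _ _ (pos_mem_places.2 ⟨C, hC, rfl, rfl⟩)
  cut_positive C hC := hR.positive _ _ (pos_mem_places.2 ⟨C, hC, rfl, rfl⟩)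
  trees_distinct := nodup_trees_of_normal hn
  cuts_distinct := by
    have hdual : R.cuts.map (fun C => (C.1.Sh, C.2.Sh)) =
        (R.cuts.map fun C => C.1.Sh).map fun A => (A, A.dual) := by
      rw [Multiset.map_map]
      refine Multiset.map_congr rfl fun C hC => ?_
      simp [hd _ _ (pos_mem_places.2 ⟨C, hC, rfl, rfl⟩)]
    exact (hdual ▸ nodup_cuts_of_normal hn).of_map _
  regular := hR.regular
  closed A hA := by
    obtain ⟨E, hE, rfl⟩ := Multiset.mem_map.1 hA
    exact hR.closed _ (tree_mem_places.2 ⟨E, hE, rfl⟩)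

/-- Expansion pre-proofs with a tautological deep sequent and levels of variables. -/
structure IsLeveled (P : RawProof L) : Prop where
  preProof : P.IsPreProof
  level : ∃ lev, P.IsLevel lev
  tautology : ∀ val, ∃ A ∈ P.Dp, A.eval val

end RawProof

/-! ### Cuts -/

/-- The condition of `RawProof.IsLevel` for a single tree. -/
def ETree.IsLevel (lev : ℕ → ℕ) (E : ETree L) : Prop :=
  ∀ o ∈ E.occs, ∀ y ∈ E.Sh.deps o.1, lev y < lev o.2

namespace ETree

variable {lev : ℕ → ℕ} {E F : ETree L}

theorem isLevel_and : (and E F).IsLevel lev ↔ E.IsLevel lev ∧ F.IsLevel lev := by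
  simp only [IsLevel, occs, Multiset.mem_add, Multiset.mem_map, or_imp, forall_and,
    forall_exists_index, and_imp, forall_apply_eq_imp_iff₂]
  simp [Occ.under, NNF.deps, NNF.top, Path.vars, Step.vars, Sh]

theorem isLevel_or : (or E F).IsLevel lev ↔ E.IsLevel lev ∧ F.IsLevel lev := by
  simp only [IsLevel, occs, Multiset.mem_add, Multiset.mem_map, or_imp, forall_and,
    forall_exists_index, and_imp, forall_apply_eq_imp_iff₂]
  simp [Occ.under, NNF.deps, NNF.top, Path.vars, Step.vars, Sh]

end ETree

section mkCut

variable {E F : ETree L}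

theorem mkCut_eq_or (E F : ETree L) : mkCut E F = (E, F) ∨ mkCut E F = (F, E) := by
  rw [mkCut]
  split_ifs <;> simp

theorem forall_mkCut (p : ETree L → Prop) : p (mkCut E F).1 ∧ p (mkCut E F).2 ↔ p E ∧ p F := by
  rcases mkCut_eq_or E F with h | h <;> simp [h, and_comm]

theorem EV_mkCut (E F : ETree L) : (mkCut E F).1.EV + (mkCut E F).2.EV = E.EV + F.EV := by
  rcases mkCut_eq_or E F with h | h <;> simp [h, add_comm]

theorem positive_mkCut (h : F.Sh.positive = !E.Sh.positive) :
    (mkCut E F).1.Sh.positive = true := by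
  rw [mkCut]
  split_ifs with hE
  · exact hE
  · simpa [h] using hE

theorem dual_mkCut {σ : ℕ → L.Term ℕ} (h : F.Sh.subst σ = (E.Sh.subst σ).dual) :
    (mkCut E F).2.Sh.subst σ = ((mkCut E F).1.Sh.subst σ).dual := by
  rcases mkCut_eq_or E F with h' | h' <;> simp [h', h]

theorem apply_Sh_mkCut {α : Type*} {w : NNF L 0 → α} (hw : w F.Sh = w E.Sh) :
    w (mkCut E F).1.Sh = w E.Sh := by
  rcases mkCut_eq_or E F with h | h <;> simp [h, hw]

end mkCut

theorem sum_map_le_of_nodup {α : Type*} {s t : Multiset α} (w : α → ℕ) (hs : s.Nodup)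
    (h : ∀ x ∈ s, w x ≠ 0 → x ∈ t) : (s.map w).sum ≤ (t.map w).sum := by
  classical
  obtain ⟨u, rfl⟩ : ∃ u, t = s.filter (fun x => w x ≠ 0) + u :=
    Multiset.le_iff_exists_add.1 <| (Multiset.le_iff_subset (hs.filter _)).2 fun x hx =>
      h x (Multiset.mem_filter.1 hx).1 (Multiset.mem_filter.1 hx).2
  have hzero : ((s.filter fun x => ¬ w x ≠ 0).map w).sum = 0 := by
    simp +contextual [Multiset.sum_eq_zero_iff]
  conv_lhs => rw [← Multiset.filter_add_not (fun x => w x ≠ 0) s]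
  rw [Multiset.map_add, Multiset.sum_add, hzero, Multiset.map_add, Multiset.sum_add]
  exact Nat.le_add_right _ _

namespace RawProof

variable {R P Q : RawProof L} {ρ : ℕ → ℕ}

theorem forall_mem_roots {p : ETree L → Prop} :
    (∀ x ∈ R.roots, p x.2) ↔ (∀ E ∈ R.trees, p E) ∧ ∀ C ∈ R.cuts, p C.1 ∧ p C.2 := by
  simp only [mem_roots, or_imp, forall_and, forall_exists_index, and_imp,
    forall_apply_eq_imp_iff₂]

theorem isLevel_iff {lev : ℕ → ℕ} : R.IsLevel lev ↔ ∀ x ∈ R.roots, x.2.IsLevel lev := by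
  simp only [IsLevel, mem_occs, ETree.IsLevel]
  constructor
  · intro h x hx o ho
    rw [← formula_of_mem_roots hx]
    exact h (x.1, o) ⟨x.2, hx, ho⟩
  · rintro h o ⟨E, hE, ho⟩
    rw [formula_of_mem_roots hE]
    exact h _ hE _ ho

/-- The cut-formulas. -/
def cutFormulas (R : RawProof L) : Multiset (NNF L 0) := R.cuts.map fun C => C.1.Sh

theorem Renames.mem_cutFormulas (h : Renames ρ R Q) {A : NNF L 0} (hA : A ∈ Q.cutFormulas) :
    ∃ B ∈ R.cutFormulas, A = B.subst (ren ρ) := by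
  obtain ⟨C, hC, rfl⟩ := Multiset.mem_map.1 hA
  obtain ⟨π, hπ, hA⟩ := h.places ▸ pos_mem_places.2 ⟨C, hC, rfl, rfl⟩
  cases π with
  | pos A₀ B₀ =>
    obtain ⟨D, hD, rfl, rfl⟩ := pos_mem_places.1 hπ
    exact ⟨_, Multiset.mem_map_of_mem _ hD, (Place.pos.inj hA).1.symm⟩
  | _ => cases hA

theorem IsLeveled.mergeable (h : P.IsLeveled) : P.Mergeable where
  wf := forall_mem_roots.2 ⟨fun E hE => (h.preProof.tree_wf E hE).mwf, fun C hC =>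
    ⟨(h.preProof.cut_wf C hC).1.mwf, (h.preProof.cut_wf C hC).2.mwf⟩⟩
  regular := h.preProof.regular
  positive A B hA := by
    obtain ⟨C, hC, rfl, rfl⟩ := pos_mem_places.1 hA
    exact h.preProof.cut_positive C hC
  closed A hA := by
    obtain ⟨E, hE, rfl⟩ := tree_mem_places.1 hA
    exact h.preProof.closed _ (Multiset.mem_map_of_mem _ hE)
  level := h.level
  tautology := h.tautology

theorem Mergeable.isLeveled_of_normal (hQ : Q.Mergeable) (hn : ∀ Q', ¬ MergeStep Q Q')
    (h : Renames ρ R Q)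
    (hd : ∀ C ∈ R.cuts, C.2.Sh.subst (ren ρ) = (C.1.Sh.subst (ren ρ)).dual) : Q.IsLeveled where
  preProof := isPreProof_of_normal hn hQ fun A B hA => by
    obtain ⟨π, hπ, hA⟩ := h.places ▸ hA
    cases π with
    | pos A₀ B₀ =>
      obtain ⟨D, hD, rfl, rfl⟩ := pos_mem_places.1 hπ
      obtain ⟨rfl, rfl⟩ := Place.pos.inj hA
      exact hd D hD
    | _ => cases hA
  level := hQ.level
  tautology := hQ.tautology

theorem Sh_eq_of_places (hP : P.IsPreProof) (hQ : Q.IsPreProof)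
    (h : ∀ A, Place.tree A ∈ Q.places ↔ Place.tree A ∈ P.places) : Q.Sh = P.Sh := by
  refine (Multiset.Nodup.ext hQ.trees_distinct hP.trees_distinct).2 fun A => ?_
  simpa [tree_mem_places] using h A

/-- A reduction step between leveled pre-proofs in which the quantifier depth of the cut-formulas
does not grow. -/
structure Progress (P Q : RawProof L) : Prop where
  leveled : Q.IsLeveled
  Sh_eq : Q.Sh = P.Sh
  step : CutStep P Q
  qd_le : ∀ r, (∀ A ∈ P.cutFormulas, A.qd ≤ r) → ∀ A ∈ Q.cutFormulas, A.qd ≤ r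

/-! ### Reduction of propositional cuts -/

/-- The decrease achieved by the reduction of a cut whose cut-formula is not quantified. -/
structure PropProgress (P Q : RawProof L) : Prop extends Progress P Q where
  size_lt : (Q.cutFormulas.map NNF.size).sum < (P.cutFormulas.map NNF.size).sum
  weight_le : ∀ r, (Q.cutFormulas.map (NNF.weight r)).sum ≤ (P.cutFormulas.map (NNF.weight r)).sum

section Or

variable {E₁ E₂ F₁ F₂ : ETree L} {cuts : Multiset (Cut L)} {trees : Multiset (ETree L)}

theorem IsPreProof.dual_of_or_and
    (hP : IsPreProof ⟨(ETree.or E₁ E₂, ETree.and F₁ F₂) ::ₘ cuts, trees⟩) :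
    F₁.Sh = E₁.Sh.dual ∧ F₂.Sh = E₂.Sh.dual :=
  NNF.and.inj (hP.cut_dual _ (Multiset.mem_cons_self _ _))

theorem IsLeveled.mergeable_prop
    (hP : IsLeveled ⟨(ETree.or E₁ E₂, ETree.and F₁ F₂) ::ₘ cuts, trees⟩) :
    Mergeable ⟨mkCut E₁ F₁ ::ₘ mkCut E₂ F₂ ::ₘ cuts, trees⟩ where
  wf := by
    have hwf := forall_mem_roots.1 hP.mergeable.wf
    simp only [forall_mem_roots, Multiset.forall_mem_cons, forall_mkCut] at hwf ⊢
    exact ⟨hwf.1, ⟨hwf.2.1.1.1, hwf.2.1.2.1⟩, ⟨hwf.2.1.1.2, hwf.2.1.2.2⟩, hwf.2.2⟩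
  regular := by
    have hEV := hP.preProof.regular
    simp only [EV, Multiset.cons_bind, EV_mkCut, ETree.EV] at hEV ⊢
    convert hEV using 1
    abel
  positive A B hA := by
    obtain ⟨hd₁, hd₂⟩ := hP.preProof.dual_of_or_and
    obtain ⟨C, hC, rfl, rfl⟩ := pos_mem_places.1 hA
    simp only [Multiset.mem_cons] at hC
    rcases hC with rfl | rfl | hC
    · exact positive_mkCut (by rw [hd₁, NNF.positive_dual])
    · exact positive_mkCut (by rw [hd₂, NNF.positive_dual])
    · exact hP.preProof.cut_positive C (Multiset.mem_cons_of_mem hC)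
  closed A hA := by
    obtain ⟨E, hE, rfl⟩ := tree_mem_places.1 hA
    exact hP.mergeable.closed _ (tree_mem_places.2 ⟨E, hE, rfl⟩)
  level := by
    obtain ⟨lev, hlev⟩ := hP.level
    refine ⟨lev, ?_⟩
    simp only [isLevel_iff, forall_mem_roots, Multiset.forall_mem_cons, forall_mkCut] at hlev ⊢
    obtain ⟨htrees, ⟨hor, hand⟩, hcuts⟩ := hlev
    simp only [ETree.isLevel_or, ETree.isLevel_and] at hor hand
    exact ⟨htrees, ⟨hor.1, hand.1⟩, ⟨hor.2, hand.2⟩, hcuts⟩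
  tautology val := by
    have htaut := hP.tautology val
    simp only [eval_Dp_iff, Multiset.mem_cons, exists_eq_or_imp, ETree.Dp, PForm.eval,
      forall_mkCut fun E => E.Dp.eval val] at htaut ⊢
    grind

theorem IsPreProof.dual_prop
    (hP : IsPreProof ⟨(ETree.or E₁ E₂, ETree.and F₁ F₂) ::ₘ cuts, trees⟩) (σ : ℕ → L.Term ℕ) :
    ∀ C ∈ mkCut E₁ F₁ ::ₘ mkCut E₂ F₂ ::ₘ cuts, C.2.Sh.subst σ = (C.1.Sh.subst σ).dual := by
  obtain ⟨hd₁, hd₂⟩ := hP.dual_of_or_and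
  simp only [Multiset.forall_mem_cons]
  refine ⟨dual_mkCut ?_, dual_mkCut ?_, fun C hC => ?_⟩
  · rw [hd₁, NNF.dual_subst]
  · rw [hd₂, NNF.dual_subst]
  · rw [hP.cut_dual C (Multiset.mem_cons_of_mem hC), NNF.dual_subst]

theorem IsPreProof.map_cutFormulas_prop {α : Type*} {w : NNF L 0 → α} (hw : ∀ A, w A.dual = w A)
    (hP : IsPreProof ⟨(ETree.or E₁ E₂, ETree.and F₁ F₂) ::ₘ cuts, trees⟩) :
    (cutFormulas ⟨mkCut E₁ F₁ ::ₘ mkCut E₂ F₂ ::ₘ cuts, trees⟩).map w =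
      w E₁.Sh ::ₘ w E₂.Sh ::ₘ (cutFormulas ⟨cuts, trees⟩).map w := by
  obtain ⟨hd₁, hd₂⟩ := hP.dual_of_or_and
  simp only [cutFormulas, Multiset.map_cons, apply_Sh_mkCut (w := w) (hd₁ ▸ hw E₁.Sh),
    apply_Sh_mkCut (w := w) (hd₂ ▸ hw E₂.Sh)]

theorem Renames.sum_cutFormulas_le (h : Renames ρ R Q) (hQ : Q.cutFormulas.Nodup)
    {w : NNF L 0 → ℕ} (hw : ∀ σ A, w (A.subst σ) = w A) :
    (Q.cutFormulas.map w).sum ≤ (R.cutFormulas.map w).sum := by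
  refine (sum_map_le_of_nodup (t := R.cutFormulas.map (NNF.subst (ren ρ))) w hQ ?_).trans ?_
  · intro A hA _
    obtain ⟨B, hB, rfl⟩ := h.mem_cutFormulas hA
    exact Multiset.mem_map_of_mem _ hB
  · simp [hw]

theorem IsLeveled.exists_propProgress_or
    (hP : IsLeveled ⟨(ETree.or E₁ E₂, ETree.and F₁ F₂) ::ₘ cuts, trees⟩) :
    ∃ Q, PropProgress ⟨(ETree.or E₁ E₂, ETree.and F₁ F₂) ::ₘ cuts, trees⟩ Q := by
  have hpre := hP.preProof
  obtain ⟨Q, ρ, hQ, hQM, hρ⟩ := hP.mergeable_prop.exists_normalForm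
  have hQL : Q.IsLeveled := hQM.isLeveled_of_normal hQ.2 hρ (hpre.dual_prop _)
  have hsum {w : NNF L 0 → ℕ} (hw : ∀ σ A, w (A.subst σ) = w A) (hw' : ∀ A, w A.dual = w A) :
      (Q.cutFormulas.map w).sum ≤
        w E₁.Sh + (w E₂.Sh + ((cutFormulas ⟨cuts, trees⟩).map w).sum) := by
    simpa only [hpre.map_cutFormulas_prop hw', Multiset.sum_cons] using
      hρ.sum_cutFormulas_le hQL.preProof.cuts_distinct hw
  refine ⟨Q, ⟨hQL, ?_, ⟨hpre, hQL.preProof, .prop _ _ _ _ _ _ _ hQ⟩, fun r hr A hA => ?_⟩, ?_,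
    fun r => ?_⟩
  · refine Sh_eq_of_places hpre hQL.preProof fun A => ?_
    rw [hρ.tree_iff hP.mergeable_prop.closed, tree_mem_places, tree_mem_places]
  · obtain ⟨B, hB, rfl⟩ := hρ.mem_cutFormulas hA
    rw [NNF.qd_subst]
    have hBqd := Multiset.mem_map_of_mem NNF.qd hB
    simp only [hpre.map_cutFormulas_prop NNF.qd_dual, Multiset.mem_cons, Multiset.mem_map] at hBqd
    simp only [cutFormulas, Multiset.map_cons, Multiset.forall_mem_cons, ETree.Sh, NNF.qd,
      max_le_iff] at hr
    grind [cutFormulas]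
  · refine (hsum NNF.size_subst NNF.size_dual).trans_lt ?_
    simp only [cutFormulas, Multiset.map_cons, Multiset.sum_cons, ETree.Sh, NNF.size]
    omega
  · refine (hsum (NNF.weight_subst r) (NNF.weight_dual r)).trans_eq ?_
    simp only [cutFormulas, Multiset.map_cons, Multiset.sum_cons, ETree.Sh, NNF.weight, add_assoc]

end Or

theorem IsLeveled.propProgress_atom {l : ℕ} {S : L.Relations l} {ts : Fin l → L.Term ℕ}
    {cuts : Multiset (Cut L)} {trees : Multiset (ETree L)}
    (hP : IsLeveled ⟨(ETree.lit true S ts, ETree.lit false S ts) ::ₘ cuts, trees⟩) :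
    PropProgress ⟨(ETree.lit true S ts, ETree.lit false S ts) ::ₘ cuts, trees⟩
      ⟨cuts, trees⟩ := by
  obtain ⟨hpre, ⟨lev, hlev⟩, htaut⟩ := hP
  have hQ : IsPreProof ⟨cuts, trees⟩ :=
    { tree_wf := hpre.tree_wf
      cut_wf := (Multiset.forall_mem_cons.1 hpre.cut_wf).2
      cut_dual := (Multiset.forall_mem_cons.1 hpre.cut_dual).2
      cut_positive := (Multiset.forall_mem_cons.1 hpre.cut_positive).2
      trees_distinct := hpre.trees_distinct
      cuts_distinct := (Multiset.nodup_cons.1 (Multiset.map_cons _ _ cuts ▸ hpre.cuts_distinct)).2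
      regular := by simpa [EV, ETree.EV] using hpre.regular
      closed := hpre.closed }
  refine ⟨⟨⟨hQ, ⟨lev, ?_⟩, fun val => ?_⟩, rfl, ⟨hpre, hQ, .atom _ _ _ _⟩, fun r hr => ?_⟩, ?_,
    fun r => ?_⟩
  · simp only [isLevel_iff, forall_mem_roots, Multiset.forall_mem_cons] at hlev ⊢
    exact ⟨hlev.1, hlev.2.2⟩
  · have := htaut val
    simp only [eval_Dp_iff, Multiset.mem_cons, exists_eq_or_imp, ETree.Dp, PForm.eval] at this ⊢
    grind
  · simp only [cutFormulas, Multiset.map_cons, Multiset.forall_mem_cons] at hr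
    exact hr.2
  all_goals simp [cutFormulas, ETree.Sh, NNF.size, NNF.weight]

theorem IsLeveled.exists_propProgress (hP : P.IsLeveled) {C : Cut L} (hC : C ∈ P.cuts)
    (hne : ∀ A, C.1.Sh ≠ NNF.ex A) : ∃ Q, PropProgress P Q := by
  obtain ⟨E, F⟩ := C
  obtain ⟨hE, hF⟩ := hP.preProof.cut_wf _ hC
  have hd := hP.preProof.cut_dual _ hC
  have hpos := hP.preProof.cut_positive _ hC
  obtain ⟨_, trees⟩ := P
  obtain ⟨cuts, rfl⟩ := Multiset.exists_cons_of_mem hC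
  cases E with
  | lit b S ts =>
    obtain rfl : b = true := hpos
    obtain rfl : F = ETree.lit false S ts := hF.eq_lit_of_Sh hd
    exact ⟨_, hP.propProgress_atom⟩
  | or E₁ E₂ =>
    obtain ⟨F₁, F₂, rfl, -, -⟩ := hF.eq_and_of_Sh hd
    exact hP.exists_propProgress_or
  | ex A => exact (hne A rfl).elim
  | exp G t E =>
    obtain ⟨A, hA, -⟩ := hE.2.2.2
    exact (hne A (ETree.Sh_of_exBody hA)).elim
  | and | all => cases hpos
  | merge => exact hE.elim

theorem IsLeveled.exists_reduces_quantified (hP : P.IsLeveled) :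
    ∃ Q, Q.IsLeveled ∧ Q.Sh = P.Sh ∧ P.Reduces Q ∧
      (∀ r, (∀ A ∈ P.cutFormulas, A.qd ≤ r) → ∀ A ∈ Q.cutFormulas, A.qd ≤ r) ∧
      (∀ r, (Q.cutFormulas.map (NNF.weight r)).sum ≤ (P.cutFormulas.map (NNF.weight r)).sum) ∧
      ∀ C ∈ Q.cuts, ∃ A, C.1.Sh = NNF.ex A := by
  induction hn : (P.cutFormulas.map NNF.size).sum using Nat.strong_induction_on generalizing P with
  | _ n ih =>
    by_cases h : ∀ C ∈ P.cuts, ∃ A, C.1.Sh = NNF.ex A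
    · exact ⟨P, hP, rfl, .refl, fun _ h => h, fun _ => le_rfl, h⟩
    push Not at h
    obtain ⟨C, hC, hne⟩ := h
    obtain ⟨Q, hQ⟩ := hP.exists_propProgress hC hne
    obtain ⟨Q', hQ', hSh, hred, hqd, hw, hex⟩ := ih _ (hn ▸ hQ.size_lt) hQ.leveled rfl
    exact ⟨Q', hQ', hSh.trans hQ.Sh_eq, hred.head hQ.step, fun r hr => hqd r (hQ.qd_le r hr),
      fun r => (hw r).trans (hQ.weight_le r), hex⟩

end RawProof

/-! ### Variables, expansions and long disjunctions -/

namespace ETree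

theorem fv_Sh_subset_vars {E : ETree L} : E.Sh.fv ⊆ E.vars := by
  induction E with
  | lit b R ts => simp [Sh, NNF.fv, vars, varFinsetLeft_relabel_inl]
  | and E F ihE ihF | or E F ihE ihF => exact Set.union_subset_union ihE ihF
  | ex => exact subset_rfl
  | exp F t E ihF _ => exact ihF.trans (Set.subset_union_left.trans Set.subset_union_left)
  | all => exact Set.subset_union_left.trans Set.subset_union_left
  | merge E F ihE _ => exact ihE.trans Set.subset_union_left

theorem mem_vars_of_mem_occs {E : ETree L} {o : Occ L} (ho : o ∈ E.occs) {y : ℕ}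
    (hy : y ∈ Path.vars o.1 ∨ y = o.2) : y ∈ E.vars := by
  induction E generalizing o with
  | lit | ex => simp [occs] at ho
  | and E F ihE ihF | or E F ihE ihF =>
    simp only [occs, Multiset.mem_add, Multiset.mem_map] at ho
    obtain ⟨o, ho, rfl⟩ | ⟨o, ho, rfl⟩ := ho <;>
      simp only [Occ.under, Path.vars, Step.vars, Finset.empty_union] at hy
    · exact Or.inl (ihE ho hy)
    · exact Or.inr (ihF ho hy)
  | exp F t E ihF ihE =>
    simp only [occs, Multiset.mem_add, Multiset.mem_map] at ho
    obtain ho | ⟨o, ho, rfl⟩ := ho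
    · exact Or.inl (Or.inl (ihF ho hy))
    · simp only [Occ.under, Path.vars, Step.vars, Finset.mem_union, or_assoc] at hy
      exact hy.elim (fun hy => Or.inl (Or.inr hy)) fun hy => Or.inr (ihE ho hy)
  | all A c E ih =>
    simp only [occs, Multiset.mem_cons, Multiset.mem_map] at ho
    obtain rfl | ⟨o, ho, rfl⟩ := ho
    · simp only [Path.vars, Finset.notMem_empty, false_or] at hy
      exact Or.inl (Or.inr hy)
    · simp only [Occ.under, Path.vars, Step.vars, Finset.empty_union] at hy
      exact Or.inr (ih ho hy)
  | merge E F ihE ihF =>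
    exact (Multiset.mem_add.1 ho).imp (ihE · hy) (ihF · hy)

theorem deps_subset_vars {E : ETree L} {o : Occ L} (ho : o ∈ E.occs) :
    E.Sh.deps o.1 ⊆ E.vars := by
  rintro y (hy | hy)
  · exact mem_vars_of_mem_occs ho (Or.inl hy)
  · exact fv_Sh_subset_vars (NNF.fv_top_subset _ _ hy)

theorem mem_vars_of_mem_EV {E : ETree L} {a : ℕ} (h : a ∈ E.EV) : a ∈ E.vars := by
  obtain ⟨p, hp⟩ := mem_EV_iff.1 h
  exact mem_vars_of_mem_occs hp (Or.inr rfl)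

theorem vars_finite (E : ETree L) : E.vars.Finite := by
  induction E with
  | lit b R ts =>
    refine (Finset.finite_toSet (Finset.univ.biUnion fun i => (ts i).varFinset)).subset ?_
    intro x hx
    simpa [vars] using hx
  | and E F ihE ihF | or E F ihE ihF | merge E F ihE ihF => exact ihE.union ihF
  | ex A => exact A.fv_finite
  | exp F t E ihF ihE => exact (ihF.union (Finset.finite_toSet t.varFinset)).union ihE
  | all A a E ih => exact (A.fv_finite.union (Set.finite_singleton a)).union ih

theorem IsLevel.congr {E : ETree L} {lev lev' : ℕ → ℕ} (hE : E.IsLevel lev)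
    (h : ∀ y ∈ E.vars, lev' y = lev y) : E.IsLevel lev' := fun o ho y hy => by
  rw [h y (deps_subset_vars ho hy), h _ (mem_vars_of_mem_occs ho (Or.inr rfl))]
  exact hE o ho y hy

theorem isLevel_all {A : NNF L 1} {a : ℕ} {E : ETree L} {lev : ℕ → ℕ} :
    (all A a E).IsLevel lev ↔ (∀ y ∈ A.fv, lev y < lev a) ∧
      ∀ o ∈ E.occs, ∀ y, y ∈ Path.vars o.1 ∨ y ∈ A.fv → lev y < lev o.2 := by
  simp only [IsLevel, occs, Multiset.mem_cons, Multiset.mem_map, forall_eq_or_imp,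
    forall_exists_index, and_imp, forall_apply_eq_imp_iff₂, Sh, NNF.deps, NNF.top, NNF.fv,
    Occ.under, Path.vars, Step.vars, Finset.empty_union, Set.mem_union, Set.mem_ofPred_eq,
    Finset.notMem_empty, false_or]

section Expansions

variable {F G : ETree L} {A : NNF L 1} {t : L.Term ℕ} {lev : ℕ → ℕ}

theorem mem_vars_of_mem_expansions (h : (t, G) ∈ F.expansions) {y : ℕ} (hy : y ∈ t.varFinset) :
    y ∈ F.vars := by
  induction F with
  | exp F s E ihF _ =>
    simp only [expansions, List.mem_append, List.mem_singleton, Prod.mk.injEq] at h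
    obtain h | ⟨rfl, rfl⟩ := h
    · exact Or.inl (Or.inl (ihF h))
    · exact Or.inl (Or.inr hy)
  | _ => simp [expansions] at h

theorem vars_subset_of_mem_expansions (h : (t, G) ∈ F.expansions) : G.vars ⊆ F.vars := by
  induction F with
  | exp F s E ihF _ =>
    simp only [expansions, List.mem_append, List.mem_singleton, Prod.mk.injEq] at h
    obtain h | ⟨rfl, rfl⟩ := h
    · exact (ihF h).trans (Set.subset_union_left.trans Set.subset_union_left)
    · exact Set.subset_union_right
  | _ => simp [expansions] at h

theorem WF.of_mem_expansions (hF : F.WF) (hA : F.exBody = some A) (h : (t, G) ∈ F.expansions) :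
    G.WF ∧ G.Sh = A.inst t := by
  induction F with
  | exp F s E ihF _ =>
    obtain ⟨hF, hE, -, B, hB, hS⟩ := hF
    obtain rfl : B = A := Option.some.inj (hB.symm.trans hA)
    simp only [expansions, List.mem_append, List.mem_singleton, Prod.mk.injEq] at h
    obtain h | ⟨rfl, rfl⟩ := h
    · exact ihF hF hA h
    · exact ⟨hE, hS⟩
  | _ => simp [expansions] at h

theorem EV_eq_sum_expansions (hA : F.exBody = some A) :
    F.EV = (F.expansions.map fun x => x.2.EV).sum := by
  induction F with
  | ex => simp [expansions, EV]
  | exp F s E ihF _ => simp [expansions, EV, ihF hA]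
  | _ => simp [exBody] at hA

theorem eval_iff_expansions (hA : F.exBody = some A) {val : Valuation L} :
    F.Dp.eval val ↔ ∃ x ∈ F.expansions, x.2.Dp.eval val := by
  induction F with
  | ex => simp [expansions, Dp, PForm.eval]
  | exp F s E ihF _ => simp [expansions, Dp, PForm.eval, ihF hA, or_and_right, exists_or]
  | _ => simp [exBody] at hA

theorem under_mem_occs_of_mem_expansions (h : (t, G) ∈ F.expansions) {o : Occ L}
    (ho : o ∈ G.occs) : o.under (Step.ex t) ∈ F.occs := by
  induction F with
  | exp F s E ihF _ =>
    simp only [expansions, List.mem_append, List.mem_singleton, Prod.mk.injEq] at h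
    obtain h | ⟨rfl, rfl⟩ := h
    · exact Multiset.mem_add.2 (Or.inl (ihF h))
    · exact Multiset.mem_add.2 (Or.inr (Multiset.mem_map_of_mem _ ho))
  | _ => simp [expansions] at h

theorem IsLevel.lt_of_mem_fv (hA : F.exBody = some A) (hF : F.IsLevel lev) {o : Occ L}
    (ho : o ∈ F.occs) {y : ℕ} (hy : y ∈ A.fv) : lev y < lev o.2 := by
  refine hF o ho y (Or.inr ?_)
  rw [Sh_of_exBody hA]
  simpa only [NNF.top, NNF.fv] using hy

theorem IsLevel.of_mem_expansions (hF : F.WF) (hA : F.exBody = some A) (hl : F.IsLevel lev)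
    (h : (t, G) ∈ F.expansions) : G.IsLevel lev := by
  intro o ho y hy
  have ho' := under_mem_occs_of_mem_expansions h ho
  obtain hy | hy := hy
  · exact hl _ ho' y (Or.inl (Finset.mem_union_right _ hy))
  have hfv := NNF.fv_top_subset _ _ hy
  rw [(hF.of_mem_expansions hA h).2] at hfv
  obtain hy | hy := NNF.mem_fv_inst hfv
  · exact hl.lt_of_mem_fv hA ho' hy
  · exact hl _ ho' y (Or.inl (Finset.mem_union_left _ hy))

end Expansions

section BigOr

theorem EV_bigOr (E : ETree L) (l : List (ETree L)) :
    (bigOr E l).EV = ((E :: l).map EV).sum := by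
  induction l generalizing E with
  | nil => simp [bigOr]
  | cons F l ih => simp [bigOr, EV, ih]

theorem EV_bigAnd (E : ETree L) (l : List (ETree L)) :
    (bigAnd E l).EV = ((E :: l).map EV).sum := by
  induction l generalizing E with
  | nil => simp [bigAnd]
  | cons F l ih => simp [bigAnd, EV, ih]

theorem eval_bigOr {val : Valuation L} {E : ETree L} {l : List (ETree L)} :
    (bigOr E l).Dp.eval val ↔ ∃ G ∈ E :: l, G.Dp.eval val := by
  induction l generalizing E with
  | nil => simp [bigOr]
  | cons F l ih => simp [bigOr, Dp, PForm.eval, ih]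

theorem eval_bigAnd {val : Valuation L} {E : ETree L} {l : List (ETree L)} :
    (bigAnd E l).Dp.eval val ↔ ∀ G ∈ E :: l, G.Dp.eval val := by
  induction l generalizing E with
  | nil => simp [bigAnd]
  | cons F l ih => simp [bigAnd, Dp, PForm.eval, ih]

theorem bigOr_bigAnd_induction {motive : ETree L → ETree L → Prop}
    (or_and : ∀ E F E' F', motive E F → motive E' F' → motive (or E E') (and F F'))
    {E F : ETree L} {l : List (ETree L × ETree L)}
    (h : ∀ x ∈ (E, F) :: l, motive x.1 x.2) :
    motive (bigOr E (l.map Prod.fst)) (bigAnd F (l.map Prod.snd)) := by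
  induction l generalizing E F with
  | nil => exact h (E, F) (List.mem_singleton_self _)
  | cons x l ih =>
    obtain ⟨hEF, hl⟩ := List.forall_mem_cons.1 h
    exact or_and _ _ _ _ hEF (ih hl)

end BigOr

end ETree

namespace RawProof

section DisjunctionCut

variable {l : List (ETree L × ETree L)} {C : Cut L}

theorem disjunctionCut_induction {motive : ETree L → ETree L → Prop} (hC : C ∈ disjunctionCut l)
    (or_and : ∀ E F E' F', motive E F → motive E' F' → motive (.or E E') (.and F F'))
    (h : ∀ x ∈ l, motive x.1 x.2) : ∃ E F, C = mkCut E F ∧ motive E F := by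
  cases l with
  | nil => simp [disjunctionCut] at hC
  | cons x l =>
    exact ⟨_, _, Multiset.mem_singleton.1 hC, ETree.bigOr_bigAnd_induction or_and h⟩

theorem forall_mem_disjunctionCut {p : ETree L → Prop} (hor : ∀ E F, p E → p F → p (.or E F))
    (hand : ∀ E F, p E → p F → p (.and E F)) (h : ∀ x ∈ l, p x.1 ∧ p x.2) :
    ∀ C ∈ disjunctionCut l, p C.1 ∧ p C.2 := by
  intro C hC
  obtain ⟨E, F, rfl, hEF⟩ := disjunctionCut_induction (motive := fun E F => p E ∧ p F) hC
    (fun _ _ _ _ h₁ h₂ => ⟨hor _ _ h₁.1 h₂.1, hand _ _ h₁.2 h₂.2⟩) h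
  exact (forall_mkCut p).2 hEF

theorem positive_of_mem_disjunctionCut (hC : C ∈ disjunctionCut l)
    (h : ∀ x ∈ l, x.2.Sh.positive = !x.1.Sh.positive) : C.1.Sh.positive = true := by
  obtain ⟨E, F, rfl, hEF⟩ := disjunctionCut_induction
    (motive := fun E F => F.Sh.positive = !E.Sh.positive) hC (fun _ _ _ _ _ _ => rfl) h
  exact positive_mkCut hEF

theorem dual_of_mem_disjunctionCut {σ : ℕ → L.Term ℕ} (hC : C ∈ disjunctionCut l)
    (h : ∀ x ∈ l, x.2.Sh.subst σ = (x.1.Sh.subst σ).dual) :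
    C.2.Sh.subst σ = (C.1.Sh.subst σ).dual := by
  obtain ⟨E, F, rfl, hEF⟩ := disjunctionCut_induction
    (motive := fun E F => F.Sh.subst σ = (E.Sh.subst σ).dual) hC
    (fun _ _ _ _ h₁ h₂ => congrArg₂ NNF.and h₁ h₂) h
  exact dual_mkCut hEF

theorem EV_disjunctionCut (l : List (ETree L × ETree L)) :
    ((disjunctionCut l).bind fun C => C.1.EV + C.2.EV) =
      (l.map fun x => x.1.EV + x.2.EV).sum := by
  cases l with
  | nil => simp [disjunctionCut]
  | cons x l =>
    simp only [disjunctionCut, Multiset.singleton_bind, EV_mkCut, ETree.EV_bigOr, ETree.EV_bigAnd,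
      ← List.map_cons, List.map_map, List.sum_map_add]
    rfl

theorem eval_disjunctionCut {val : Valuation L} (h₁ : ∃ x ∈ l, x.1.Dp.eval val)
    (h₂ : ∀ x ∈ l, x.2.Dp.eval val) :
    ∃ C ∈ disjunctionCut l, C.1.Dp.eval val ∧ C.2.Dp.eval val := by
  cases l with
  | nil => simp at h₁
  | cons x l =>
    refine ⟨_, Multiset.mem_singleton_self _,
      (forall_mkCut fun E => E.Dp.eval val).2 ⟨ETree.eval_bigOr.2 ?_, ETree.eval_bigAnd.2 ?_⟩⟩
    · obtain ⟨y, hy, hval⟩ := h₁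
      exact ⟨y.1, List.mem_map_of_mem (f := Prod.fst) hy, hval⟩
    · exact List.forall_mem_map (f := Prod.snd) (l := x :: l).2 h₂

end DisjunctionCut

theorem exists_freshRenamings (n : ℕ) {S V : Set ℕ} (hV : V.Finite) (hS : S ⊆ V) :
    ∃ η : Fin n → ℕ → ℕ, FreshRenamings η S V := by
  classical
  obtain ⟨B, hB⟩ := hV.bddAbove
  have hlt : ∀ x ∈ V, x < B + 1 := fun x hx => Nat.lt_succ_of_le (hB hx)
  refine ⟨fun i x => if x ∈ S then x + (B + 1) * (i + 1) else x, ?_, ?_, ?_⟩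
  · intro i x hx
    exact if_neg hx
  · intro i x hx hxV
    rw [if_pos hx] at hxV
    nlinarith [hlt _ hxV]
  · intro i j x hx y hy h
    rw [if_pos hx, if_pos hy] at h
    have hdiv (k : ℕ) {z : ℕ} (hz : z ∈ S) : (z + (B + 1) * (k + 1)) / (B + 1) = k + 1 := by
      rw [Nat.add_mul_div_left _ _ B.succ_pos, Nat.div_eq_of_lt (hlt z (hS hz)), zero_add]
    have hij : (i : ℕ) = j := by
      have hdivij := hdiv i hx
      rw [h, hdiv j hy] at hdivij
      omega
    rw [hij] at h
    exact ⟨Fin.ext hij, Nat.add_right_cancel h⟩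

theorem vars_eq_biUnion (P : RawProof L) : P.vars = ⋃ x ∈ {x | x ∈ P.roots}, x.2.vars := by
  ext y
  have h := forall_mem_roots (R := P) (p := fun E => y ∉ E.vars)
  simp only [vars, Set.mem_ofPred_eq, Set.mem_union, Set.mem_iUnion, exists_prop]
  grind

theorem vars_finite (P : RawProof L) : P.vars.Finite := by
  rw [vars_eq_biUnion]
  exact (Multiset.finite_toSet P.roots).biUnion fun x _ => x.2.vars_finite

theorem vars_subset_of_mem_roots {P : RawProof L} {x : Place L × ETree L} (hx : x ∈ P.roots) :
    x.2.vars ⊆ P.vars := by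
  rw [vars_eq_biUnion]
  exact Set.subset_biUnion_of_mem (u := fun x : Place L × ETree L => x.2.vars) hx

end RawProof

/-! ### Reduction of quantified cuts -/

/-- The substitution for a copy made in the reduction of a quantified cut: the renaming `η` followed
by `[a\t]`. -/
def copySubst (a : ℕ) (t : L.Term ℕ) (η : ℕ → ℕ) : ℕ → L.Term ℕ := fun x => single a t (η x)

/-- The tree `Gη[a\t]`. The two substitutions are not composed, since each of them may join the
expansions whose terms it makes equal. -/
noncomputable def ETree.copy (a : ℕ) (t : L.Term ℕ) (η : ℕ → ℕ) (G : ETree L) : ETree L :=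
  (G.subst (ren η)).subst (single a t)

namespace ETree

variable {a : ℕ} {t : L.Term ℕ} {η : ℕ → ℕ} {G : ETree L}

theorem Sh_copy : (G.copy a t η).Sh = G.Sh.subst (copySubst a t η) := by
  simp only [copy, Sh_subst, NNF.subst_subst]
  rfl

theorem EV_copy : (G.copy a t η).EV = G.EV.map fun x => substVar (single a t) (η x) := by
  simp only [copy, EV_subst, Multiset.map_map]
  rfl

theorem eval_copy {val : Valuation L} : (G.copy a t η).Dp.eval val ↔
    G.Dp.eval fun l R ts => val l R fun j => (ts j).subst (copySubst a t η) := by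
  simp only [copy, eval_subst, term_subst_subst]
  rfl

theorem substVar_single_of_ne {b : ℕ} (h : b ≠ a) : substVar (single a t) b = b :=
  substVar_eq (by simp [single, h])

theorem occs_copy (h : ∀ x ∈ G.EV, η x ≠ a) :
    (G.copy a t η).occs = G.occs.map fun o => (Path.subst (copySubst a t η) o.1, η o.2) := by
  simp only [copy, occs_subst, Multiset.map_map]
  refine Multiset.map_congr rfl fun o ho => ?_
  have hne : η o.2 ≠ a := h o.2 (map_snd_occs G ▸ Multiset.mem_map_of_mem _ ho)
  simp only [Function.comp_apply, Occ.subst, Path.subst_subst]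
  exact congrArg _ (substVar_single_of_ne hne)

theorem MWF.copy (hG : G.MWF) (h : ∀ x ∈ G.EV, η x ≠ a) : (G.copy a t η).MWF := by
  refine (hG.subst fun x _ => ⟨η x, rfl⟩).subst fun y hy => ?_
  rw [EV_subst] at hy
  obtain ⟨x, hx, rfl⟩ := Multiset.mem_map.1 hy
  exact ⟨η x, by simp [single, h x hx]⟩

/-- Levels of the variables of the original increase by `N` in the copy, so that they exceed the
levels of the variables of `t`. -/
theorem isLevel_copy {lev lev' : ℕ → ℕ} {N : ℕ} (hη : ∀ x ∈ G.EV, η x ≠ a)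
    (hEV : ∀ x ∈ G.EV, lev' (η x) = lev x + N)
    (ha : ∀ y ∈ (copySubst a t η a).varFinset, lev' y < N)
    (hvars : ∀ x ∈ G.vars, x ≠ a → ∀ y ∈ (copySubst a t η x).varFinset, lev' y ≤ lev x + N)
    (hG : ∀ o ∈ G.occs, ∀ x ∈ G.Sh.deps o.1, x = a ∨ lev x < lev o.2) :
    (G.copy a t η).IsLevel lev' := by
  rw [IsLevel, occs_copy hη, Sh_copy, Multiset.forall_mem_map_iff]
  intro o ho y hy
  obtain ⟨x, hx, hyx⟩ := NNF.mem_deps_subst hy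
  rw [hEV o.2 (mem_EV_iff.2 ⟨o.1, ho⟩)]
  by_cases hxa : x = a
  · subst hxa
    exact (ha y hyx).trans_le (Nat.le_add_left N _)
  · exact (hvars x (deps_subset_vars ho hx) hxa y hyx).trans_lt
      (Nat.add_lt_add_right ((hG o ho x hx).resolve_left hxa) N)

end ETree

theorem sum_bind {ι α β : Type*} (s : Finset ι) (f : ι → Multiset α) (g : α → Multiset β) :
    (∑ i ∈ s, f i).bind g = ∑ i ∈ s, (f i).bind g :=
  map_sum (⟨⟨fun m => m.bind g, Multiset.zero_bind g⟩, fun m n => Multiset.add_bind m n g⟩ :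
    Multiset α →+ Multiset β) f s

namespace RawProof

namespace FreshRenamings

variable {n : ℕ} {η : Fin n → ℕ → ℕ} {S V : Set ℕ}

theorem nodup_sum_map {X : Multiset ℕ} (h : FreshRenamings η {x | x ∈ X} V) (hX : X.Nodup) :
    (∑ i, X.map (η i)).Nodup := by
  have hsum : ∑ i, X.map (η i) = (Finset.univ.val ×ˢ X).map fun x => η x.1 x.2 := by
    change _ = (Finset.univ.val.bind fun i => X.map (Prod.mk i)).map _
    simp only [Multiset.map_bind, Multiset.map_map, Function.comp_def]
    rfl
  rw [hsum]
  refine (Finset.univ.nodup.product hX).map_on fun x hx y hy hxy => ?_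
  obtain ⟨h₁, h₂⟩ := h.injective x.1 y.1 x.2 (Multiset.mem_product.1 hx).2 y.2
    (Multiset.mem_product.1 hy).2 hxy
  exact Prod.ext h₁ h₂

theorem exists_extension (h : FreshRenamings η S V) {β : Type*} (f g : ℕ → β) :
    ∃ f' : ℕ → β, (∀ i, ∀ x ∈ S, f' (η i x) = g x) ∧ ∀ y ∈ V, f' y = f y := by
  classical
  let φ : Fin n × S → ℕ := fun x => η x.1 x.2
  have hφ : Function.Injective φ := fun x y hxy =>
    have hxy := h.injective x.1 y.1 x.2 x.2.2 y.2 y.2.2 hxy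
    Prod.ext hxy.1 (Subtype.ext hxy.2)
  refine ⟨Function.extend φ (fun x => g x.2) f, fun i x hx => ?_, fun y hy => ?_⟩
  · exact hφ.extend_apply _ _ (i, ⟨x, hx⟩)
  · refine Function.extend_apply' _ _ _ ?_
    rintro ⟨x, rfl⟩
    exact h.fresh x.1 x.2 x.2.2 hy

end FreshRenamings

section QuantReduct

variable {P : RawProof L} {l : List (L.Term ℕ × ETree L)} {a : ℕ} {E : ETree L}
  {η : Fin l.length → ℕ → ℕ}

/-- The pairs `(Eᵢ, Eηᵢ[a\tᵢ])` from which the new cut is formed. -/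
noncomputable def cutPairs (l : List (L.Term ℕ × ETree L)) (a : ℕ) (E : ETree L)
    (η : Fin l.length → ℕ → ℕ) : List (ETree L × ETree L) :=
  List.ofFn fun i => ((l.get i).2, E.copy a (l.get i).1 (η i))

theorem forall_mem_cutPairs {p : ETree L × ETree L → Prop} :
    (∀ x ∈ cutPairs l a E η, p x) ↔ ∀ i, p ((l.get i).2, E.copy a (l.get i).1 (η i)) := by
  rw [cutPairs, List.forall_mem_ofFn_iff]

theorem cuts_quantReduct : (quantReduct P l a E η).cuts =
    P.cuts + disjunctionCut (cutPairs l a E η) + ∑ i, P.cuts.map fun C =>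
      (C.1.copy a (l.get i).1 (η i), C.2.copy a (l.get i).1 (η i)) := by
  simp only [quantReduct, subst, Multiset.map_map]
  rfl

theorem trees_quantReduct : (quantReduct P l a E η).trees =
    P.trees + ∑ i, P.trees.map (ETree.copy a (l.get i).1 (η i)) := by
  simp only [quantReduct, subst, Multiset.map_map]
  rfl

theorem mem_cuts_quantReduct {C : Cut L} : C ∈ (quantReduct P l a E η).cuts ↔
    C ∈ P.cuts ∨ C ∈ disjunctionCut (cutPairs l a E η) ∨ ∃ i, ∃ D ∈ P.cuts,
      (D.1.copy a (l.get i).1 (η i), D.2.copy a (l.get i).1 (η i)) = C := by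
  simp only [cuts_quantReduct, Multiset.mem_add, Multiset.mem_sum, Finset.mem_univ, true_and,
    Multiset.mem_map, or_assoc]

theorem mem_trees_quantReduct {G : ETree L} : G ∈ (quantReduct P l a E η).trees ↔
    G ∈ P.trees ∨ ∃ i, ∃ H ∈ P.trees, H.copy a (l.get i).1 (η i) = G := by
  simp only [trees_quantReduct, Multiset.mem_add, Multiset.mem_sum, Finset.mem_univ, true_and,
    Multiset.mem_map]

theorem copy_mem_roots_quantReduct {x : Place L × ETree L} (hx : x ∈ P.roots) (i) :
    (x.1.subst (copySubst a (l.get i).1 (η i)), x.2.copy a (l.get i).1 (η i)) ∈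
      (quantReduct P l a E η).roots := by
  obtain ⟨G, hG, rfl⟩ | ⟨C, hC, rfl⟩ | ⟨C, hC, rfl⟩ := mem_roots.1 hx <;>
    simp only [Place.subst, ← ETree.Sh_copy]
  · exact tree_mem_roots (mem_trees_quantReduct.2 (Or.inr ⟨i, G, hG, rfl⟩))
  · exact pos_mem_roots (mem_cuts_quantReduct.2 (Or.inr (Or.inr ⟨i, C, hC, rfl⟩)))
  · exact neg_mem_roots (mem_cuts_quantReduct.2 (Or.inr (Or.inr ⟨i, C, hC, rfl⟩)))

theorem mem_roots_quantReduct {x : Place L × ETree L} (hx : x ∈ P.roots) :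
    x ∈ (quantReduct P l a E η).roots := by
  obtain ⟨G, hG, rfl⟩ | ⟨C, hC, rfl⟩ | ⟨C, hC, rfl⟩ := mem_roots.1 hx
  · exact tree_mem_roots (mem_trees_quantReduct.2 (Or.inl hG))
  · exact pos_mem_roots (mem_cuts_quantReduct.2 (Or.inl hC))
  · exact neg_mem_roots (mem_cuts_quantReduct.2 (Or.inl hC))

theorem forall_roots_quantReduct {p : ETree L → Prop} (hor : ∀ E F, p E → p F → p (.or E F))
    (hand : ∀ E F, p E → p F → p (.and E F)) (hP : ∀ x ∈ P.roots, p x.2)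
    (hP' : ∀ i, ∀ x ∈ P.roots, p (x.2.copy a (l.get i).1 (η i))) (hl : ∀ i, p (l.get i).2)
    (hE : ∀ i, p (E.copy a (l.get i).1 (η i))) :
    ∀ x ∈ (quantReduct P l a E η).roots, p x.2 := by
  rw [forall_mem_roots] at hP ⊢
  replace hP' := fun i =>
    (forall_mem_roots (p := fun G => p (G.copy a (l.get i).1 (η i)))).1 (hP' i)
  refine ⟨fun G hG => ?_, fun C hC => ?_⟩
  · obtain hG | ⟨i, H, hH, rfl⟩ := mem_trees_quantReduct.1 hG
    · exact hP.1 G hG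
    · exact (hP' i).1 H hH
  · obtain hC | hC | ⟨i, D, hD, rfl⟩ := mem_cuts_quantReduct.1 hC
    · exact hP.2 C hC
    · exact forall_mem_disjunctionCut hor hand
        (forall_mem_cutPairs.2 fun i => ⟨hl i, hE i⟩) C hC
    · exact (hP' i).2 D hD

theorem EV_quantReduct : (quantReduct P l a E η).EV = P.EV + (l.map fun x => x.2.EV).sum +
    ∑ i, (P.EV + E.EV).map fun x => ETree.substVar (single a (l.get i).1) (η i x) := by
  have hpairs : ((cutPairs l a E η).map fun x => x.1.EV + x.2.EV).sum =
      (l.map fun x => x.2.EV).sum +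
        ∑ i, E.EV.map fun x => ETree.substVar (single a (l.get i).1) (η i x) := by
    rw [cutPairs, List.map_ofFn, List.sum_ofFn, ← Fin.sum_univ_fun_getElem]
    simp only [Function.comp_apply, Finset.sum_add_distrib, ETree.EV_copy]
    rfl
  simp only [EV, trees_quantReduct, cuts_quantReduct, Multiset.add_bind, sum_bind,
    Multiset.bind_map, EV_disjunctionCut, hpairs, ETree.EV_copy, Multiset.map_add,
    Multiset.map_bind, Finset.sum_add_distrib]
  abel

theorem nodup_EV_quantReduct {V : Set ℕ} (hη : FreshRenamings η {x | x ∈ P.EV + E.EV} V)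
    (hV : ∀ x ∈ P.EV + (l.map fun x => x.2.EV).sum, x ∈ V) (ha : a ∈ V)
    (hnodup : (P.EV + (l.map fun x => x.2.EV).sum + E.EV).Nodup) :
    (quantReduct P l a E η).EV.Nodup := by
  have hcopies : ∀ i, ((P.EV + E.EV).map fun x => ETree.substVar (single a (l.get i).1) (η i x)) =
      (P.EV + E.EV).map (η i) := fun i => Multiset.map_congr rfl fun x hx =>
    ETree.substVar_single_of_ne fun h => hη.fresh i x hx (h ▸ ha)
  rw [EV_quantReduct, Finset.sum_congr rfl fun i _ => hcopies i]
  refine Multiset.nodup_add.2 ⟨(Multiset.nodup_add.1 hnodup).1, hη.nodup_sum_map ?_, ?_⟩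
  · rw [add_right_comm] at hnodup
    exact (Multiset.nodup_add.1 hnodup).1
  · rw [Multiset.disjoint_left]
    intro z hz hz'
    obtain ⟨i, -, hz'⟩ := Multiset.mem_sum.1 hz'
    obtain ⟨x, hx, rfl⟩ := Multiset.mem_map.1 hz'
    exact hη.fresh i x hx (hV _ hz)

end QuantReduct

section QuantRedex

variable {R : RawProof L} {F : ETree L} {A : NNF L 1} {a : ℕ} {E : ETree L}
  {η : Fin F.expansions.length → ℕ → ℕ} {lev : ℕ → ℕ}

theorem mem_EV_of_mem_roots {x : Place L × ETree L} (hx : x ∈ R.roots) {y : ℕ}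
    (hy : y ∈ x.2.EV) : y ∈ R.EV :=
  R.EV_eq_bind ▸ Multiset.mem_bind.2 ⟨x, hx, hy⟩

/-- `R` together with the cut of `F` against the universal tree `∀Ā +ᵃ E`. -/
abbrev addQuantCut (R : RawProof L) (F : ETree L) (A : NNF L 1) (a : ℕ) (E : ETree L) :
    RawProof L :=
  ⟨(F, ETree.all A.dual a E) ::ₘ R.cuts, R.trees⟩

theorem forall_roots_addQuantCut {p : ETree L → Prop} :
    (∀ x ∈ (R.addQuantCut F A a E).roots, p x.2) ↔
      p F ∧ p (.all A.dual a E) ∧ ∀ x ∈ R.roots, p x.2 := by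
  rw [roots_cons_cut, Multiset.forall_mem_cons, Multiset.forall_mem_cons]

theorem vars_subset_addQuantCut (R : RawProof L) (F : ETree L) (A : NNF L 1) (a : ℕ)
    (E : ETree L) : F.vars ⊆ (R.addQuantCut F A a E).vars ∧
    (ETree.all A.dual a E).vars ⊆ (R.addQuantCut F A a E).vars ∧
    ∀ x ∈ R.roots, x.2.vars ⊆ (R.addQuantCut F A a E).vars :=
  forall_roots_addQuantCut (p := fun G => G.vars ⊆ (R.addQuantCut F A a E).vars).1
    fun _ => vars_subset_of_mem_roots

theorem mem_vars_addQuantCut_of_mem_EV {x : ℕ} (hx : x ∈ R.EV + F.EV + E.EV) :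
    x ∈ (R.addQuantCut F A a E).vars := by
  obtain ⟨hF, hE, hR⟩ := vars_subset_addQuantCut R F A a E
  simp only [Multiset.mem_add, EV_eq_bind, Multiset.mem_bind] at hx
  obtain (⟨r, hr, hx⟩ | hx) | hx := hx
  · exact hR r hr (ETree.mem_vars_of_mem_EV hx)
  · exact hF (ETree.mem_vars_of_mem_EV hx)
  · exact hE (ETree.mem_vars_of_mem_EV (Multiset.mem_cons_of_mem hx))

theorem mem_vars_addQuantCut_self : a ∈ (R.addQuantCut F A a E).vars :=
  (vars_subset_addQuantCut R F A a E).2.1 (ETree.mem_vars_of_mem_EV (Multiset.mem_cons_self _ _))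

theorem EV_addQuantCut : (R.addQuantCut F A a E).EV = a ::ₘ (R.EV + F.EV + E.EV) := by
  simp only [EV_eq_bind, roots_cons_cut, Multiset.cons_bind, ETree.EV, Multiset.cons_add,
    Multiset.add_cons]
  congr 1
  abel

theorem tautology_quantReduct (hF : F.exBody = some A)
    (h : ∀ val, ∃ B ∈ (R.addQuantCut F A a E).Dp, B.eval val) (val : Valuation L) :
    ∃ B ∈ (quantReduct R F.expansions a E η).Dp, B.eval val := by
  simp only [eval_Dp_iff, Multiset.mem_cons, or_and_right, exists_or, exists_eq_left,
    ETree.Dp] at h ⊢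
  by_cases hE : ∀ i, (E.copy a (F.expansions.get i).1 (η i)).Dp.eval val
  · obtain ⟨G, hG, hval⟩ | ⟨hFval, -⟩ | ⟨C, hC, hval⟩ := h val
    · exact Or.inl ⟨G, mem_trees_quantReduct.2 (Or.inl hG), hval⟩
    · obtain ⟨x, hx, hval⟩ := (ETree.eval_iff_expansions hF).1 hFval
      obtain ⟨i, rfl⟩ := List.get_of_mem hx
      obtain ⟨C, hC, hCval⟩ := eval_disjunctionCut (l := cutPairs F.expansions a E η)
        ⟨_, List.mem_ofFn.2 ⟨i, rfl⟩, hval⟩ (forall_mem_cutPairs.2 hE)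
      exact Or.inr ⟨C, mem_cuts_quantReduct.2 (Or.inr (Or.inl hC)), hCval⟩
    · exact Or.inr ⟨C, mem_cuts_quantReduct.2 (Or.inl hC), hval⟩
  · obtain ⟨i, hi⟩ := not_forall.1 hE
    rw [ETree.eval_copy] at hi
    obtain ⟨G, hG, hval⟩ | ⟨-, hEval⟩ | ⟨C, hC, hval⟩ := h fun l S ts =>
      val l S fun j => (ts j).subst (copySubst a (F.expansions.get i).1 (η i))
    · exact Or.inl ⟨_, mem_trees_quantReduct.2 (Or.inr ⟨i, G, hG, rfl⟩), ETree.eval_copy.2 hval⟩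
    · exact absurd hEval hi
    · exact Or.inr ⟨_, mem_cuts_quantReduct.2 (Or.inr (Or.inr ⟨i, C, hC, rfl⟩)),
        ETree.eval_copy.2 hval.1, ETree.eval_copy.2 hval.2⟩

theorem tree_mem_places_quantReduct (hclosed : ∀ G ∈ R.trees, G.Sh.fv = ∅) {B : NNF L 0} :
    Place.tree B ∈ (quantReduct R F.expansions a E η).places ↔
      Place.tree B ∈ (R.addQuantCut F A a E).places := by
  rw [tree_mem_places, tree_mem_places]
  constructor
  · rintro ⟨G, hG, rfl⟩
    obtain hG | ⟨i, H, hH, rfl⟩ := mem_trees_quantReduct.1 hG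
    · exact ⟨G, hG, rfl⟩
    · exact ⟨H, hH, by rw [ETree.Sh_copy, NNF.subst_eq_self (hclosed H hH)]⟩
  · rintro ⟨G, hG, rfl⟩
    exact ⟨G, mem_trees_quantReduct.2 (Or.inl hG), rfl⟩

/-- A leveled pre-proof with a distinguished quantified cut, and fresh renamings for its
reduction. -/
structure QuantRedex (R : RawProof L) (F : ETree L) (A : NNF L 1) (a : ℕ) (E : ETree L)
    (η : Fin F.expansions.length → ℕ → ℕ) : Prop where
  leveled : (R.addQuantCut F A a E).IsLeveled
  body : F.exBody = some A
  fresh : FreshRenamings η {x | x ∈ R.EV + E.EV} (R.addQuantCut F A a E).vars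

namespace QuantRedex

theorem wf (h : QuantRedex R F A a E η) : F.WF ∧ (ETree.all A.dual a E).WF :=
  h.leveled.preProof.cut_wf _ (Multiset.mem_cons_self _ _)

theorem Sh_eq (h : QuantRedex R F A a E η) : E.Sh = A.dual.inst (Term.var a) := h.wf.2.2

theorem expansion_wf (h : QuantRedex R F A a E η) (i : Fin F.expansions.length) :
    (F.expansions.get i).2.WF ∧ (F.expansions.get i).2.Sh = A.inst (F.expansions.get i).1 :=
  h.wf.1.of_mem_expansions h.body (List.get_mem _ i)

theorem nodup_EV (h : QuantRedex R F A a E η) : (a ::ₘ (R.EV + F.EV + E.EV)).Nodup :=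
  EV_addQuantCut (R := R) (A := A) ▸ h.leveled.preProof.regular

theorem eta_ne (h : QuantRedex R F A a E η) (i) {x : ℕ} (hx : x ∈ R.EV + E.EV) : η i x ≠ a :=
  fun heq => h.fresh.fresh i x hx (heq ▸ mem_vars_addQuantCut_self)

theorem copySubst_of_mem (h : QuantRedex R F A a E η) (i) {x : ℕ} (hx : x ∈ R.EV + E.EV)
    (t : L.Term ℕ) : copySubst a t (η i) x = Term.var (η i x) := by
  simp [copySubst, single, h.eta_ne i hx]

theorem copySubst_of_notMem (h : QuantRedex R F A a E η) (i) {x : ℕ} (hx : x ∉ R.EV + E.EV)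
    (hxa : x ≠ a) (t : L.Term ℕ) : copySubst a t (η i) x = Term.var x := by
  simp [copySubst, single, h.fresh.fixed i x hx, hxa]

theorem copySubst_self (h : QuantRedex R F A a E η) (i) (t : L.Term ℕ) :
    copySubst a t (η i) a = t := by
  have ha : a ∉ R.EV + E.EV := by
    have hnotMem := (Multiset.nodup_cons.1 h.nodup_EV).1
    rw [add_right_comm] at hnotMem
    exact fun ha => hnotMem (Multiset.mem_add.2 (Or.inl ha))
  simp [copySubst, single, h.fresh.fixed i a ha]

theorem isLevel_copy (h : QuantRedex R F A a E η) {lev' : ℕ → ℕ} {N : ℕ}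
    (hN : ∀ y ∈ (R.addQuantCut F A a E).vars, lev y < N)
    (hη : ∀ i, ∀ x ∈ R.EV + E.EV, lev' (η i x) = lev x + N)
    (hV : ∀ y ∈ (R.addQuantCut F A a E).vars, lev' y = lev y)
    {G : ETree L} (hEV : ∀ x ∈ G.EV, x ∈ R.EV + E.EV)
    (hvars : G.vars ⊆ (R.addQuantCut F A a E).vars)
    (hG : ∀ o ∈ G.occs, ∀ x ∈ G.Sh.deps o.1, x = a ∨ lev x < lev o.2) (i) :
    (G.copy a (F.expansions.get i).1 (η i)).IsLevel lev' := by
  refine ETree.isLevel_copy (fun x hx => h.eta_ne i (hEV x hx)) (fun x hx => hη i x (hEV x hx))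
    (fun y hy => ?_) (fun x hx hxa y hy => ?_) hG
  · rw [h.copySubst_self] at hy
    have hyV := (vars_subset_addQuantCut R F A a E).1
      (ETree.mem_vars_of_mem_expansions (List.get_mem _ i) hy)
    exact (hV y hyV).trans_lt (hN y hyV)
  · by_cases hxS : x ∈ R.EV + E.EV
    · rw [h.copySubst_of_mem i hxS, Term.varFinset, Finset.mem_singleton] at hy
      rw [hy, hη i x hxS]
    · rw [h.copySubst_of_notMem i hxS hxa, Term.varFinset, Finset.mem_singleton] at hy
      rw [hy, hV x (hvars hx)]
      exact Nat.le_add_right _ _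

theorem exists_isLevel (h : QuantRedex R F A a E η) :
    ∃ lev', (quantReduct R F.expansions a E η).IsLevel lev' := by
  obtain ⟨lev, hlev⟩ := h.leveled.level
  obtain ⟨N, hN⟩ := ((R.addQuantCut F A a E).vars_finite.image lev).bddAbove
  have hN (y) (hy : y ∈ (R.addQuantCut F A a E).vars) : lev y < N + 1 :=
    Nat.lt_succ_of_le (hN (Set.mem_image_of_mem lev hy))
  obtain ⟨lev', hη, hV⟩ := h.fresh.exists_extension lev fun x => lev x + (N + 1)
  obtain ⟨hFl, hEl, hRl⟩ := forall_roots_addQuantCut.1 (isLevel_iff.1 hlev)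
  obtain ⟨hFV, hEV, hRV⟩ := vars_subset_addQuantCut R F A a E
  have hEV : E.vars ⊆ _ := Set.subset_union_right.trans hEV
  refine ⟨lev', isLevel_iff.2 (forall_roots_quantReduct
    (fun _ _ h₁ h₂ => ETree.isLevel_or.2 ⟨h₁, h₂⟩) (fun _ _ h₁ h₂ => ETree.isLevel_and.2 ⟨h₁, h₂⟩)
    (fun x hx => (hRl x hx).congr fun y hy => hV y (hRV x hx hy)) (fun i x hx => ?_)
    (fun i => ?_) (h.isLevel_copy hN hη hV (fun x hx => ?_) hEV fun o ho x hx => ?_))⟩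
  · refine h.isLevel_copy hN hη hV (fun y hy => ?_) (hRV x hx)
      (fun o ho y hy => Or.inr (hRl x hx o ho y hy)) i
    exact Multiset.mem_add.2 (Or.inl (mem_EV_of_mem_roots hx hy))
  · have hmem := List.get_mem F.expansions i
    exact (ETree.IsLevel.of_mem_expansions h.wf.1 h.body hFl hmem).congr fun y hy =>
      hV y (hFV (ETree.vars_subset_of_mem_expansions hmem hy))
  · exact Multiset.mem_add.2 (Or.inr hx)
  · obtain hx | hx := hx
    · exact Or.inr ((ETree.isLevel_all.1 hEl).2 o ho x (Or.inl hx))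
    · have hx := NNF.fv_top_subset _ _ hx
      rw [h.Sh_eq] at hx
      obtain hx | hx := NNF.mem_fv_inst hx
      · exact Or.inr ((ETree.isLevel_all.1 hEl).2 o ho x (Or.inr hx))
      · exact Or.inl (by simpa using hx)

theorem tree_mem_places (h : QuantRedex R F A a E η) {B : NNF L 0} :
    Place.tree B ∈ (quantReduct R F.expansions a E η).places ↔
      Place.tree B ∈ (R.addQuantCut F A a E).places :=
  have hclosed : ∀ G ∈ R.trees, G.Sh.fv = ∅ := fun G hG =>
    h.leveled.preProof.closed G.Sh (Multiset.mem_map_of_mem _ hG)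
  tree_mem_places_quantReduct hclosed

theorem positive (h : QuantRedex R F A a E η) {C : Cut L}
    (hC : C ∈ (quantReduct R F.expansions a E η).cuts) : C.1.Sh.positive = true := by
  have hpos : ∀ C ∈ R.cuts, C.1.Sh.positive = true := fun C hC =>
    h.leveled.preProof.cut_positive C (Multiset.mem_cons_of_mem hC)
  obtain hC | hC | ⟨i, D, hD, rfl⟩ := mem_cuts_quantReduct.1 hC
  · exact hpos C hC
  · refine positive_of_mem_disjunctionCut hC (forall_mem_cutPairs.2 fun i => ?_)
    rw [ETree.Sh_copy, NNF.positive_subst, h.Sh_eq, (h.expansion_wf i).2,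
      NNF.positive_inst _ (F.expansions.get i).1, ← NNF.dual_inst, NNF.positive_dual]
  · rw [ETree.Sh_copy, NNF.positive_subst, hpos D hD]

theorem mergeable (h : QuantRedex R F A a E η) :
    (quantReduct R F.expansions a E η).Mergeable where
  wf := by
    obtain ⟨-, -, hR⟩ := forall_roots_addQuantCut.1 h.leveled.mergeable.wf
    refine forall_roots_quantReduct (p := ETree.MWF) (fun _ _ h₁ h₂ => ⟨h₁, h₂⟩)
      (fun _ _ h₁ h₂ => ⟨h₁, h₂⟩) hR
      (fun i x hx => (hR x hx).copy fun y hy =>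
        h.eta_ne i (Multiset.mem_add.2 (Or.inl (mem_EV_of_mem_roots hx hy))))
      (fun i => (h.expansion_wf i).1.mwf)
      (fun i => h.wf.2.1.mwf.copy fun y hy => h.eta_ne i (Multiset.mem_add.2 (Or.inr hy)))
  regular := by
    refine nodup_EV_quantReduct h.fresh (fun x hx => mem_vars_addQuantCut_of_mem_EV ?_)
      mem_vars_addQuantCut_self ?_
    · rw [← ETree.EV_eq_sum_expansions h.body] at hx
      exact Multiset.mem_add.2 (Or.inl hx)
    · rw [← ETree.EV_eq_sum_expansions h.body]
      exact (Multiset.nodup_cons.1 h.nodup_EV).2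
  positive B B' hB := by
    obtain ⟨C, hC, rfl, rfl⟩ := pos_mem_places.1 hB
    exact h.positive hC
  closed B hB := h.leveled.mergeable.closed B (h.tree_mem_places.1 hB)
  level := h.exists_isLevel
  tautology := tautology_quantReduct h.body h.leveled.tautology

end QuantRedex

end QuantRedex

section Normalization

variable {P Q R : RawProof L} {F : ETree L} {A : NNF L 1} {a : ℕ} {E : ETree L}
  {η : Fin F.expansions.length → ℕ → ℕ} {lev ρ : ℕ → ℕ} {K : ℕ} {σ : ℕ → L.Term ℕ}

theorem IsPreProof.place_subst_congr (hP : P.IsPreProof)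
    (hex : ∀ C ∈ P.cuts, ∃ B, C.1.Sh = NNF.ex B) {x : Place L × ETree L} (hx : x ∈ P.roots)
    {τ : ℕ → L.Term ℕ} {p : Path L} (h : ∀ z ∈ (x.1.formula.top p).fv, σ z = τ z) :
    x.1.subst σ = x.1.subst τ := by
  have hcut {C : Cut L} (hC : C ∈ P.cuts) (h : ∀ z ∈ C.1.Sh.fv, σ z = τ z) :
      C.1.Sh.subst σ = C.1.Sh.subst τ ∧ C.2.Sh.subst σ = C.2.Sh.subst τ := by
    rw [hP.cut_dual C hC, ← NNF.dual_subst, ← NNF.dual_subst, NNF.subst_congr _ h]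
    exact ⟨rfl, rfl⟩
  obtain ⟨G, hG, rfl⟩ | ⟨C, hC, rfl⟩ | ⟨C, hC, rfl⟩ := mem_roots.1 hx
  · have hclosed := hP.closed _ (Multiset.mem_map_of_mem ETree.Sh hG)
    simp only [Place.subst, NNF.subst_eq_self hclosed]
  · obtain ⟨B, hB⟩ := hex C hC
    obtain ⟨h₁, h₂⟩ := hcut hC (by simpa [Place.formula, hB, NNF.top] using h)
    simp only [Place.subst, h₁, h₂]
  · obtain ⟨B, hB⟩ := hex C hC
    obtain ⟨h₁, h₂⟩ := hcut hC (by
      simpa [Place.formula, hP.cut_dual C hC, hB, NNF.dual, NNF.top, NNF.fv] using h)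
    simp only [Place.subst, h₁, h₂]

theorem mem_occs_addQuantCut {o : PlacedOcc L} (ho : o ∈ R.occs) :
    o ∈ (R.addQuantCut F A a E).occs := by
  obtain ⟨G, hG, ho⟩ := mem_occs.1 ho
  refine mem_occs.2 ⟨G, ?_, ho⟩
  rw [roots_cons_cut]
  exact Multiset.mem_cons_of_mem (Multiset.mem_cons_of_mem hG)

theorem mem_occs_quantReduct {o : PlacedOcc L} (ho : o ∈ R.occs) :
    o ∈ (quantReduct R F.expansions a E η).occs := by
  obtain ⟨G, hG, ho⟩ := mem_occs.1 ho
  exact mem_occs.2 ⟨G, mem_roots_quantReduct hG, ho⟩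

namespace QuantRedex

theorem copy_mem_occs (h : QuantRedex R F A a E η) {π : Place L} {p : Path L} {b : ℕ}
    (ho : (π, p, b) ∈ R.occs) (i) :
    (π.subst (copySubst a (F.expansions.get i).1 (η i)),
      Path.subst (copySubst a (F.expansions.get i).1 (η i)) p, η i b) ∈
        (quantReduct R F.expansions a E η).occs := by
  obtain ⟨G, hG, ho⟩ := mem_occs.1 ho
  refine mem_occs.2 ⟨_, copy_mem_roots_quantReduct hG i, ?_⟩
  rw [ETree.occs_copy fun x hx =>
    h.eta_ne i (Multiset.mem_add.2 (Or.inl (mem_EV_of_mem_roots hG hx)))]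
  exact Multiset.mem_map_of_mem _ ho

/-- By induction on the level: once the variables in the position of an eigenvariable agree with
their copies, so do the positions of the eigenvariable and its copy, and merging identifies the
two. -/
theorem subst_copySubst (h : QuantRedex R F A a E η)
    (hlev : (R.addQuantCut F A a E).IsLevel lev) (hK : ∀ b ∈ (ETree.all A.dual a E).EV, K ≤ lev b)
    (hex : ∀ C ∈ (R.addQuantCut F A a E).cuts, ∃ B, C.1.Sh = NNF.ex B) (hQ : Q.Mergeable)
    (hn : ∀ Q', ¬ MergeStep Q Q') (hρ : Renames ρ (quantReduct R F.expansions a E η) Q) (i)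
    {y : ℕ} (hy : lev y < K) :
    (copySubst a (F.expansions.get i).1 (η i) y).subst (ren ρ) = ren ρ y := by
  induction hm : lev y using Nat.strong_induction_on generalizing y with
  | _ m ih =>
    subst hm
    have hyK : y ∉ (ETree.all A.dual a E).EV := fun hyE => (hK y hyE).not_gt hy
    rw [ETree.EV, Multiset.mem_cons, not_or] at hyK
    by_cases hyR : y ∈ R.EV
    · rw [h.copySubst_of_mem i (Multiset.mem_add.2 (Or.inl hyR))]
      obtain ⟨π, p, ho⟩ := RawProof.mem_EV_iff.1 hyR
      have ho' := mem_occs_addQuantCut (F := F) (A := A) (a := a) (E := E) ho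
      have hlow : ∀ z ∈ π.formula.deps p,
          (copySubst a (F.expansions.get i).1 (η i) z).subst (ren ρ) = ren ρ z := fun z hz =>
        have hzy : lev z < lev y := hlev _ ho' z hz
        ih _ hzy (hzy.trans hy) rfl
      have hcopy := (hρ.mem_occs _).2 (Multiset.mem_map_of_mem _ (h.copy_mem_occs ho i))
      have horig := (hρ.mem_occs _).2 (Multiset.mem_map_of_mem _ (mem_occs_quantReduct ho))
      simp only [PlacedOcc.subst, Occ.subst, Place.subst_subst, Path.subst_subst] at hcopy horig
      obtain ⟨G, hG, -⟩ := mem_occs.1 ho'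
      rw [h.leveled.preProof.place_subst_congr hex hG fun z hz => hlow z (Or.inr hz),
        Path.subst_congr p fun z hz => hlow z (Or.inl hz)] at hcopy
      exact congrArg Term.var (eq_of_path_eq_of_normal hn hQ hcopy horig)
    · rw [h.copySubst_of_notMem i (by simp [hyR, hyK.2]) hyK.1]
      rfl

theorem dual_subst (h : QuantRedex R F A a E η)
    (hA : ∀ i, ∀ y ∈ A.fv, (copySubst a (F.expansions.get i).1 (η i) y).subst σ = σ y) {C : Cut L}
    (hC : C ∈ (quantReduct R F.expansions a E η).cuts) :
    C.2.Sh.subst σ = (C.1.Sh.subst σ).dual := by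
  have hdual : ∀ C ∈ R.cuts, C.2.Sh = C.1.Sh.dual := fun C hC =>
    h.leveled.preProof.cut_dual C (Multiset.mem_cons_of_mem hC)
  obtain hC | hC | ⟨i, D, hD, rfl⟩ := mem_cuts_quantReduct.1 hC
  · rw [hdual C hC, NNF.dual_subst]
  · refine dual_of_mem_disjunctionCut hC (forall_mem_cutPairs.2 fun i => ?_)
    have hAi : A.dual.subst (fun y => (copySubst a (F.expansions.get i).1 (η i) y).subst σ) =
        A.dual.subst σ :=
      NNF.subst_congr _ fun y hy => hA i y (by simpa using hy)
    rw [ETree.Sh_copy, h.Sh_eq, NNF.subst_subst, NNF.subst_inst, hAi, (h.expansion_wf i).2,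
      NNF.subst_inst, NNF.dual_inst, NNF.dual_subst]
    simp only [Term.subst, h.copySubst_self]
  · simp only [ETree.Sh_copy, hdual D hD, NNF.dual_subst]

theorem cases_cutFormulas (h : QuantRedex R F A a E η) {B : NNF L 0}
    (hB : B ∈ (quantReduct R F.expansions a E η).cutFormulas) :
    B.qd ≤ A.qd ∨ B ∈ R.cutFormulas ∨
      ∃ i, ∃ D ∈ R.cutFormulas, B = D.subst (copySubst a (F.expansions.get i).1 (η i)) := by
  obtain ⟨C, hC, rfl⟩ := Multiset.mem_map.1 hB
  obtain hC | hC | ⟨i, D, hD, rfl⟩ := mem_cuts_quantReduct.1 hC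
  · exact Or.inr (Or.inl (Multiset.mem_map_of_mem _ hC))
  · refine Or.inl (forall_mem_disjunctionCut (p := fun G => G.Sh.qd ≤ A.qd)
      (fun _ _ => max_le) (fun _ _ => max_le) (forall_mem_cutPairs.2 fun i => ⟨?_, ?_⟩) C hC).1
    · rw [(h.expansion_wf i).2, NNF.qd_inst]
    · rw [ETree.Sh_copy, NNF.qd_subst, h.Sh_eq, NNF.qd_inst, NNF.qd_dual]
  · exact Or.inr (Or.inr ⟨i, _, Multiset.mem_map_of_mem _ hD, ETree.Sh_copy⟩)

theorem cutFormulas_addQuantCut (h : QuantRedex R F A a E η) :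
    (R.addQuantCut F A a E).cutFormulas = NNF.ex A ::ₘ R.cutFormulas := by
  rw [cutFormulas, Multiset.map_cons, ETree.Sh_of_exBody h.body, cutFormulas]

theorem qd_le_of_mem_cutFormulas (h : QuantRedex R F A a E η) {r : ℕ}
    (hr : ∀ B ∈ (R.addQuantCut F A a E).cutFormulas, B.qd ≤ r) {B : NNF L 0}
    (hB : B ∈ (quantReduct R F.expansions a E η).cutFormulas) : B.qd ≤ r := by
  rw [h.cutFormulas_addQuantCut, Multiset.forall_mem_cons] at hr
  obtain hB | hB | ⟨i, D, hD, rfl⟩ := h.cases_cutFormulas hB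
  · exact hB.trans ((Nat.le_succ _).trans hr.1)
  · exact hr.2 B hB
  · rw [NNF.qd_subst]
    exact hr.2 D hD

theorem subst_mem_cutFormulas (h : QuantRedex R F A a E η)
    (hR : ∀ i, ∀ D ∈ R.cutFormulas, D.weight (A.qd + 1) ≠ 0 → ∀ y ∈ D.fv,
      (copySubst a (F.expansions.get i).1 (η i) y).subst σ = σ y) {B : NNF L 0}
    (hB : B ∈ (quantReduct R F.expansions a E η).cutFormulas) (hw : B.weight (A.qd + 1) ≠ 0) :
    B.subst σ ∈ R.cutFormulas.map (NNF.subst σ) := by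
  obtain hB | hB | ⟨i, D, hD, rfl⟩ := h.cases_cutFormulas hB
  · exact absurd (NNF.weight_eq_zero (Nat.lt_succ_of_le hB)) hw
  · exact Multiset.mem_map_of_mem _ hB
  · rw [NNF.weight_subst] at hw
    rw [NNF.subst_subst, NNF.subst_congr D (hR i D hD hw)]
    exact Multiset.mem_map_of_mem _ hD

theorem sum_weight_lt (h : QuantRedex R F A a E η)
    (hρ : Renames ρ (quantReduct R F.expansions a E η) Q) (hQ : Q.cutFormulas.Nodup)
    (hR : ∀ i, ∀ D ∈ R.cutFormulas, D.weight (A.qd + 1) ≠ 0 → ∀ y ∈ D.fv,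
      (copySubst a (F.expansions.get i).1 (η i) y).subst (ren ρ) = ren ρ y) :
    (Q.cutFormulas.map (NNF.weight (A.qd + 1))).sum <
      ((R.addQuantCut F A a E).cutFormulas.map (NNF.weight (A.qd + 1))).sum := by
  refine (sum_map_le_of_nodup (t := R.cutFormulas.map (NNF.subst (ren ρ))) _ hQ
    fun B hB hw => ?_).trans_lt ?_
  · obtain ⟨B, hBR, rfl⟩ := hρ.mem_cutFormulas hB
    rw [NNF.weight_subst] at hw
    exact h.subst_mem_cutFormulas hR hBR hw
  · simp [h.cutFormulas_addQuantCut, NNF.weight, NNF.weight_subst]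

theorem exists_progress (h : QuantRedex R F A a E η)
    (hlev : (R.addQuantCut F A a E).IsLevel lev) (hK : ∀ b ∈ (ETree.all A.dual a E).EV, K ≤ lev b)
    (hex : ∀ C ∈ (R.addQuantCut F A a E).cuts, ∃ B, C.1.Sh = NNF.ex B)
    (hlow : ∀ D ∈ (R.addQuantCut F A a E).cutFormulas, D.weight (A.qd + 1) ≠ 0 →
      ∀ y ∈ D.fv, lev y < K) :
    ∃ Q, Progress (R.addQuantCut F A a E) Q ∧ (Q.cutFormulas.map (NNF.weight (A.qd + 1))).sum <
      ((R.addQuantCut F A a E).cutFormulas.map (NNF.weight (A.qd + 1))).sum := by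
  rw [h.cutFormulas_addQuantCut, Multiset.forall_mem_cons] at hlow
  obtain ⟨hlowA, hlowR⟩ := hlow
  replace hlowA : ∀ y ∈ A.fv, lev y < K := hlowA (by simp [NNF.weight])
  obtain ⟨Q, ρ, hQ, hQM, hρ⟩ := h.mergeable.exists_normalForm
  have hcopy {y : ℕ} (hy : lev y < K) (i) :
      (copySubst a (F.expansions.get i).1 (η i) y).subst (ren ρ) = ren ρ y :=
    h.subst_copySubst hlev hK hex hQM hQ.2 hρ i hy
  have hQL : Q.IsLeveled := hQM.isLeveled_of_normal hQ.2 hρ fun C hC =>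
    h.dual_subst (fun i y hy => hcopy (hlowA y hy) i) hC
  have hpre := h.leveled.preProof
  refine ⟨Q, ⟨hQL, ?_, ⟨hpre, hQL.preProof, .quant _ A _ _ _ _ η _ h.body h.fresh hQ⟩, ?_⟩,
    h.sum_weight_lt hρ hQL.preProof.cuts_distinct fun i D hD hw y hy =>
      hcopy (hlowR D hD hw y hy) i⟩
  · refine Sh_eq_of_places hpre hQL.preProof fun B => ?_
    rw [hρ.tree_iff h.mergeable.closed, h.tree_mem_places]
  · intro r hr B hB
    obtain ⟨B, hBR, rfl⟩ := hρ.mem_cutFormulas hB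
    rw [NNF.qd_subst]
    exact h.qd_le_of_mem_cutFormulas hr hBR

end QuantRedex

theorem IsLeveled.exists_quantRedex (hP : P.IsLeveled) {C : Cut L} (hC : C ∈ P.cuts)
    (hA : C.1.Sh = NNF.ex A) :
    ∃ (R : RawProof L) (F : ETree L) (a : ℕ) (E : ETree L)
      (η : Fin F.expansions.length → ℕ → ℕ),
      P = R.addQuantCut F A a E ∧ QuantRedex R F A a E η := by
  obtain ⟨F, G⟩ := C
  obtain ⟨_, trees⟩ := P
  obtain ⟨cuts, rfl⟩ := Multiset.exists_cons_of_mem hC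
  obtain ⟨hF, hG⟩ := hP.preProof.cut_wf _ hC
  have hd := hP.preProof.cut_dual _ hC
  simp only [hA, NNF.dual] at hF hG hd
  obtain ⟨a, E, rfl⟩ := hG.eq_all_of_Sh hd
  obtain ⟨η, hη⟩ := exists_freshRenamings F.expansions.length
    (vars_finite (addQuantCut ⟨cuts, trees⟩ F A a E))
    (S := {x | x ∈ (⟨cuts, trees⟩ : RawProof L).EV + E.EV}) fun x hx =>
      mem_vars_addQuantCut_of_mem_EV (by
        rw [add_right_comm]
        exact Multiset.mem_add.2 (Or.inl hx))
  exact ⟨⟨cuts, trees⟩, F, a, E, η, rfl, hP, hF.exBody_of_Sh hA, hη⟩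

theorem exists_maximal_levelBound (lev : ℕ → ℕ) {S : Set (NNF L 0)} (hS : S.Finite)
    (hne : S.Nonempty) : ∃ B ∈ S, ∃ K, (∀ D ∈ S, ∀ y ∈ D.fv, lev y < K) ∧
      ∀ m, (∀ y ∈ B.fv, lev y < m) → K ≤ m := by
  let bound (B : NNF L 0) : ℕ := B.fv_finite.toFinset.sup fun y => lev y + 1
  obtain ⟨B, hB, hmax⟩ := Set.exists_max_image S bound hS hne
  refine ⟨B, hB, bound B, fun D hD y hy => ?_, fun m hm => ?_⟩
  · exact (Finset.le_sup (f := fun y => lev y + 1) (D.fv_finite.mem_toFinset.2 hy)).trans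
      (hmax D hD)
  · exact Finset.sup_le fun y hy => hm y (B.fv_finite.mem_toFinset.1 hy)

theorem IsLeveled.exists_progress_quantified (hP : P.IsLeveled)
    (hex : ∀ C ∈ P.cuts, ∃ B, C.1.Sh = NNF.ex B) {r : ℕ}
    (hr : ∃ B ∈ P.cutFormulas, B.weight r ≠ 0) :
    ∃ Q, Progress P Q ∧ (Q.cutFormulas.map (NNF.weight r)).sum <
      (P.cutFormulas.map (NNF.weight r)).sum := by
  obtain ⟨lev, hlev⟩ := hP.level
  obtain ⟨_, ⟨hB, hBr⟩, K, hlow, hK⟩ := exists_maximal_levelBound lev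
    (S := {B | B ∈ P.cutFormulas ∧ B.weight r ≠ 0})
    ((Multiset.finite_toSet P.cutFormulas).subset fun B hB => hB.1) hr
  obtain ⟨C, hC, rfl⟩ := Multiset.mem_map.1 hB
  obtain ⟨A, hA⟩ := hex C hC
  obtain rfl : A.qd + 1 = r := by
    rw [hA] at hBr
    by_contra hne
    exact hBr (if_neg hne)
  obtain ⟨R, F, a, E, η, rfl, h⟩ := hP.exists_quantRedex hC hA
  refine h.exists_progress hlev (K := K) (fun b hb => hK _ fun y hy => ?_) hex
    fun D hD hw => hlow D ⟨hD, hw⟩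
  replace hy : y ∈ A.dual.fv := by simpa [hA, NNF.fv] using hy
  obtain ⟨-, hEl, -⟩ := forall_roots_addQuantCut.1 (isLevel_iff.1 hlev)
  obtain ⟨hya, hyE⟩ := ETree.isLevel_all.1 hEl
  obtain rfl | hb := Multiset.mem_cons.1 hb
  · exact hya y hy
  · obtain ⟨p, hp⟩ := ETree.mem_EV_iff.1 hb
    exact hyE _ hp y (Or.inr hy)

theorem IsLeveled.exists_reduces_cutFree (hP : P.IsLeveled) :
    ∃ Q, Q.IsLeveled ∧ Q.CutFree ∧ Q.Sh = P.Sh ∧ P.Reduces Q := by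
  obtain ⟨r, hr⟩ : ∃ r, ∀ A ∈ P.cutFormulas, A.qd ≤ r :=
    ⟨(P.cutFormulas.map NNF.qd).sum, fun A hA =>
      Multiset.single_le_sum (fun _ _ => Nat.zero_le _) _ (Multiset.mem_map_of_mem _ hA)⟩
  induction r generalizing P with
  | zero =>
    obtain ⟨Q, hQ, hSh, hred, hqd, -, hex⟩ := hP.exists_reduces_quantified
    refine ⟨Q, hQ, Multiset.eq_zero_of_forall_notMem fun C hC => ?_, hSh, hred⟩
    obtain ⟨A, hA⟩ := hex C hC
    have hzero := hqd 0 hr _ (Multiset.mem_map_of_mem _ hC)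
    rw [hA] at hzero
    exact Nat.not_succ_le_zero _ hzero
  | succ r ihr =>
    induction hm : (P.cutFormulas.map (NNF.weight (r + 1))).sum using Nat.strong_induction_on
      generalizing P with
    | _ m ihm =>
      obtain ⟨Q, hQ, hSh, hred, hqd, hw, hex⟩ := hP.exists_reduces_quantified
      by_cases hweight : ∃ B ∈ Q.cutFormulas, B.weight (r + 1) ≠ 0
      · obtain ⟨Q', hQ', hlt⟩ := hQ.exists_progress_quantified hex hweight
        obtain ⟨Q'', hQ'', hfree, hSh', hred'⟩ := ihm _ (hm ▸ hlt.trans_le (hw (r + 1)))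
          hQ'.leveled (hQ'.qd_le _ (hqd _ hr)) rfl
        exact ⟨Q'', hQ'', hfree, hSh'.trans (hQ'.Sh_eq.trans hSh),
          hred.trans (hred'.head hQ'.step)⟩
      · push Not at hweight
        obtain ⟨Q', hQ', hfree, hSh', hred'⟩ := ihr hQ fun B hB => by
          refine Nat.le_of_lt_succ (lt_of_le_of_ne (hqd _ hr B hB) fun hBr => ?_)
          obtain ⟨C, hC, rfl⟩ := Multiset.mem_map.1 hB
          obtain ⟨A, hA⟩ := hex C hC
          have hzero := hweight _ hB
          rw [hA] at hzero hBr
          exact one_ne_zero ((if_pos hBr).symm.trans hzero)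
        exact ⟨Q', hQ', hfree, hSh'.trans hSh, hred.trans hred'⟩

end Normalization

end RawProof

/-! ### Level functions and the dependency relation -/

theorem Path.vars_append (p q : Path L) : Path.vars (p ++ q) = p.vars ∪ q.vars := by
  induction p with
  | nil => exact (Finset.empty_union _).symm
  | cons s p ih => simp only [List.cons_append, Path.vars, ih, Finset.union_assoc]

namespace ETree

variable {E G : ETree L} {A : NNF L 1} {a : ℕ} {p : List Bool}

/-- The path to a position: the steps that matter for the occurrences of eigenvariables, so none at
a merge node or from `F +^t E` to `F`. -/
def path : ETree L → List Bool → Path L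
  | and E _, false :: p => Step.left :: E.path p
  | and _ F, true :: p => Step.right :: F.path p
  | or E _, false :: p => Step.left :: E.path p
  | or _ F, true :: p => Step.right :: F.path p
  | exp F _ _, false :: p => F.path p
  | exp _ t E, true :: p => Step.ex t :: E.path p
  | all _ _ E, true :: p => Step.all :: E.path p
  | merge E _, false :: p => E.path p
  | merge _ F, true :: p => F.path p
  | _, _ => []

theorem path_append (h : E.sub p = some G) (q : List Bool) :
    E.path (p ++ q) = E.path p ++ G.path q := by
  induction p generalizing E with
  | nil =>
    obtain rfl : E = G := by simpa [sub] using h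
    simp [path]
  | cons b p ih => cases E <;> cases b <;> simp_all [sub, path]

theorem path_prefix_path_append (E : ETree L) (p q : List Bool) :
    E.path p <+: E.path (p ++ q) := by
  induction p generalizing E with
  | nil => cases E <;> exact List.nil_prefix
  | cons b p ih => cases E <;> cases b <;> simp [path, ih]

theorem path_mem_occs (h : E.sub p = some (all A a G)) : (E.path p, a) ∈ E.occs := by
  induction p generalizing E with
  | nil =>
    obtain rfl : E = all A a G := by simpa [sub] using h
    simp [path, occs]
  | cons b p ih => cases E <;> cases b <;> simp_all [sub, path, occs, Occ.under]

theorem exists_sub_of_mem_occs {o : Occ L} (h : o ∈ E.occs) :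
    ∃ p, E.path p = o.1 ∧ ∃ A G, E.sub p = some (all A o.2 G) := by
  induction E generalizing o with
  | lit | ex => simp [occs] at h
  | and E F ihE ihF | or E F ihE ihF =>
    simp only [occs, Multiset.mem_add, Multiset.mem_map] at h
    obtain ⟨o, ho, rfl⟩ | ⟨o, ho, rfl⟩ := h
    · obtain ⟨p, hp, hsub⟩ := ihE ho
      exact ⟨false :: p, congrArg _ hp, hsub⟩
    · obtain ⟨p, hp, hsub⟩ := ihF ho
      exact ⟨true :: p, congrArg _ hp, hsub⟩
  | exp F t E ihF ihE =>
    simp only [occs, Multiset.mem_add, Multiset.mem_map] at h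
    obtain ho | ⟨o, ho, rfl⟩ := h
    · obtain ⟨p, hp, hsub⟩ := ihF ho
      exact ⟨false :: p, hp, hsub⟩
    · obtain ⟨p, hp, hsub⟩ := ihE ho
      exact ⟨true :: p, congrArg _ hp, hsub⟩
  | all B b E ih =>
    simp only [occs, Multiset.mem_cons, Multiset.mem_map] at h
    obtain rfl | ⟨o, ho, rfl⟩ := h
    · exact ⟨[], rfl, B, E, rfl⟩
    · obtain ⟨p, hp, hsub⟩ := ih ho
      exact ⟨true :: p, congrArg _ hp, hsub⟩
  | merge E F ihE ihF =>
    obtain ho | ho := Multiset.mem_add.1 h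
    · obtain ⟨p, hp, hsub⟩ := ihE ho
      exact ⟨false :: p, hp, hsub⟩
    · obtain ⟨p, hp, hsub⟩ := ihF ho
      exact ⟨true :: p, hp, hsub⟩

theorem exists_sub_of_mem_vars_path {y : ℕ} (h : y ∈ Path.vars (E.path p)) :
    ∃ q q' F t G, p = q ++ true :: q' ∧ E.sub q = some (exp F t G) ∧ y ∈ t.varFinset := by
  induction p generalizing E with
  | nil => cases E <;> simp [path, Path.vars] at h
  | cons b p ih =>
    have descend {D : ETree L} (hD : ∀ q, E.sub (b :: q) = D.sub q)
        (hy : y ∈ Path.vars (D.path p)) : ∃ q q' F t G,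
          b :: p = q ++ true :: q' ∧ E.sub q = some (exp F t G) ∧ y ∈ t.varFinset := by
      obtain ⟨q, q', F, t, G, rfl, hsub, hyt⟩ := ih hy
      exact ⟨b :: q, q', F, t, G, rfl, (hD q).trans hsub, hyt⟩
    cases E <;> cases b <;> simp only [path, Path.vars, Step.vars, Finset.mem_union,
      Finset.notMem_empty, false_or] at h
    case exp.true =>
      obtain hyt | hy := h
      · exact ⟨[], p, _, _, _, rfl, rfl, hyt⟩
      · exact descend (fun _ => rfl) hy
    all_goals exact descend (fun _ => rfl) h

end ETree

namespace RawProof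

variable {P : RawProof L} {lev : ℕ → ℕ} {r s : Root L} {p q : List Bool} {a b y : ℕ}

/-- The place at which a tree of a pre-proof stands, in the sense of `roots`. -/
def Root.place : Root L → Place L
  | tree E => Place.tree E.Sh
  | pos C => Place.pos C.1.Sh C.2.Sh
  | neg C => Place.neg C.1.Sh C.2.Sh

theorem Root.In.mem_roots (h : r.In P) : (r.place, r.content) ∈ P.roots := by
  cases r
  · exact tree_mem_roots h
  · exact pos_mem_roots h
  · exact neg_mem_roots h

theorem exists_root_of_mem_roots {x : Place L × ETree L} (h : x ∈ P.roots) :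
    ∃ r : Root L, r.In P ∧ r.content = x.2 := by
  obtain ⟨E, hE, rfl⟩ | ⟨C, hC, rfl⟩ | ⟨C, hC, rfl⟩ := RawProof.mem_roots.1 h
  · exact ⟨.tree E, hE, rfl⟩
  · exact ⟨.pos C, hC, rfl⟩
  · exact ⟨.neg C, hC, rfl⟩

theorem AllAt.mem_occs (h : P.AllAt r p a) : (r.place, r.content.path p, a) ∈ P.occs := by
  obtain ⟨hr, A, E, hE⟩ := h
  exact RawProof.mem_occs.2 ⟨r.content, hr.mem_roots, ETree.path_mem_occs hE⟩

theorem exists_allAt_of_mem_EV (h : a ∈ P.EV) : ∃ r p, P.AllAt r p a := by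
  obtain ⟨π, p, ho⟩ := mem_EV_iff.1 h
  obtain ⟨E, hE, hp⟩ := mem_occs.1 ho
  obtain ⟨r, hr, rfl⟩ := exists_root_of_mem_roots hE
  obtain ⟨q, -, hq⟩ := ETree.exists_sub_of_mem_occs hp
  exact ⟨r, q, hr, hq⟩

theorem IsPreProof.lt_of_mem_deps (hP : P.IsPreProof) (ha : P.AllAt s q a)
    (hya : y ∈ s.place.formula.deps (s.content.path q)) (hy : P.AllAt r p y) :
    P.Lt (Node.expansion r p) (Node.expansion s q) := by
  obtain hya | hya := hya
  · obtain ⟨q₀, q', F, t, G, rfl, hsub, hyt⟩ := ETree.exists_sub_of_mem_vars_path hya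
    have ht : P.ExAt s q₀ t := ⟨ha.1, F, G, hsub⟩
    exact .tail (.single (.term hy ht hyt)) (.dominates (Or.inr ⟨t, ht⟩) (Or.inl ⟨a, ha⟩))
  · replace hya := NNF.fv_top_subset _ _ hya
    cases s with
    | tree E =>
      rw [Root.place, Place.formula, hP.closed _ (Multiset.mem_map_of_mem _ ha.1)] at hya
      exact hya.elim
    | pos C => exact .tail (.single (.cut_formula hy ha.1 hya)) (.in_pos ha.1 (Or.inl ⟨a, ha⟩))
    | neg C =>
      rw [Root.place, Place.formula, hP.cut_dual C ha.1, NNF.fv_dual] at hya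
      exact .tail (.single (.cut_formula hy ha.1 hya)) (.in_neg ha.1 (Or.inl ⟨a, ha⟩))

/-- The dependency relation on eigenvariables, each of which belongs to a single expansion of a
pre-proof. -/
def VarLt (P : RawProof L) (b a : ℕ) : Prop :=
  ∀ r p s q, P.AllAt r p b → P.AllAt s q a → P.Lt (Node.expansion r p) (Node.expansion s q)

theorem IsPreProof.varLt_of_mem_deps (hP : P.IsPreProof) {o : PlacedOcc L} (ho : o ∈ P.occs)
    (hy : y ∈ o.1.formula.deps o.2.1) : P.VarLt y o.2.2 := by
  intro r p s q hry hsa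
  rw [occ_eq_of_nodup_EV hP.regular ho hsa.mem_occs rfl] at hy
  exact hP.lt_of_mem_deps hsa hy hry

theorem VarLt.trans (hby : P.VarLt b y) (hy : y ∈ P.EV) (hya : P.VarLt y a) : P.VarLt b a := by
  obtain ⟨r', p', hy⟩ := exists_allAt_of_mem_EV hy
  exact fun r p s q hb ha => Relation.TransGen.trans (hby _ _ _ _ hb hy) (hya _ _ _ _ hy ha)

theorem IsProof.not_varLt_self (hP : P.IsProof) (ha : a ∈ P.EV) : ¬ P.VarLt a a := by
  obtain ⟨r, p, ha⟩ := exists_allAt_of_mem_EV ha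
  exact fun h => hP.acyclic _ (h r p r p ha ha)

/-- The eigenvariables on which the eigenvariable `y` depends, including `y` itself; empty if `y`
is not an eigenvariable. The level of `y` is the size of this set. -/
def lowerVars (P : RawProof L) (y : ℕ) : Set ℕ :=
  {b | b ∈ P.EV ∧ y ∈ P.EV ∧ (b = y ∨ P.VarLt b y)}

theorem IsProof.lowerVars_ssubset (hP : P.IsProof) (ha : a ∈ P.EV) (h : P.VarLt y a) :
    P.lowerVars y ⊂ P.lowerVars a := by
  refine (Set.ssubset_iff_of_subset ?_).2 ⟨a, ⟨ha, ha, Or.inl rfl⟩, ?_⟩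
  · rintro b ⟨hb, hy, rfl | hby⟩
    · exact ⟨hb, ha, Or.inr h⟩
    · exact ⟨hb, ha, Or.inr (hby.trans hy h)⟩
  · rintro ⟨-, hy, rfl | hay⟩
    · exact hP.not_varLt_self ha h
    · exact hP.not_varLt_self ha (hay.trans hy h)

theorem IsProof.isLeveled (hP : P.IsProof) : P.IsLeveled := by
  refine ⟨hP.preProof, ⟨fun y => (P.lowerVars y).ncard, fun o ho y hy => ?_⟩, hP.tautology⟩
  have ha : o.2.2 ∈ P.EV := mem_EV_iff.2 ⟨o.1, o.2.1, ho⟩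
  have hfinite : (P.lowerVars o.2.2).Finite :=
    (Multiset.finite_toSet P.EV).subset fun b hb => hb.1
  exact Set.ncard_lt_ncard (hP.lowerVars_ssubset ha (hP.preProof.varLt_of_mem_deps ho hy)) hfinite

/-- A rank that increases along the dependency relation of a cut-free pre-proof. The position is
extended by `true` so that the path includes the term of an `∃`-expansion at the position. -/
def rank (lev : ℕ → ℕ) : Node L → ℕ ×ₗ ℕ
  | Node.cut _ => toLex (0, 0)
  | Node.expansion r p =>
    toLex ((Path.vars (r.content.path (p ++ [true]))).sup fun y => lev y + 1, p.length)

theorem IsLevel.rank_lt_of_term (hlev : P.IsLevel lev) {t : L.Term ℕ} (ha : P.AllAt r p a)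
    (ht : P.ExAt s q t) (hat : a ∈ t.varFinset) :
    rank lev (Node.expansion r p) < rank lev (Node.expansion s q) := by
  have hpath (y) (hy : y ∈ Path.vars (r.content.path (p ++ [true]))) : lev y < lev a := by
    obtain ⟨-, A, E, hE⟩ := id ha
    refine hlev _ ha.mem_occs y (Or.inl ?_)
    simpa [ETree.path_append hE, ETree.path, Path.vars_append, Path.vars, Step.vars] using hy
  have hterm : a ∈ Path.vars (s.content.path (q ++ [true])) := by
    obtain ⟨-, F, G, hF⟩ := ht
    rw [ETree.path_append hF, Path.vars_append]
    exact Finset.mem_union_right _ (Finset.mem_union_left _ hat)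
  exact Prod.Lex.toLex_lt_toLex.2 (Or.inl ((Finset.sup_le hpath).trans_lt
    (Finset.le_sup (f := fun y => lev y + 1) hterm)))

theorem rank_lt_rank_append (lev : ℕ → ℕ) (r : Root L) (p q : List Bool) :
    rank lev (Node.expansion r p) < rank lev (Node.expansion r (p ++ true :: q)) := by
  have hsubset : Path.vars (r.content.path (p ++ [true])) ⊆
      Path.vars (r.content.path (p ++ true :: q ++ [true])) := by
    obtain ⟨l, hl⟩ := r.content.path_prefix_path_append (p ++ [true]) (q ++ [true])
    rw [show p ++ true :: q ++ [true] = p ++ [true] ++ (q ++ [true]) by simp, ← hl,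
      Path.vars_append]
    exact Finset.subset_union_left
  obtain hlt | heq := (Finset.sup_mono (f := fun y => lev y + 1) hsubset).lt_or_eq
  · exact Prod.Lex.toLex_lt_toLex.2 (Or.inl hlt)
  · exact Prod.Lex.toLex_lt_toLex.2 (Or.inr ⟨heq, by simp⟩)

theorem IsLeveled.isProof (hP : P.IsLeveled) (hfree : P.CutFree) : P.IsProof := by
  obtain ⟨lev, hlev⟩ := hP.level
  have hcut {C : Cut L} (hC : C ∈ P.cuts) : False := by simp [show P.cuts = 0 from hfree] at hC
  have hstep (x y) (h : P.Lt0 x y) : rank lev x < rank lev y := by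
    cases h with
    | term ha ht hat => exact hlev.rank_lt_of_term ha ht hat
    | dominates => exact rank_lt_rank_append lev _ _ _
    | in_pos hC | in_neg hC | cut_formula _ hC => exact (hcut hC).elim
  have hlt {x y} (h : P.Lt x y) : rank lev x < rank lev y := by
    induction h with
    | single h => exact hstep _ _ h
    | tail _ h ih => exact ih.trans (hstep _ _ h)
  exact ⟨hP.preProof, fun x h => (hlt h).false, hP.tautology⟩

end RawProof

end ExpansionCut

open ExpansionCut in
/-- Weak normalization of cut reduction for expansion proofs with cuts. -/
theorem theorem32 {L : FirstOrder.Language.{u, v}} (P : RawProof L) (hP : P.IsProof) :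
    ∃ Q : RawProof L, Q.IsProof ∧ Q.CutFree ∧ Q.Sh = P.Sh ∧ P.Reduces Q := by
  obtain ⟨Q, hQ, hfree, hSh, hred⟩ := hP.isLeveled.exists_reduces_cutFree
  exact ⟨Q, hQ.isProof hfree, hfree, hSh, hred⟩
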